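/- Let $\omega$ be a non-principal ultrafilter on $\mathbb N$ and let $(\lambda_k)$ be a real sequence with $\lambda_k\ge 1$ and $\lambda_k\to\infty$. Let $$\mathbb C_\omega=\{(a_k)\in\mathbb C^{\mathbb N} : \exists C>0\ \forall k\ |a_k|^{1/\lambda_k}<C\}/\sim_\omega,\qquad (a_k)\sim_\omega(b_k)\iff \omega\text{-}\lim_k |a_k-b_k|^{1/\lambda_k}=0,$$ which is a field under the termwise operations. Let $D_2(z)=\operatorname{Im}\mathrm{Li}_2(z)+\arg(1-z)\log|z|$ be the Bloch–Wigner function, extended continuously to $\mathbb C$. For $x\in\mathbb C_\omega$ put $D_2^\omega(x)=\omega\text{-}\lim_l D_2(x_l)$, where $(x_l)$ is any sequence representing $x$. For points $x_0,\dots,x_3\in\mathbb P^1(\mathbb C_\omega)$ put $$\mathrm{Vol}^\omega(x_0,x_1,x_2,x_3)=D_2^\omega\!\left(\frac{(x_0-x_2)(x_1-x_3)}{(x_0-x_3)(x_1-x_2)}\right)$$ if the four points are distinct, and $\mathrm{Vol}^\omega(x_0,x_1,x_2,x_3)=0$ otherwise. For four vectors $v_0,\dots,v_3$ spanning a finite-dimensional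 $\mathbb C_\omega$-vector space $V$, let $\mathrm{Vol}^\omega[V;(v_0,\dots,v_3)]$ be the value of $\mathrm{Vol}^\omega$ at the four lines spanned by the images of the $v_i$ under an isomorphism $V\cong\mathbb C_\omega^2$ if $\dim V=2$ and all $v_i\neq0$, and $0$ otherwise. Let $n$ be a natural number. A complete flag in $\mathbb C_\omega^n$ is a chain of subspaces $F^0\subset F^1\subset\dots\subset F^n$ with $\dim F^i=i$. An affine flag $(F,v)$ is a complete flag $F$ with vectors $v^1,\dots,v^n$ such that $F^i=\mathbb C_\omega v^i+F^{i-1}$ for $1\le i\le n$. Let $\mathscr F(n,\mathbb C_\omega)$ and $\mathscr F_{\mathrm{aff}}(n,\mathbb C_\omega)$ be the sets of complete flags and of affine flags, with the natural actions of $GL(n,\mathbb C_\omega)$. The $\omega$-Borel function $B_n^\omega:\mathscr F_{\mathrm{aff}}(n,\mathbb C_\omega)^4\to\mathbb R$ is $$B_n^\omega\big((F_0,v_0),\dots,(F_3,v_3)\big)=\sum_{\mathbf J\in\{0,\dots,n-1\}^4}\mathrm{Vol}^\omega\left[\frac{\langle F_0^{j_0+1},\dots,F_3^{j_3+1}\rangle}{\langle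 F_0^{j_0},\dots,F_3^{j_3}\rangle};\,(v_0^{j_0+1},\dots,v_3^{j_3+1})\right].$$ **Proposition.** The function $B_n^\omega$ is a bounded, alternating, strict $GL(n,\mathbb C_\omega)$-invariant cocycle on $\mathscr F_{\mathrm{aff}}(n,\mathbb C_\omega)^4$. That is, it is bounded, it changes by the sign of the permutation when its four arguments are permuted, and the following two identities hold for all tuples without exception: $$B_n^\omega(g\xi_0,\dots,g\xi_3)=B_n^\omega(\xi_0,\dots,\xi_3)\ \text{ for } g\in GL(n,\mathbb C_\omega),\qquad \sum_{i=0}^4(-1)^iB_n^\omega(\xi_0,\dots,\widehat{\xi_i},\dots,\xi_4)=0 .$$ Moreover $B_n^\omega$ depends only on the underlying flags, and so descends to a function on $\mathscr F(n,\mathbb C_\omega)^4$. The descended function is again a bounded, alternating, strict $GL(n,\mathbb C_\omega)$-invariant cocycle, and for all flags $F_0,\dots,F_3\in\mathscr F(n,\mathbb C_\omega)$ $$|B_n^\omega(F_0,\dots,F_3)|\le\frac{n(n^2-1)}{6}\,\nu_3,$$ where $\nu_3$ is the volume of a regular ideal tetrahedron in hyperbolic 3-space. -/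

import Mathlib

noncomputable section

namespace OmegaBorel

open Filter Topology MeasureTheory Module

/-! ### The asymptotic cone of the complex numbers -/

/-- A non-principal ultrafilter `ω` on `ℕ` and a real sequence `scale k ≥ 1` that diverges to
infinity. -/
structure ScalingData where
  ω : Ultrafilter ℕ
  nonprincipal : ∀ k : ℕ, ω ≠ pure k
  scale : ℕ → ℝ
  one_le_scale : ∀ k, 1 ≤ scale k
  tendsto_scale : Tendsto scale atTop atTop

namespace ScalingData

variable (S : ScalingData)

/-- The rescaled absolute value `|a_k|^(1/λ_k)`. -/
def size (a : ℕ → ℂ) (k : ℕ) : ℝ := ‖a k‖ ^ (1 / S.scale k)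

lemma exponent_pos (k : ℕ) : 0 < 1 / S.scale k :=
  one_div_pos.mpr (lt_of_lt_of_le one_pos (S.one_le_scale k))

lemma exponent_le_one (k : ℕ) : 1 / S.scale k ≤ 1 := by
  rw [div_le_one (lt_of_lt_of_le one_pos (S.one_le_scale k))]
  exact S.one_le_scale k

lemma size_nonneg (a : ℕ → ℂ) (k : ℕ) : 0 ≤ S.size a k := Real.rpow_nonneg (norm_nonneg _) _

lemma size_zero (k : ℕ) : S.size 0 k = 0 := by
  simp [size, Real.zero_rpow (S.exponent_pos k).ne', -one_div]

lemma size_one (k : ℕ) : S.size 1 k = 1 := by simp [size]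

lemma size_neg (a : ℕ → ℂ) (k : ℕ) : S.size (-a) k = S.size a k := by simp [size]

lemma size_mul (a b : ℕ → ℂ) (k : ℕ) : S.size (a * b) k = S.size a k * S.size b k := by
  simp [size, Real.mul_rpow (norm_nonneg _) (norm_nonneg _)]

lemma size_add_le (a b : ℕ → ℂ) (k : ℕ) : S.size (a + b) k ≤ S.size a k + S.size b k := by
  have h1 : ‖(a + b) k‖ ≤ ‖a k‖ + ‖b k‖ := norm_add_le _ _
  calc S.size (a + b) k ≤ (‖a k‖ + ‖b k‖) ^ (1 / S.scale k) :=
        Real.rpow_le_rpow (norm_nonneg _) h1 (S.exponent_pos k).le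
    _ ≤ _ := Real.rpow_add_le_add_rpow (norm_nonneg _) (norm_nonneg _)
        (S.exponent_pos k).le (S.exponent_le_one k)

/-- The ring of sequences `a` for which `|a_k|^(1/λ_k)` is bounded. -/
def boundedSeq : Subring (ℕ → ℂ) where
  carrier := {a | ∃ C > 0, ∀ k, ‖a k‖ ^ (1 / S.scale k) < C}
  mul_mem' := by
    rintro a b ⟨C, hC, ha⟩ ⟨D, hD, hb⟩
    refine ⟨C * D, mul_pos hC hD, fun k => ?_⟩
    have := S.size_mul a b k
    simp only [size] at this
    rw [this]
    exact mul_lt_mul'' (ha k) (hb k) (S.size_nonneg a k) (S.size_nonneg b k)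
  one_mem' := ⟨2, two_pos, fun k => by simp⟩
  add_mem' := by
    rintro a b ⟨C, hC, ha⟩ ⟨D, hD, hb⟩
    exact ⟨C + D, add_pos hC hD, fun k =>
      (S.size_add_le a b k).trans_lt (add_lt_add (ha k) (hb k))⟩
  zero_mem' := ⟨1, one_pos, fun k => by
    have := S.size_zero k
    simp only [size] at this
    rw [this]
    exact one_pos⟩
  neg_mem' := by
    rintro a ⟨C, hC, ha⟩
    exact ⟨C, hC, fun k => by simpa using ha k⟩

/-- The ideal of sequences `a` with `ω-lim |a_k|^(1/λ_k) = 0`. -/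
def nullIdeal : Ideal S.boundedSeq where
  carrier := {a | Tendsto (fun k => ‖(a : ℕ → ℂ) k‖ ^ (1 / S.scale k)) S.ω (𝓝 0)}
  add_mem' := by
    intro a b ha hb
    have h : Tendsto (fun k => S.size a k + S.size b k) S.ω (𝓝 0) := by
      have ha' : Tendsto (fun k => S.size a k) S.ω (𝓝 0) := ha
      have hb' : Tendsto (fun k => S.size b k) S.ω (𝓝 0) := hb
      simpa using ha'.add hb'
    exact squeeze_zero (fun k => S.size_nonneg _ k) (fun k => S.size_add_le _ _ k) h
  zero_mem' := by
    have : (fun k => S.size 0 k) = fun _ => 0 := funext S.size_zero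
    change Tendsto (fun k => S.size 0 k) S.ω (𝓝 0)
    rw [this]
    exact tendsto_const_nhds
  smul_mem' := by
    rintro ⟨c, C, hC, hc⟩ a ha
    have h : Tendsto (fun k => C * S.size a k) S.ω (𝓝 0) := by
      have ha' : Tendsto (fun k => S.size a k) S.ω (𝓝 0) := ha
      simpa using ha'.const_mul C
    refine squeeze_zero (fun k => S.size_nonneg _ k) (fun k => ?_) h
    change S.size (c * (a : ℕ → ℂ)) k ≤ _
    rw [S.size_mul]
    exact mul_le_mul_of_nonneg_right (hc k).le (S.size_nonneg _ k)

instance nullIdeal_isMaximal : S.nullIdeal.IsMaximal := by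
  rw [Ideal.isMaximal_iff]
  constructor
  · intro h
    have h1 : Tendsto (fun k => S.size 1 k) S.ω (𝓝 0) := h
    rw [show (fun k => S.size 1 k) = fun _ => (1 : ℝ) from funext S.size_one] at h1
    exact one_ne_zero (tendsto_nhds_unique tendsto_const_nhds h1)
  · intro J x hJ hx hxJ
    have hx' : ¬ Tendsto (fun k => S.size x k) S.ω (𝓝 0) := hx
    obtain ⟨ε, hε, hev⟩ : ∃ ε > 0, ∀ᶠ k in (S.ω : Filter ℕ), ε ≤ S.size x k := by
      by_contra! hcon
      refine hx' (Metric.tendsto_nhds.mpr fun ε hε => ?_)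
      refine (hcon ε hε).mono fun k hk => ?_
      simpa [Real.dist_eq, abs_of_nonneg (S.size_nonneg _ k)] using hk
    classical
    let y : ℕ → ℂ := fun k => if ε ≤ S.size x k then ((x : ℕ → ℂ) k)⁻¹ else 0
    have hy : y ∈ S.boundedSeq := by
      refine ⟨ε⁻¹ + 1, by positivity, fun k => ?_⟩
      by_cases hk : ε ≤ S.size x k
      · have : ‖y k‖ ^ (1 / S.scale k) = (S.size x k)⁻¹ := by
          have hyk : y k = ((x : ℕ → ℂ) k)⁻¹ := if_pos hk
          rw [hyk, norm_inv]
          exact Real.inv_rpow (norm_nonneg _) _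
        rw [this]
        have := inv_anti₀ hε hk
        linarith
      · have : ‖y k‖ ^ (1 / S.scale k) = 0 := by
          simp only [y, if_neg hk, norm_zero]
          exact Real.zero_rpow (S.exponent_pos k).ne'
        rw [this]
        positivity
    have hnull : 1 - ⟨y, hy⟩ * x ∈ S.nullIdeal := by
      refine Tendsto.congr' ?_ tendsto_const_nhds
      filter_upwards [hev] with k hk
      have hx0 : (x : ℕ → ℂ) k ≠ 0 := by
        intro h0
        have : S.size x k = 0 := by
          simp only [size, h0, norm_zero]
          exact Real.zero_rpow (S.exponent_pos k).ne'
        linarith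
      have : ((1 - ⟨y, hy⟩ * x : S.boundedSeq) : ℕ → ℂ) k = 0 := by
        change 1 - y k * (x : ℕ → ℂ) k = 0
        simp only [y, if_pos hk]
        rw [inv_mul_cancel₀ hx0, sub_self]
      rw [this, norm_zero, Real.zero_rpow (S.exponent_pos k).ne']
    have := J.add_mem (hJ hnull) (J.mul_mem_left ⟨y, hy⟩ hxJ)
    simpa using this

/-- The field `ℂ_ω`: bounded sequences modulo null sequences. -/
def Cone : Type := S.boundedSeq ⧸ S.nullIdeal

instance : Field S.Cone := Ideal.Quotient.field S.nullIdeal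

/-- The class `[(a_k)]` of a bounded sequence. -/
def toCone : S.boundedSeq →+* S.Cone := Ideal.Quotient.mk S.nullIdeal

lemma toCone_surjective : Function.Surjective S.toCone := Ideal.Quotient.mk_surjective

/-- A sequence representing an element of `ℂ_ω`. -/
def representative (x : S.Cone) : ℕ → ℂ := (Function.surjInv S.toCone_surjective x).1

end ScalingData

/-! ### The Bloch–Wigner function and its `ω`-version -/

/-- The principal branch of the dilogarithm, `Li₂(z) = -∫₀^z log(1-u)/u du` along the segment
`u = tz`. On the cut `[1, ∞)` this is one of the two one-sided boundary values. -/
def dilog (z : ℂ) : ℂ := -∫ t in (0 : ℝ)..1, Complex.log (1 - t * z) / t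

/-- The Bloch–Wigner function `D₂(z) = Im Li₂(z) + arg(1-z) log|z|`. With the principal branches
the formula gives the continuous extension also at `0` and on the cut `[1, ∞)`, where it is `0`. -/
def blochWigner (z : ℂ) : ℝ := (dilog z).im + Complex.arg (1 - z) * Real.log ‖z‖

/-- The `ω`-Bloch–Wigner function on `ℂ_ω`: the `ω`-limit of `D₂` along a representing sequence. -/
def omegaBlochWigner (S : ScalingData) (x : S.Cone) : ℝ :=
  limUnder (S.ω : Filter ℕ) fun l => blochWigner (S.representative x l)

/-! ### Cross ratio and volume on the projective line -/

section Projective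

variable {K : Type*} [Field K]

/-- The determinant of two vectors of `K²`; for `(x,1)`, `(y,1)` it is `x - y`. -/
def det₂ (v w : Fin 2 → K) : K := v 0 * w 1 - v 1 * w 0

/-- The cross ratio `(x₀-x₂)(x₁-x₃) / ((x₀-x₃)(x₁-x₂))` in homogeneous coordinates. -/
def crossRatio (x : Fin 4 → Projectivization K (Fin 2 → K)) : K :=
  (det₂ (x 0).rep (x 2).rep * det₂ (x 1).rep (x 3).rep) /
    (det₂ (x 0).rep (x 3).rep * det₂ (x 1).rep (x 2).rep)

/-- The cross ratio may be computed with any homogeneous coordinates. -/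
lemma crossRatio_mk (v : Fin 4 → Fin 2 → K) (hv : ∀ i, v i ≠ 0) :
    crossRatio (fun i => Projectivization.mk K (v i) (hv i)) =
      (det₂ (v 0) (v 2) * det₂ (v 1) (v 3)) / (det₂ (v 0) (v 3) * det₂ (v 1) (v 2)) := by
  have h := fun i => Projectivization.exists_smul_eq_mk_rep K (v i) (hv i)
  choose a ha using h
  have key : ∀ i j, det₂ (a i • v i) (a j • v j) = (a i : K) * a j * det₂ (v i) (v j) := by
    intro i j
    simp only [det₂, Pi.smul_apply, Units.smul_def, smul_eq_mul]
    ring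
  simp only [crossRatio, ← ha, key]
  rw [show (a 0 : K) * a 2 * det₂ (v 0) (v 2) * (a 1 * a 3 * det₂ (v 1) (v 3)) =
      ((a 0 : K) * a 1 * a 2 * a 3) * (det₂ (v 0) (v 2) * det₂ (v 1) (v 3)) by ring,
    show (a 0 : K) * a 3 * det₂ (v 0) (v 3) * (a 1 * a 2 * det₂ (v 1) (v 2)) =
      ((a 0 : K) * a 1 * a 2 * a 3) * (det₂ (v 0) (v 3) * det₂ (v 1) (v 2)) by ring]
  exact mul_div_mul_left _ _ (by simp)

end Projective

open Classical in
/-- The `ω`-volume of a 4-tuple of points of `ℙ¹(ℂ_ω)`: it is `D₂^ω` of the cross ratio when the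
points are distinct, and `0` otherwise. -/
def omegaVol (S : ScalingData) (x : Fin 4 → Projectivization S.Cone (Fin 2 → S.Cone)) : ℝ :=
  if Function.Injective x then omegaBlochWigner S (crossRatio x) else 0

open Classical in
/-- The `ω`-volume `Vol^ω[V; (v₀,…,v₃)]` of four vectors spanning a finite-dimensional vector
space: it is `0` unless `V` has dimension `2` and all the vectors are nonzero, in which case it is
the `ω`-volume of the four lines, read in `ℂ_ω²` through a chosen isomorphism. -/
def omegaVolVectors (S : ScalingData) {V : Type} [AddCommGroup V] [Module S.Cone V]
    [Module.Finite S.Cone V] (v : Fin 4 → V) : ℝ :=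
  if h : finrank S.Cone V = 2 ∧ ∀ i, v i ≠ 0 then
    omegaVol S fun i => Projectivization.mk S.Cone ((finBasisOfFinrankEq S.Cone V h.1).equivFun (v i))
      (by simpa using h.2 i)
  else 0

/-! ### Flags and affine flags -/

section Flags

variable {K : Type*} [Field K] {n : ℕ}

variable (K n) in
/-- A complete flag `F⁰ ⊂ F¹ ⊂ ⋯ ⊂ Fⁿ` in `Kⁿ`, with `dim Fⁱ = i`. -/
@[ext]
structure CompleteFlag where
  space : Fin (n + 1) → Submodule K (Fin n → K)
  mono : Monotone space
  finrank_space : ∀ i, finrank K (space i) = i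

variable (K n) in
/-- An affine flag: a complete flag with vectors `v¹,…,vⁿ` such that `Fⁱ = K vⁱ + Fⁱ⁻¹` for
`1 ≤ i ≤ n`. The vector `vⁱ⁺¹` is `vec i`, for `i : Fin n`. -/
@[ext]
structure AffineFlag extends CompleteFlag K n where
  vec : Fin n → Fin n → K
  space_succ : ∀ i : Fin n,
    space i.succ = Submodule.span K {vec i} ⊔ space i.castSucc

lemma AffineFlag.vec_mem (F : AffineFlag K n) (i : Fin n) : F.vec i ∈ F.space i.succ := by
  rw [F.space_succ]
  exact Submodule.mem_sup_left (Submodule.mem_span_singleton_self _)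

/-- The linear automorphism of `Kⁿ` given by a matrix of `GL(n, K)`. -/
def glEquiv (g : GL (Fin n) K) : (Fin n → K) ≃ₗ[K] (Fin n → K) :=
  LinearEquiv.ofLinearMap (Matrix.mulVecLin g.1) (Matrix.mulVecLin g⁻¹.1)
    (by rw [← Matrix.mulVecLin_mul, Units.mul_inv, Matrix.mulVecLin_one])
    (by rw [← Matrix.mulVecLin_mul, Units.inv_mul, Matrix.mulVecLin_one])

lemma glEquiv_apply (g : GL (Fin n) K) (v : Fin n → K) : glEquiv g v = g.1.mulVec v := rfl

lemma map_glEquiv_one (W : Submodule K (Fin n → K)) :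
    W.map (glEquiv (1 : GL (Fin n) K)).toLinearMap = W := by
  rw [show (glEquiv (1 : GL (Fin n) K)).toLinearMap = LinearMap.id from
    LinearMap.ext fun v => by simp [glEquiv_apply], Submodule.map_id]

lemma map_glEquiv_mul (g h : GL (Fin n) K) (W : Submodule K (Fin n → K)) :
    W.map (glEquiv (g * h)).toLinearMap =
      (W.map (glEquiv h).toLinearMap).map (glEquiv g).toLinearMap := by
  rw [show (glEquiv (g * h)).toLinearMap = (glEquiv g).toLinearMap ∘ₗ (glEquiv h).toLinearMap from
    LinearMap.ext fun v => by simp [glEquiv_apply], Submodule.map_comp]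

/-- The action `g • F = (gF⁰ ⊂ ⋯ ⊂ gFⁿ)` of `GL(n, K)` on complete flags. -/
instance : MulAction (GL (Fin n) K) (CompleteFlag K n) where
  smul g F :=
    { space := fun i => (F.space i).map (glEquiv g).toLinearMap
      mono := fun _ _ hij => Submodule.map_mono (F.mono hij)
      finrank_space := fun i => by
        rw [LinearEquiv.finrank_map_eq]
        exact F.finrank_space i }
  one_smul F := CompleteFlag.ext (funext fun i => map_glEquiv_one (F.space i))
  mul_smul g h F := CompleteFlag.ext (funext fun i => map_glEquiv_mul g h (F.space i))

/-- The action of `GL(n, K)` on affine flags, by moving both the subspaces and the vectors. -/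
instance : MulAction (GL (Fin n) K) (AffineFlag K n) where
  smul g F :=
    { toCompleteFlag := g • F.toCompleteFlag
      vec := fun i => glEquiv g (F.vec i)
      space_succ := fun i => by
        change (F.space i.succ).map (glEquiv g).toLinearMap =
          _ ⊔ (F.space i.castSucc).map (glEquiv g).toLinearMap
        rw [F.space_succ i, Submodule.map_sup, Submodule.map_span, Set.image_singleton]
        rfl }
  one_smul F := AffineFlag.ext (funext fun i => map_glEquiv_one (F.space i))
    (funext fun i => by change glEquiv 1 (F.vec i) = F.vec i; simp [glEquiv_apply])
  mul_smul g h F := AffineFlag.ext (funext fun i => map_glEquiv_mul g h (F.space i))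
    (funext fun i => by
      change glEquiv (g * h) (F.vec i) = glEquiv g (glEquiv h (F.vec i))
      simp [glEquiv_apply])

/-- The subspace `⟨F₀^{j₀+1}, …, F₃^{j₃+1}⟩`. -/
def upperSpan (F : Fin 4 → AffineFlag K n) (J : Fin 4 → Fin n) : Submodule K (Fin n → K) :=
  ⨆ i, (F i).space (J i).succ

/-- The subspace `⟨F₀^{j₀}, …, F₃^{j₃}⟩`. -/
def lowerSpan (F : Fin 4 → AffineFlag K n) (J : Fin 4 → Fin n) : Submodule K (Fin n → K) :=
  ⨆ i, (F i).space (J i).castSucc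

/-- The quotient space `⟨F₀^{j₀+1}, …, F₃^{j₃+1}⟩ / ⟨F₀^{j₀}, …, F₃^{j₃}⟩`. -/
abbrev SpanQuotient (F : Fin 4 → AffineFlag K n) (J : Fin 4 → Fin n) : Type _ :=
  upperSpan F J ⧸ (lowerSpan F J).submoduleOf (upperSpan F J)

/-- The images of the vectors `v₀^{j₀+1}, …, v₃^{j₃+1}` in the quotient space. -/
def quotientVec (F : Fin 4 → AffineFlag K n) (J : Fin 4 → Fin n) (i : Fin 4) :
    SpanQuotient F J :=
  Submodule.Quotient.mk ⟨(F i).vec (J i),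
    le_iSup (fun i => (F i).space (J i).succ) i ((F i).vec_mem (J i))⟩

end Flags

/-- The `ω`-Borel function `B_n^ω` of degree `n`. -/
def omegaBorel (S : ScalingData) (n : ℕ) (F : Fin 4 → AffineFlag S.Cone n) : ℝ :=
  ∑ J : Fin 4 → Fin n, omegaVolVectors S (quotientVec F J)

/-! ### Cocycles and the volume of the regular ideal tetrahedron -/

/-- A real function on `(k+1)`-tuples of points of a `G`-set `X` is a bounded, alternating, strict
`G`-invariant cocycle. Strict: invariance and the cocycle identity hold for all tuples without
exception. -/
structure IsBoundedAlternatingInvariantCocycle (G : Type*) {X : Type*} [Group G] [MulAction G X]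
    {k : ℕ} (f : (Fin (k + 1) → X) → ℝ) : Prop where
  bounded : ∃ C : ℝ, ∀ x, |f x| ≤ C
  alternating : ∀ (σ : Equiv.Perm (Fin (k + 1))) (x : Fin (k + 1) → X),
    f (x ∘ σ) = ((Equiv.Perm.sign σ : ℤ) : ℝ) * f x
  invariant : ∀ (g : G) (x : Fin (k + 1) → X), f (fun i => g • x i) = f x
  cocycle : ∀ x : Fin (k + 2) → X,
    ∑ i : Fin (k + 2), (-1 : ℝ) ^ (i : ℕ) * f (x ∘ i.succAbove) = 0

/-- The hyperbolic volume of a subset of the upper half-space `{(z, t) | t > 0}` in `ℂ × ℝ`, with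
metric `(|dz|² + dt²) / t²`. -/
def hyperbolicVolume (A : Set (ℂ × ℝ)) : ENNReal := ∫⁻ p in A, ENNReal.ofReal (1 / p.2 ^ 3)

/-- The regular ideal tetrahedron with vertices `∞` and the three cube roots of unity: the region
above the unit hemisphere and over the equilateral triangle spanned by the roots of unity. -/
def regularIdealTetrahedron : Set (ℂ × ℝ) :=
  {p | p.1 ∈ convexHull ℝ {z : ℂ | z ^ 3 = 1} ∧ 0 < p.2 ∧ 1 ≤ ‖p.1‖ ^ 2 + p.2 ^ 2}

/-- The volume `ν₃` of a regular ideal tetrahedron in hyperbolic 3-space. -/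
def nu₃ : ℝ := (hyperbolicVolume regularIdealTetrahedron).toReal

end OmegaBorel

end

noncomputable section
namespace OmegaBorel
open Filter Topology MeasureTheory Module

/-! The algebraic half uses only three properties of $f=D_2^\omega$, bundled in `IsBlochFunction`:
$f(x^{-1})=-f(x)$, $f(1-x)=-f(x)$ and the five-term relation. With the convention $a/0=0$ they force
$f(0)=0$. So `cross` is alternating, vanishes as soon as two of the four lines coincide, and
satisfies the cocycle identity for any five nonzero vectors of the plane (`cross_five_term`).

For general $n$ the heart is the local identity `sum_volDefect`. For five vectors $v_i$ and a
subspace $L$, the alternating sum over $i$ of the volume of the other four modulo $L$ minus their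
volume modulo $L+Kv_i$ is zero. Only the cases where the $v_i$ have rank 2 or 3 modulo $L$ matter.
Rank 2 is the five-term relation. In rank 3 the generic case concerns five points of the projective
plane, the cross ratio of four of them being taken as seen from the fifth; Gale duality turns these
into the cross ratios of five points on a line. Now sum over all five positions in five flags.
Replacing $L$ by $L+Kv_i$ advances the $i$-th flag by one step, so the sum over that position
telescopes to the Borel function of the other four flags (`affineBorel_cocycle`). Two affine
structures on a flag differ by nonzero scalars modulo the previous step, which lies in $L$
(`affineBorel_congr`).

The bound is the product of $\sup|f|$ and the number of nonzero terms. A telescoping count of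
codimensions shows that at most $\binom{n+1}{3}=n(n^2-1)/6$ terms are nonzero (`card_goodIndex_le`).

The analytic half establishes these properties for $D_2$. Its differential is
$\log|z|\,d\arg(1-z)-\log|1-z|\,d\arg z$, which yields all functional equations: the differentials
cancel and one value is known. As $D_2$ vanishes on $\mathbb R$ and at infinity, its extrema are
critical points, that is $(1\pm i\sqrt3)/2$. The maximal value and $\nu_3$ both equal
$-3\int_0^{\pi/3}\log(2\sin u)\,du$ (`abs_blochWigner_le`, `nu₃_eq`). Uniform continuity makes
$D_2^\omega$ independent of representatives, and the equations and the bound pass to the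
$\omega$-limit (`isBlochFunction_omegaBlochWigner`). -/

/-! ### Bloch functions and the cocycle of four points on the projective line -/

/-- A function with the symmetries and the five-term relation of the Bloch–Wigner function. -/
structure IsBlochFunction {K : Type*} [Field K] (f : K → ℝ) : Prop where
  map_inv : ∀ x, f x⁻¹ = -f x
  map_one_sub : ∀ x, f (1 - x) = -f x
  five_term : ∀ x y, x ≠ 0 → x ≠ 1 → y ≠ 0 → y ≠ 1 → x ≠ y →
    f x - f y + f (y / x) - f ((1 - x⁻¹) / (1 - y⁻¹)) + f ((1 - x) / (1 - y)) = 0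

section Line

variable {K : Type*} [Field K] {f : K → ℝ}

/-- Oddness under inversion, with $0^{-1}=0$. Thanks to this value, a cross ratio with zero
denominator contributes nothing. -/
lemma IsBlochFunction.map_zero (hf : IsBlochFunction f) : f 0 = 0 := by
  have := hf.map_inv 0
  rw [inv_zero] at this
  linarith

lemma det₂_swap (v w : Fin 2 → K) : det₂ v w = -det₂ w v := by
  simp only [det₂]; ring

lemma det₂_self (v : Fin 2 → K) : det₂ v v = 0 := by
  simp only [det₂]; ring

lemma det₂_smul_left (c : K) (v w : Fin 2 → K) : det₂ (c • v) w = c * det₂ v w := by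
  simp only [det₂, Pi.smul_apply, smul_eq_mul]; ring

lemma det₂_smul_right (c : K) (v w : Fin 2 → K) : det₂ v (c • w) = c * det₂ v w := by
  simp only [det₂, Pi.smul_apply, smul_eq_mul]; ring

/-- The three-term Plücker relation: it turns one minus a cross ratio into the cross ratio of the
points with the middle two exchanged. -/
lemma det₂_plucker (a b c d : Fin 2 → K) :
    det₂ a d * det₂ b c - det₂ a c * det₂ b d = -(det₂ a b * det₂ c d) := by
  simp only [det₂]; ring

lemma exists_smul_of_det₂_eq_zero {a b : Fin 2 → K} (ha : a ≠ 0) (hb : b ≠ 0)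
    (h : det₂ a b = 0) : ∃ c : K, c ≠ 0 ∧ b = c • a := by
  have key : ∃ c : K, b = c • a := by
    simp only [det₂] at h
    by_cases h0 : a 0 = 0
    · have h1 : a 1 ≠ 0 := fun h1 => ha (by ext i; fin_cases i <;> simp [h0, h1])
      refine ⟨b 1 / a 1, ?_⟩
      have hb0 : b 0 = 0 := by
        rw [h0, zero_mul, zero_sub, neg_eq_zero] at h
        exact (mul_eq_zero.mp h).resolve_left h1
      ext i
      fin_cases i <;> simp [h0, hb0, h1]
    · refine ⟨b 0 / a 0, ?_⟩
      ext i
      fin_cases i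
      · simp [h0]
      · simp only [Fin.mk_one, Pi.smul_apply, smul_eq_mul]
        field_simp
        linear_combination h
  obtain ⟨c, rfl⟩ := key
  exact ⟨c, fun hc => hb (by simp [hc]), rfl⟩

/-- The value of `f` at the cross ratio of four vectors of `K²`. -/
def cross (f : K → ℝ) (a b c d : Fin 2 → K) : ℝ :=
  f (det₂ a c * det₂ b d / (det₂ a d * det₂ b c))

lemma cross_congr_of_det₂ {a b c d a' b' c' d' : Fin 2 → K} {r : K} (hr : r ≠ 0)
    (h₁ : det₂ a' c' = r * det₂ a c) (h₂ : det₂ b' d' = r * det₂ b d)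
    (h₃ : det₂ a' d' = r * det₂ a d) (h₄ : det₂ b' c' = r * det₂ b c) :
    cross f a' b' c' d' = cross f a b c d := by
  simp only [cross, h₁, h₂, h₃, h₄]
  rw [show r * det₂ a c * (r * det₂ b d) = (r * r) * (det₂ a c * det₂ b d) by ring,
    show r * det₂ a d * (r * det₂ b c) = (r * r) * (det₂ a d * det₂ b c) by ring,
    mul_div_mul_left _ _ (mul_ne_zero hr hr)]

lemma cross_smul₀ {r : K} (hr : r ≠ 0) (a b c d : Fin 2 → K) :
    cross f (r • a) b c d = cross f a b c d := by
  simp only [cross, det₂_smul_left]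
  rw [mul_assoc, mul_assoc, mul_div_mul_left _ _ hr]

lemma cross_swap₀₁ (hf : IsBlochFunction f) (a b c d : Fin 2 → K) :
    cross f b a c d = -cross f a b c d := by
  rw [cross, cross, ← hf.map_inv, inv_div]
  congr 1
  rw [mul_comm (det₂ b c), mul_comm (det₂ b d)]

lemma cross_swap₂₃ (hf : IsBlochFunction f) (a b c d : Fin 2 → K) :
    cross f a b d c = -cross f a b c d := by
  rw [cross, cross, ← hf.map_inv, inv_div]

lemma cross_swap₁₂ (hf : IsBlochFunction f) (a b c d : Fin 2 → K) :
    cross f a c b d = -cross f a b c d := by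
  by_cases h : det₂ a d * det₂ b c = 0
  -- Both quotients then have denominator zero, so both sides are $f(0)=0$.
  · have h' : det₂ a d * det₂ c b = 0 := by
      rw [det₂_swap c b, mul_neg, h, neg_zero]
    simp [cross, h, h', hf.map_zero]
  · rw [cross, cross, ← hf.map_one_sub, one_sub_div h, det₂_plucker, det₂_swap c b, mul_neg,
      div_neg, neg_div]

lemma cross_smul₁ (hf : IsBlochFunction f) {r : K} (hr : r ≠ 0) (a b c d : Fin 2 → K) :
    cross f a (r • b) c d = cross f a b c d := by
  rw [← neg_inj, ← cross_swap₀₁ hf, cross_smul₀ hr, cross_swap₀₁ hf]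

lemma cross_smul₂ (hf : IsBlochFunction f) {r : K} (hr : r ≠ 0) (a b c d : Fin 2 → K) :
    cross f a b (r • c) d = cross f a b c d := by
  rw [← neg_inj, ← cross_swap₁₂ hf, cross_smul₁ hf hr, cross_swap₁₂ hf]

lemma cross_smul₃ (hf : IsBlochFunction f) {r : K} (hr : r ≠ 0) (a b c d : Fin 2 → K) :
    cross f a b c (r • d) = cross f a b c d := by
  rw [← neg_inj, ← cross_swap₂₃ hf, cross_smul₂ hf hr, cross_swap₂₃ hf]

/-- Coincident lines make the quotient 0, either honestly or through a zero denominator, or 1. The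
value 1 can come only from the first or the last pair, and the middle transposition moves it to 0.
-/
lemma cross_eq_zero (hf : IsBlochFunction f) {a b c d : Fin 2 → K}
    (h : det₂ a b = 0 ∨ det₂ a c = 0 ∨ det₂ a d = 0 ∨ det₂ b c = 0 ∨ det₂ b d = 0 ∨
      det₂ c d = 0) : cross f a b c d = 0 := by
  rcases h with h | h | h | h | h | h
  · rw [← neg_eq_zero, ← cross_swap₁₂ hf, cross, h, zero_mul, zero_div, hf.map_zero]
  · rw [cross, h, zero_mul, zero_div, hf.map_zero]
  · rw [cross, h, zero_mul, div_zero, hf.map_zero]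
  · rw [cross, h, mul_zero, div_zero, hf.map_zero]
  · rw [cross, h, mul_zero, zero_div, hf.map_zero]
  · rw [← neg_eq_zero, ← cross_swap₁₂ hf, cross, h, mul_zero, zero_div, hf.map_zero]

/-- The five-term relation for pairwise independent vectors. -/
lemma cross_five_term_of_det₂_ne_zero (hf : IsBlochFunction f) {a b c d e : Fin 2 → K}
    (hab : det₂ a b ≠ 0) (hac : det₂ a c ≠ 0) (had : det₂ a d ≠ 0) (hae : det₂ a e ≠ 0)
    (hbc : det₂ b c ≠ 0) (hbd : det₂ b d ≠ 0) (hbe : det₂ b e ≠ 0) (hcd : det₂ c d ≠ 0)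
    (hce : det₂ c e ≠ 0) (hde : det₂ d e ≠ 0) :
    cross f b c d e - cross f a c d e + cross f a b d e - cross f a b c e + cross f a b c d = 0 := by
  -- With `x` and `y` the cross ratios of $(a,b,c,d)$ and $(a,b,c,e)$, the other arguments of the
  -- five-term relation are the three remaining cross ratios, two of them inverted.
  set x := det₂ a c * det₂ b d / (det₂ a d * det₂ b c) with hx
  set y := det₂ a c * det₂ b e / (det₂ a e * det₂ b c) with hy
  have hx0 : x ≠ 0 := by positivity
  have hy0 : y ≠ 0 := by positivity
  have h1x : 1 - x = -(det₂ a b * det₂ c d) / (det₂ a d * det₂ b c) := by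
    rw [hx, one_sub_div (mul_ne_zero had hbc), det₂_plucker]
  have h1y : 1 - y = -(det₂ a b * det₂ c e) / (det₂ a e * det₂ b c) := by
    rw [hy, one_sub_div (mul_ne_zero hae hbc), det₂_plucker]
  have hx1 : x ≠ 1 := by
    intro h
    rw [h, sub_self, eq_comm, div_eq_zero_iff] at h1x
    simp_all
  have hy1 : y ≠ 1 := by
    intro h
    rw [h, sub_self, eq_comm, div_eq_zero_iff] at h1y
    simp_all
  have hxi : 1 - x⁻¹ = -(1 - x) / x := by field_simp; ring
  have hyi : 1 - y⁻¹ = -(1 - y) / y := by field_simp; ring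
  have hyx : y / x = det₂ a d * det₂ b e / (det₂ a e * det₂ b d) := by
    rw [hx, hy]; field_simp
  have hxy : x ≠ y := by
    intro h
    have h1 : det₂ a d * det₂ b e - det₂ a e * det₂ b d = 0 := by
      rw [h, div_self hy0, eq_div_iff (mul_ne_zero hae hbd)] at hyx
      linear_combination -hyx
    have := det₂_plucker a b d e
    have : det₂ a b * det₂ d e = 0 := by linear_combination h1 + this
    exact mul_ne_zero hab hde this
  have h3 : (1 - x⁻¹) / (1 - y⁻¹) = (det₂ b d * det₂ c e / (det₂ b e * det₂ c d))⁻¹ := by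
    rw [hxi, hyi, h1x, h1y, hx, hy]; field_simp
  have h4 : (1 - x) / (1 - y) = (det₂ a d * det₂ c e / (det₂ a e * det₂ c d))⁻¹ := by
    rw [h1x, h1y]; field_simp
  have := hf.five_term x y hx0 hx1 hy0 hy1 hxy
  rw [h3, h4, hyx, hf.map_inv, hf.map_inv] at this
  simp only [cross]
  linarith

set_option linter.unusedSimpArgs false in
/-- The strict cocycle identity on the projective line. -/
lemma cross_five_term (hf : IsBlochFunction f) {a b c d e : Fin 2 → K}
    (ha : a ≠ 0) (hb : b ≠ 0) (hc : c ≠ 0) (hd : d ≠ 0) (he : e ≠ 0) :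
    cross f b c d e - cross f a c d e + cross f a b d e - cross f a b c e + cross f a b c d = 0 := by
  have s₀ := cross_swap₀₁ hf
  have s₁ := cross_swap₁₂ hf
  have s₂ := cross_swap₂₃ hf
  have z : ∀ x y z : Fin 2 → K, cross f x x y z = 0 ∧ cross f x y x z = 0 ∧ cross f x y z x = 0 ∧
      cross f y x x z = 0 ∧ cross f y x z x = 0 ∧ cross f y z x x = 0 := fun x y z => by
    refine ⟨?_, ?_, ?_, ?_, ?_, ?_⟩ <;> exact cross_eq_zero hf (by simp [det₂_self])
  -- If two of the five lines coincide, the three terms containing both vanish. After rescaling, the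
  -- other two agree up to a permutation of arguments whose sign makes them cancel.
  by_cases hab : det₂ a b = 0
  · obtain ⟨r, hr, rfl⟩ := exists_smul_of_det₂_eq_zero ha hb hab
    simp only [cross_smul₀ hr, cross_smul₁ hf hr, cross_smul₂ hf hr, cross_smul₃ hf hr, z]
    linarith
  by_cases hac : det₂ a c = 0
  · obtain ⟨r, hr, rfl⟩ := exists_smul_of_det₂_eq_zero ha hc hac
    simp only [cross_smul₀ hr, cross_smul₁ hf hr, cross_smul₂ hf hr, cross_smul₃ hf hr, z]
    linarith [s₀ a b d e]
  by_cases had : det₂ a d = 0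
  · obtain ⟨r, hr, rfl⟩ := exists_smul_of_det₂_eq_zero ha hd had
    simp only [cross_smul₀ hr, cross_smul₁ hf hr, cross_smul₂ hf hr, cross_smul₃ hf hr, z]
    linarith [s₁ b a c e, s₀ a b c e]
  by_cases hae : det₂ a e = 0
  · obtain ⟨r, hr, rfl⟩ := exists_smul_of_det₂_eq_zero ha he hae
    simp only [cross_smul₀ hr, cross_smul₁ hf hr, cross_smul₂ hf hr, cross_smul₃ hf hr, z]
    linarith [s₂ b c a d, s₁ b a c d, s₀ a b c d]
  by_cases hbc : det₂ b c = 0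
  · obtain ⟨r, hr, rfl⟩ := exists_smul_of_det₂_eq_zero hb hc hbc
    simp only [cross_smul₀ hr, cross_smul₁ hf hr, cross_smul₂ hf hr, cross_smul₃ hf hr, z]
    linarith
  by_cases hbd : det₂ b d = 0
  · obtain ⟨r, hr, rfl⟩ := exists_smul_of_det₂_eq_zero hb hd hbd
    simp only [cross_smul₀ hr, cross_smul₁ hf hr, cross_smul₂ hf hr, cross_smul₃ hf hr, z]
    linarith [s₁ a b c e]
  by_cases hbe : det₂ b e = 0
  · obtain ⟨r, hr, rfl⟩ := exists_smul_of_det₂_eq_zero hb he hbe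
    simp only [cross_smul₀ hr, cross_smul₁ hf hr, cross_smul₂ hf hr, cross_smul₃ hf hr, z]
    linarith [s₂ a c b d, s₁ a b c d]
  by_cases hcd : det₂ c d = 0
  · obtain ⟨r, hr, rfl⟩ := exists_smul_of_det₂_eq_zero hc hd hcd
    simp only [cross_smul₀ hr, cross_smul₁ hf hr, cross_smul₂ hf hr, cross_smul₃ hf hr, z]
    linarith
  by_cases hce : det₂ c e = 0
  · obtain ⟨r, hr, rfl⟩ := exists_smul_of_det₂_eq_zero hc he hce
    simp only [cross_smul₀ hr, cross_smul₁ hf hr, cross_smul₂ hf hr, cross_smul₃ hf hr, z]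
    linarith [s₂ a b c d]
  by_cases hde : det₂ d e = 0
  · obtain ⟨r, hr, rfl⟩ := exists_smul_of_det₂_eq_zero hd he hde
    simp only [cross_smul₀ hr, cross_smul₁ hf hr, cross_smul₂ hf hr, cross_smul₃ hf hr, z]
    linarith
  exact cross_five_term_of_det₂_ne_zero hf hab hac had hae hbc hbd hbe hcd hce hde

end Line

/-! ### Five points of the projective plane and Gale duality -/

section Plane

variable {K : Type*} [Field K] {f : K → ℝ}

/-- The determinant of three vectors of `K³`. -/
def det₃ (a b c : Fin 3 → K) : K :=
  a 0 * (b 1 * c 2 - b 2 * c 1) - a 1 * (b 0 * c 2 - b 2 * c 0) + a 2 * (b 0 * c 1 - b 1 * c 0)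

/-- The value of `f` at the cross ratio of the four lines of `K³ / Ke` spanned by `a, b, c, d`. -/
def cross₃ (f : K → ℝ) (e a b c d : Fin 3 → K) : ℝ :=
  f (det₃ e a c * det₃ e b d / (det₃ e a d * det₃ e b c))

/-- A linear map to `K²` that kills `w`; its kernel is `Kw` if `w, p, q` are independent. -/
def projAlong (w p q : Fin 3 → K) : (Fin 3 → K) →ₗ[K] (Fin 2 → K) where
  toFun a := ![det₃ w a q, det₃ w p a]
  map_add' a b := by
    ext i; fin_cases i <;> simp [det₃] <;> ring
  map_smul' c a := by
    ext i; fin_cases i <;> simp [det₃] <;> ring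

/-- All determinants acquire the same factor, so cross ratios after projection are cross ratios seen
from `w`. -/
lemma det₂_projAlong (w p q a b : Fin 3 → K) :
    det₂ (projAlong w p q a) (projAlong w p q b) = det₃ w p q * det₃ w a b := by
  simp [projAlong, det₂, det₃]; ring

lemma projAlong_self (w p q : Fin 3 → K) : projAlong w p q w = 0 := by
  ext i; fin_cases i <;> simp [projAlong, det₃] <;> ring

/-- Cramer's rule expands `a` in `w, p, q`; the coefficients of `p` and `q` are, up to a factor, the
two coordinates of the projection. -/
lemma eq_smul_of_projAlong_eq_zero {w p q a : Fin 3 → K} (h : det₃ w p q ≠ 0)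
    (ha : projAlong w p q a = 0) : a = (det₃ a p q / det₃ w p q) • w := by
  have h0 : det₃ w a q = 0 := congrFun ha 0
  have h1 : det₃ w p a = 0 := congrFun ha 1
  have key : ∀ i, det₃ w p q * a i = det₃ a p q * w i + det₃ w a q * p i + det₃ w p a * q i := by
    intro i; fin_cases i <;> simp only [det₃] <;> simp <;> ring
  ext i
  have := key i
  rw [h0, h1, zero_mul, zero_mul, add_zero, add_zero] at this
  rw [Pi.smul_apply, smul_eq_mul, div_mul_eq_mul_div, eq_div_iff h, ← this, mul_comm]

lemma div_congr_of_mul {r x y x' y' : K} (hr : r ≠ 0) (hx : x = r * x') (hy : y = r * y') :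
    x / y = x' / y' := by
  rw [hx, hy, mul_div_mul_left _ _ hr]

lemma cross_projAlong {w p q : Fin 3 → K} (h : det₃ w p q ≠ 0) (a b c d : Fin 3 → K) :
    cross f (projAlong w p q a) (projAlong w p q b) (projAlong w p q c) (projAlong w p q d) =
      cross₃ f w a b c d := by
  simp only [cross, cross₃, det₂_projAlong]
  exact congrArg f (div_congr_of_mul (mul_ne_zero h h) (by ring) (by ring))

lemma det₃_cyclic (a b c : Fin 3 → K) : det₃ a b c = det₃ b c a := by
  simp only [det₃]; ring

lemma det₃_swap (a b c : Fin 3 → K) : det₃ a c b = -det₃ a b c := by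
  simp only [det₃]; ring

lemma det₃_plucker (e a b c d : Fin 3 → K) :
    det₃ e a d * det₃ e b c - det₃ e a c * det₃ e b d = -(det₃ e a b * det₃ e c d) := by
  simp only [det₃]; ring

lemma cross₃_swap₀₁ (hf : IsBlochFunction f) (e a b c d : Fin 3 → K) :
    cross₃ f e b a c d = -cross₃ f e a b c d := by
  rw [cross₃, cross₃, ← hf.map_inv, inv_div]
  congr 1
  rw [mul_comm (det₃ e b c), mul_comm (det₃ e b d)]

lemma cross₃_swap₂₃ (hf : IsBlochFunction f) (e a b c d : Fin 3 → K) :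
    cross₃ f e a b d c = -cross₃ f e a b c d := by
  rw [cross₃, cross₃, ← hf.map_inv, inv_div]

lemma cross₃_swap₁₂ (hf : IsBlochFunction f) (e a b c d : Fin 3 → K) :
    cross₃ f e a c b d = -cross₃ f e a b c d := by
  by_cases h : det₃ e a d * det₃ e b c = 0
  · have h' : det₃ e a d * det₃ e c b = 0 := by
      rw [det₃_swap e b c, mul_neg, h, neg_zero]
    simp [cross₃, h, h', hf.map_zero]
  · rw [cross₃, cross₃, ← hf.map_one_sub, one_sub_div h, det₃_plucker, det₃_swap e b c, mul_neg,
      div_neg, neg_div]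

/-- The alternating sum of the cross ratios of five points of the plane, each seen from one of
them. -/
def pencilSum (f : K → ℝ) (v : Fin 5 → Fin 3 → K) : ℝ :=
  cross₃ f (v 0) (v 1) (v 2) (v 3) (v 4) - cross₃ f (v 1) (v 0) (v 2) (v 3) (v 4) +
    cross₃ f (v 2) (v 0) (v 1) (v 3) (v 4) - cross₃ f (v 3) (v 0) (v 1) (v 2) (v 4) +
    cross₃ f (v 4) (v 0) (v 1) (v 2) (v 3)

/-- An adjacent transposition exchanges two consecutive terms, which carry opposite signs, and acts
on each of the other three by an adjacent transposition of its arguments. -/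
lemma pencilSum_swap (hf : IsBlochFunction f) (i : Fin 4) (v : Fin 5 → Fin 3 → K) :
    pencilSum f (v ∘ Equiv.swap i.castSucc i.succ) = -pencilSum f v := by
  have s₀ := cross₃_swap₀₁ hf
  have s₁ := cross₃_swap₁₂ hf
  have s₂ := cross₃_swap₂₃ hf
  have h : ∀ i j k : Fin 5, (v ∘ Equiv.swap i j) k = v (if k = i then j else if k = j then i else k) :=
    fun i j k => by simp [Equiv.swap_apply_def]
  have e₀ := s₀ (v 2) (v 0) (v 1) (v 3) (v 4)
  have e₁ := s₀ (v 3) (v 0) (v 1) (v 2) (v 4)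
  have e₂ := s₀ (v 4) (v 0) (v 1) (v 2) (v 3)
  have e₃ := s₀ (v 0) (v 1) (v 2) (v 3) (v 4)
  have e₄ := s₁ (v 3) (v 0) (v 1) (v 2) (v 4)
  have e₅ := s₁ (v 4) (v 0) (v 1) (v 2) (v 3)
  have e₆ := s₁ (v 0) (v 1) (v 2) (v 3) (v 4)
  have e₇ := s₁ (v 1) (v 0) (v 2) (v 3) (v 4)
  have e₈ := s₂ (v 4) (v 0) (v 1) (v 2) (v 3)
  have e₉ := s₂ (v 0) (v 1) (v 2) (v 3) (v 4)
  have e₁₀ := s₂ (v 1) (v 0) (v 2) (v 3) (v 4)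
  have e₁₁ := s₂ (v 2) (v 0) (v 1) (v 3) (v 4)
  simp only [pencilSum, h]
  fin_cases i <;> simp <;> linarith

lemma pencilSum_comp_perm (hf : IsBlochFunction f) (σ : Equiv.Perm (Fin 5))
    (v : Fin 5 → Fin 3 → K) (h : pencilSum f (v ∘ σ) = 0) : pencilSum f v = 0 := by
  have hσ : σ ∈ Submonoid.closure (Set.range fun i : Fin 4 => Equiv.swap i.castSucc i.succ) := by
    rw [Equiv.Perm.mclosure_swap_castSucc_succ]; trivial
  induction hσ using Submonoid.closure_induction generalizing v with
  | mem x hx =>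
    obtain ⟨i, rfl⟩ := hx
    rw [pencilSum_swap hf] at h
    linarith
  | one => exact h
  | mul x y _ _ hx hy =>
    refine hx v (hy _ ?_)
    exact h

/-- Gale duality. Write $v_3=\sum\alpha_iv_i$ and $v_4=\sum\beta_iv_i$ in the basis $v_0,v_1,v_2$.
The vectors $w_i=(\alpha_i,\beta_i)$ for $i\le 2$, $w_3=(-1,0)$, $w_4=(0,-1)$ satisfy $\sum
w_i\otimes v_i=0$, and the cross ratio of four of the $v_j$ seen from the fifth is the cross ratio
of the corresponding four $w_j$. The sum becomes the five-term relation for the $w_i$. The condition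
`hv`, that the $v_j$ still span when any one is omitted, makes every $w_i$ nonzero. -/
lemma pencilSum_eq_zero_of_basis (hf : IsBlochFunction f) {v : Fin 5 → Fin 3 → K}
    (hD : det₃ (v 0) (v 1) (v 2) ≠ 0)
    (hv : ∀ i, ∃ j k l, j ≠ i ∧ k ≠ i ∧ l ≠ i ∧ det₃ (v j) (v k) (v l) ≠ 0) :
    pencilSum f v = 0 := by
  set D := det₃ (v 0) (v 1) (v 2) with hDdef
  have cramer : ∀ x : Fin 3 → K, ∃ α β γ : K, x = α • v 0 + β • v 1 + γ • v 2 := by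
    intro x
    refine ⟨det₃ x (v 1) (v 2) / D, det₃ (v 0) x (v 2) / D, det₃ (v 0) (v 1) x / D, ?_⟩
    have key : ∀ i, D * x i = det₃ x (v 1) (v 2) * v 0 i + det₃ (v 0) x (v 2) * v 1 i +
        det₃ (v 0) (v 1) x * v 2 i := by
      intro i; fin_cases i <;> simp only [hDdef, det₃] <;> simp <;> ring
    ext i
    simp only [Pi.add_apply, Pi.smul_apply, smul_eq_mul]
    field_simp
    linear_combination key i
  obtain ⟨α₀, α₁, α₂, h3⟩ := cramer (v 3)
  obtain ⟨β₀, β₁, β₂, h4⟩ := cramer (v 4)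
  have hplane : ∀ (b c : Fin 3 → K) (x y z : Fin 3 → K), (∃ r s : K, x = r • b + s • c) →
      (∃ r s : K, y = r • b + s • c) → (∃ r s : K, z = r • b + s • c) → det₃ x y z = 0 := by
    rintro b c _ _ _ ⟨r, s, rfl⟩ ⟨r', s', rfl⟩ ⟨r'', s'', rfl⟩
    simp only [det₃, Pi.add_apply, Pi.smul_apply, smul_eq_mul]; ring
  have hne : ∀ (i : Fin 5) (b c : Fin 3 → K), (∀ j, j ≠ i → ∃ r s : K, v j = r • b + s • c) →
      False := by
    intro i b c h
    obtain ⟨j, k, l, hj, hk, hl, hd⟩ := hv i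
    exact hd (hplane b c _ _ _ (h j hj) (h k hk) (h l hl))
  have hw : ∀ x y : K, ¬(x = 0 ∧ y = 0) → (![x, y] : Fin 2 → K) ≠ 0 := by
    intro x y h h'
    exact h ⟨congrFun h' 0, congrFun h' 1⟩
  -- If this dual vector vanished, the four vectors other than $v_0$ would all lie in the span of
  -- $v_1,v_2$.
  have h0 : (![α₀, β₀] : Fin 2 → K) ≠ 0 := hw _ _ fun ⟨ha, hb⟩ => hne 0 (v 1) (v 2) fun j hj => by
    rw [ha] at h3; rw [hb] at h4
    fin_cases j
    · exact absurd rfl hj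
    · exact ⟨1, 0, by simp⟩
    · exact ⟨0, 1, by simp⟩
    · exact ⟨α₁, α₂, by simp [h3]⟩
    · exact ⟨β₁, β₂, by simp [h4]⟩
  have h1 : (![α₁, β₁] : Fin 2 → K) ≠ 0 := hw _ _ fun ⟨ha, hb⟩ => hne 1 (v 0) (v 2) fun j hj => by
    rw [ha] at h3; rw [hb] at h4
    fin_cases j
    · exact ⟨1, 0, by simp⟩
    · exact absurd rfl hj
    · exact ⟨0, 1, by simp⟩
    · exact ⟨α₀, α₂, by simp [h3]⟩
    · exact ⟨β₀, β₂, by simp [h4]⟩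
  have h2 : (![α₂, β₂] : Fin 2 → K) ≠ 0 := hw _ _ fun ⟨ha, hb⟩ => hne 2 (v 0) (v 1) fun j hj => by
    rw [ha] at h3; rw [hb] at h4
    fin_cases j
    · exact ⟨1, 0, by simp⟩
    · exact ⟨0, 1, by simp⟩
    · exact absurd rfl hj
    · exact ⟨α₀, α₁, by simp [h3]⟩
    · exact ⟨β₀, β₁, by simp [h4]⟩
  have h3' : (![-1, 0] : Fin 2 → K) ≠ 0 := hw _ _ fun h => by simp at h
  have h4' : (![0, -1] : Fin 2 → K) ≠ 0 := hw _ _ fun h => by simp at h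
  have pent := cross_five_term hf h0 h1 h2 h3' h4'
  -- Up to sign, each $3\times3$ minor of the $v_i$ is $D$ times the complementary $2\times2$ minor
  -- of the $w_i$. Complementation exchanges the two factors in the numerator of a cross ratio, and
  -- likewise in the denominator.
  have d₀₁₃ : det₃ (v 0) (v 1) (v 3) = D * α₂ := by
    rw [h3]; simp only [hDdef, det₃, Pi.add_apply, Pi.smul_apply, smul_eq_mul]; ring
  have d₀₂₃ : det₃ (v 0) (v 2) (v 3) = -(D * α₁) := by
    rw [h3]; simp only [hDdef, det₃, Pi.add_apply, Pi.smul_apply, smul_eq_mul]; ring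
  have d₁₂₃ : det₃ (v 1) (v 2) (v 3) = D * α₀ := by
    rw [h3]; simp only [hDdef, det₃, Pi.add_apply, Pi.smul_apply, smul_eq_mul]; ring
  have d₀₁₄ : det₃ (v 0) (v 1) (v 4) = D * β₂ := by
    rw [h4]; simp only [hDdef, det₃, Pi.add_apply, Pi.smul_apply, smul_eq_mul]; ring
  have d₀₂₄ : det₃ (v 0) (v 2) (v 4) = -(D * β₁) := by
    rw [h4]; simp only [hDdef, det₃, Pi.add_apply, Pi.smul_apply, smul_eq_mul]; ring
  have d₁₂₄ : det₃ (v 1) (v 2) (v 4) = D * β₀ := by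
    rw [h4]; simp only [hDdef, det₃, Pi.add_apply, Pi.smul_apply, smul_eq_mul]; ring
  have d₀₃₄ : det₃ (v 0) (v 3) (v 4) = D * (α₁ * β₂ - α₂ * β₁) := by
    rw [h3, h4]; simp only [hDdef, det₃, Pi.add_apply, Pi.smul_apply, smul_eq_mul]; ring
  have d₁₃₄ : det₃ (v 1) (v 3) (v 4) = -(D * (α₀ * β₂ - α₂ * β₀)) := by
    rw [h3, h4]; simp only [hDdef, det₃, Pi.add_apply, Pi.smul_apply, smul_eq_mul]; ring
  have d₂₃₄ : det₃ (v 2) (v 3) (v 4) = D * (α₀ * β₁ - α₁ * β₀) := by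
    rw [h3, h4]; simp only [hDdef, det₃, Pi.add_apply, Pi.smul_apply, smul_eq_mul]; ring
  have hDD : D * D ≠ 0 := mul_ne_zero hD hD
  have q : ∀ a b c : Fin 3 → K, det₃ b a c = -det₃ a b c := fun a b c => by
    simp only [det₃]; ring
  have r : ∀ a b c : Fin 3 → K, det₃ c a b = det₃ a b c := fun a b c => by
    simp only [det₃]; ring
  have t0 : cross₃ f (v 0) (v 1) (v 2) (v 3) (v 4) =
      cross f ![α₁, β₁] ![α₂, β₂] ![-1, 0] ![0, -1] := by
    refine congrArg f (div_congr_of_mul hDD ?_ ?_)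
    · rw [d₀₁₃, d₀₂₄]; simp [det₂]; ring
    · rw [d₀₁₄, d₀₂₃]; simp [det₂]; ring
  have t1 : cross₃ f (v 1) (v 0) (v 2) (v 3) (v 4) =
      cross f ![α₀, β₀] ![α₂, β₂] ![-1, 0] ![0, -1] := by
    refine congrArg f (div_congr_of_mul hDD ?_ ?_)
    · rw [q (v 0) (v 1) (v 3), d₀₁₃, d₁₂₄]; simp [det₂]; ring
    · rw [q (v 0) (v 1) (v 4), d₀₁₄, d₁₂₃]; simp [det₂]; ring
  have t2 : cross₃ f (v 2) (v 0) (v 1) (v 3) (v 4) =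
      cross f ![α₀, β₀] ![α₁, β₁] ![-1, 0] ![0, -1] := by
    refine congrArg f (div_congr_of_mul hDD ?_ ?_)
    · rw [q (v 0) (v 2) (v 3), d₀₂₃, q (v 1) (v 2) (v 4), d₁₂₄]; simp [det₂]; ring
    · rw [q (v 0) (v 2) (v 4), d₀₂₄, q (v 1) (v 2) (v 3), d₁₂₃]; simp [det₂]; ring
  have t3 : cross₃ f (v 3) (v 0) (v 1) (v 2) (v 4) =
      cross f ![α₀, β₀] ![α₁, β₁] ![α₂, β₂] ![0, -1] := by
    refine congrArg f (div_congr_of_mul hDD ?_ ?_)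
    · rw [r (v 0) (v 2) (v 3), d₀₂₃, q (v 1) (v 3) (v 4), d₁₃₄]; simp [det₂]; ring
    · rw [q (v 0) (v 3) (v 4), d₀₃₄, r (v 1) (v 2) (v 3), d₁₂₃]; simp [det₂]; ring
  have t4 : cross₃ f (v 4) (v 0) (v 1) (v 2) (v 3) =
      cross f ![α₀, β₀] ![α₁, β₁] ![α₂, β₂] ![-1, 0] := by
    refine congrArg f (div_congr_of_mul hDD ?_ ?_)
    · rw [r (v 0) (v 2) (v 4), d₀₂₄, r (v 1) (v 3) (v 4), d₁₃₄]; simp [det₂]; ring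
    · rw [r (v 0) (v 3) (v 4), d₀₃₄, r (v 1) (v 2) (v 4), d₁₂₄]; simp [det₂]; ring
  rw [← pent, pencilSum, t0, t1, t2, t3, t4]

/-- Otherwise linearity in the three arguments, one after another, would make the determinant vanish
identically. -/
lemma exists_det₃_ne_zero {ι : Type*} {v : ι → Fin 3 → K} (hv : Submodule.span K (Set.range v) = ⊤) :
    ∃ i j k, det₃ (v i) (v j) (v k) ≠ 0 := by
  by_contra! h
  have step : ∀ φ : (Fin 3 → K) →ₗ[K] K, (∀ i, φ (v i) = 0) → ∀ x, φ x = 0 := by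
    intro φ hφ x
    have : φ = 0 := LinearMap.ext_on_range hv fun i => by simp [hφ]
    simp [this]
  let φ : (Fin 3 → K) → (Fin 3 → K) → (Fin 3 → K) →ₗ[K] K := fun a b =>
    { toFun := fun c => det₃ a b c
      map_add' := fun x y => by simp only [det₃, Pi.add_apply]; ring
      map_smul' := fun r x => by simp only [det₃, Pi.smul_apply, smul_eq_mul, RingHom.id_apply]; ring }
  have h1 : ∀ i j x, det₃ (v i) (v j) x = 0 := fun i j => step (φ (v i) (v j)) fun k => h i j k
  have h2 : ∀ i x y, det₃ x (v i) y = 0 := fun i x => step (φ x (v i)) fun k => by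
    change det₃ x (v i) (v k) = 0
    rw [det₃_cyclic, h1]
  have h3 : ∀ x y z : Fin 3 → K, det₃ x y z = 0 := fun x y => step (φ x y) fun k => by
    change det₃ x y (v k) = 0
    rw [det₃_cyclic, h2]
  have := h3 ![1, 0, 0] ![0, 1, 0] ![0, 0, 1]
  simp [det₃] at this

lemma exists_perm_fin_five {i j k : Fin 5} (hij : i ≠ j) (hik : i ≠ k) (hjk : j ≠ k) :
    ∃ σ : Equiv.Perm (Fin 5), σ 0 = i ∧ σ 1 = j ∧ σ 2 = k := by
  have := Equiv.Perm.isMultiplyPretransitive (Fin 5) 3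
  obtain ⟨g, hg⟩ := MulAction.exists_smul_eq (Equiv.Perm (Fin 5))
    (⟨![0, 1, 2], by decide⟩ : Fin 3 ↪ Fin 5)
    ⟨![i, j, k], by
      intro a b
      fin_cases a <;> fin_cases b <;> simp [*, Ne.symm, eq_comm]⟩
  have h := fun a => DFunLike.congr_fun hg a
  exact ⟨g, h 0, h 1, h 2⟩

lemma pencilSum_eq_zero (hf : IsBlochFunction f) {v : Fin 5 → Fin 3 → K}
    (hspan : Submodule.span K (Set.range v) = ⊤)
    (hv : ∀ i, ∃ j k l, j ≠ i ∧ k ≠ i ∧ l ≠ i ∧ det₃ (v j) (v k) (v l) ≠ 0) :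
    pencilSum f v = 0 := by
  obtain ⟨i, j, k, h⟩ := exists_det₃_ne_zero hspan
  have hij : i ≠ j := by rintro rfl; exact h (by simp only [det₃]; ring)
  have hik : i ≠ k := by rintro rfl; exact h (by simp only [det₃]; ring)
  have hjk : j ≠ k := by rintro rfl; exact h (by simp only [det₃]; ring)
  obtain ⟨σ, h0, h1, h2⟩ := exists_perm_fin_five hij hik hjk
  refine pencilSum_comp_perm hf σ v (pencilSum_eq_zero_of_basis hf ?_ fun m => ?_)
  · simpa [h0, h1, h2] using h
  · obtain ⟨a, b, c, ha, hb, hc, hd⟩ := hv (σ m)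
    exact ⟨σ.symm a, σ.symm b, σ.symm c, by simpa [Equiv.symm_apply_eq] using ha,
      by simpa [Equiv.symm_apply_eq] using hb, by simpa [Equiv.symm_apply_eq] using hc,
      by simpa using hd⟩

end Plane

/-! ### Volume of four vectors modulo a subspace -/

section Volume

variable {K : Type*} [Field K] {E E' : Type*} [AddCommGroup E] [Module K E]
  [AddCommGroup E'] [Module K E'] {ι : Type*} {r : ℕ} {f : K → ℝ}

/-- A linear map to `Kʳ` that induces an isomorphism from the span of the vectors `v` modulo `L`. -/
structure IsChart (L : Submodule K E) (v : ι → E) (φ : E →ₗ[K] (Fin r → K)) : Prop where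
  le_ker : L ≤ LinearMap.ker φ
  inf_le : (L ⊔ Submodule.span K (Set.range v)) ⊓ LinearMap.ker φ ≤ L
  map_eq : (Submodule.span K (Set.range v)).map φ = ⊤

lemma IsChart.map_sup_eq {L : Submodule K E} {v : ι → E} {φ : E →ₗ[K] (Fin r → K)}
    (h : IsChart L v φ) : (L ⊔ Submodule.span K (Set.range v)).map φ = ⊤ := by
  rw [Submodule.map_sup, h.map_eq, sup_top_eq]

lemma IsChart.inf_eq {L : Submodule K E} {v : ι → E} {φ : E →ₗ[K] (Fin r → K)}
    (h : IsChart L v φ) : (L ⊔ Submodule.span K (Set.range v)) ⊓ LinearMap.ker φ = L :=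
  le_antisymm h.inf_le (le_inf le_sup_left h.le_ker)

lemma finrank_map_add_finrank_inf_ker [FiniteDimensional K E] (U : Submodule K E)
    (φ : E →ₗ[K] E') :
    finrank K (U.map φ) + finrank K (U ⊓ LinearMap.ker φ : Submodule K E) = finrank K U := by
  have h := LinearMap.finrank_range_add_finrank_ker (φ.domRestrict U)
  rw [LinearMap.range_domRestrict] at h
  rw [← h, LinearMap.ker_domRestrict, ← Submodule.finrank_map_subtype_eq,
    Submodule.map_comap_subtype]

lemma IsChart.finrank_eq [FiniteDimensional K E] {L : Submodule K E} {v : ι → E}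
    {φ : E →ₗ[K] (Fin r → K)} (h : IsChart L v φ) :
    finrank K (L ⊔ Submodule.span K (Set.range v) : Submodule K E) = finrank K L + r := by
  have := finrank_map_add_finrank_inf_ker (L ⊔ Submodule.span K (Set.range v)) φ
  rw [h.map_sup_eq, h.inf_eq, finrank_top, finrank_fin_fun] at this
  omega

/-- Coordinates on the quotient of the span by `L` are extended linearly to all of $E/L$. Working
with maps defined on all of `E` avoids handling subquotients. -/
lemma exists_isChart [FiniteDimensional K E] {L : Submodule K E} {v : ι → E}
    (h : finrank K (L ⊔ Submodule.span K (Set.range v) : Submodule K E) = finrank K L + r) :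
    ∃ φ : E →ₗ[K] (Fin r → K), IsChart L v φ := by
  set U := L ⊔ Submodule.span K (Set.range v) with hU
  have hLU : L ≤ U := le_sup_left
  have hq : finrank K (U.map L.mkQ) = r := by
    have := finrank_map_add_finrank_inf_ker U L.mkQ
    rw [Submodule.ker_mkQ, inf_eq_right.mpr hLU] at this
    omega
  let e := (finBasisOfFinrankEq K (U.map L.mkQ) hq).equivFun
  obtain ⟨g, hg⟩ := LinearMap.exists_extend e.toLinearMap
  have hgx : ∀ x (hx : x ∈ U.map L.mkQ), g x = e ⟨x, hx⟩ := fun x hx => LinearMap.congr_fun hg ⟨x, hx⟩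
  have hle : L ≤ LinearMap.ker (g ∘ₗ L.mkQ) := fun x hx => by
    have : L.mkQ x = 0 := by simpa using hx
    simp [this]
  refine ⟨g ∘ₗ L.mkQ, hle, ?_, ?_⟩
  · rintro x ⟨hx, hx'⟩
    rw [SetLike.mem_coe, LinearMap.mem_ker, LinearMap.comp_apply, hgx _ (Submodule.mem_map_of_mem hx),
      LinearEquiv.map_eq_zero_iff] at hx'
    simpa using congrArg Subtype.val hx'
  · have h1 : U.map (g ∘ₗ L.mkQ) = ⊤ := by
      rw [Submodule.map_comp, eq_top_iff]
      intro y _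
      exact ⟨(e.symm y).1, (e.symm y).2, by rw [hgx _ (e.symm y).2]; simp⟩
    rw [hU, Submodule.map_sup] at h1
    rw [← h1, eq_comm, sup_eq_right]
    rw [LinearMap.le_ker_iff_map.mp hle]
    exact bot_le

lemma exists_isChart_iff [FiniteDimensional K E] {L : Submodule K E} {v : ι → E} :
    (∃ φ : E →ₗ[K] (Fin r → K), IsChart L v φ) ↔
      finrank K (L ⊔ Submodule.span K (Set.range v) : Submodule K E) = finrank K L + r :=
  ⟨fun ⟨_, h⟩ => h.finrank_eq, exists_isChart⟩

lemma mem_sup_span (L : Submodule K E) (v : ι → E) (i : ι) :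
    v i ∈ L ⊔ Submodule.span K (Set.range v) :=
  Submodule.mem_sup_right (Submodule.subset_span ⟨i, rfl⟩)

/-- Two charts of the same space differ by an automorphism of `K²`. -/
lemma IsChart.exists_det₂ {L : Submodule K E} {v : ι → E} {φ ψ : E →ₗ[K] (Fin 2 → K)}
    (hφ : IsChart L v φ) (hψ : IsChart L v ψ) :
    ∃ c : K, c ≠ 0 ∧ ∀ i j, det₂ (ψ (v i)) (ψ (v j)) = c * det₂ (φ (v i)) (φ (v j)) := by
  set U := L ⊔ Submodule.span K (Set.range v)
  have hmem : ∀ y, ∃ u ∈ U, φ u = y := fun y => by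
    have : y ∈ U.map φ := hφ.map_sup_eq ▸ Submodule.mem_top
    simpa using this
  obtain ⟨u₀, hu₀, h₀⟩ := hmem ![1, 0]
  obtain ⟨u₁, hu₁, h₁⟩ := hmem ![0, 1]
  -- The part of `u` not accounted for by `u₀` and `u₁` lies in `U` and is killed by `φ`, hence lies
  -- in `L`, which `ψ` kills too.
  have key : ∀ u ∈ U, ψ u = φ u 0 • ψ u₀ + φ u 1 • ψ u₁ := by
    intro u hu
    have hk : u - (φ u 0 • u₀ + φ u 1 • u₁) ∈ LinearMap.ker φ := by
      rw [LinearMap.mem_ker, map_sub, map_add, map_smul, map_smul, h₀, h₁]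
      ext i; fin_cases i <;> simp
    have hU : u - (φ u 0 • u₀ + φ u 1 • u₁) ∈ U :=
      U.sub_mem hu (U.add_mem (U.smul_mem _ hu₀) (U.smul_mem _ hu₁))
    have := hψ.le_ker (hφ.inf_le ⟨hU, hk⟩)
    rw [LinearMap.mem_ker, map_sub, map_add, map_smul, map_smul, sub_eq_zero] at this
    exact this
  have hdet : ∀ u ∈ U, ∀ w ∈ U, det₂ (ψ u) (ψ w) = det₂ (ψ u₀) (ψ u₁) * det₂ (φ u) (φ w) := by
    intro u hu w hw
    rw [key u hu, key w hw]
    simp only [det₂, Pi.add_apply, Pi.smul_apply, smul_eq_mul]; ring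
  refine ⟨det₂ (ψ u₀) (ψ u₁), fun h0 => ?_, fun i j =>
    hdet _ (mem_sup_span L v i) _ (mem_sup_span L v j)⟩
  have hmem' : ∀ y, ∃ u ∈ U, ψ u = y := fun y => by
    have : y ∈ U.map ψ := hψ.map_sup_eq ▸ Submodule.mem_top
    simpa using this
  obtain ⟨w₀, hw₀, k₀⟩ := hmem' ![1, 0]
  obtain ⟨w₁, hw₁, k₁⟩ := hmem' ![0, 1]
  have := hdet w₀ hw₀ w₁ hw₁
  rw [h0, k₀, k₁, zero_mul] at this
  simp [det₂] at this

open Classical in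
/-- The value of `f` at the cross ratio of four vectors modulo `L`; it is `0` unless they span a
plane modulo `L`. -/
def volMod (f : K → ℝ) (L : Submodule K E) (v : Fin 4 → E) : ℝ :=
  if h : ∃ φ : E →ₗ[K] (Fin 2 → K), IsChart L v φ then
    cross f (h.choose (v 0)) (h.choose (v 1)) (h.choose (v 2)) (h.choose (v 3))
  else 0

lemma IsChart.volMod_eq {L : Submodule K E} {v : Fin 4 → E} {φ : E →ₗ[K] (Fin 2 → K)}
    (h : IsChart L v φ) :
    volMod f L v = cross f (φ (v 0)) (φ (v 1)) (φ (v 2)) (φ (v 3)) := by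
  have hex : ∃ φ : E →ₗ[K] (Fin 2 → K), IsChart L v φ := ⟨φ, h⟩
  obtain ⟨c, hc, hdet⟩ := h.exists_det₂ hex.choose_spec
  rw [volMod, dif_pos hex]
  exact cross_congr_of_det₂ hc (hdet 0 2) (hdet 1 3) (hdet 0 3) (hdet 1 2)

lemma volMod_eq_zero_of_finrank_ne [FiniteDimensional K E] {L : Submodule K E} {v : Fin 4 → E}
    (h : finrank K (L ⊔ Submodule.span K (Set.range v) : Submodule K E) ≠ finrank K L + 2) :
    volMod f L v = 0 := by
  rw [volMod, dif_neg]
  rwa [exists_isChart_iff]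

lemma span_range_comp (φ : E →ₗ[K] E') (v : ι → E) :
    Submodule.span K (Set.range (φ ∘ v)) = (Submodule.span K (Set.range v)).map φ := by
  rw [Set.range_comp, Submodule.map_span]

/-- The kernel condition says that `φ` is injective on the span modulo `L`, so it carries this
quotient isomorphically to the one in the target. -/
lemma volMod_map [FiniteDimensional K E] [FiniteDimensional K E'] (L : Submodule K E)
    (v : Fin 4 → E) (φ : E →ₗ[K] E')
    (h : (L ⊔ Submodule.span K (Set.range v)) ⊓ LinearMap.ker φ ≤ L) :
    volMod f (L.map φ) (φ ∘ v) = volMod f L v := by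
  set U := L ⊔ Submodule.span K (Set.range v) with hU
  have hsup : L.map φ ⊔ Submodule.span K (Set.range (φ ∘ v)) = U.map φ := by
    rw [span_range_comp, hU, Submodule.map_sup]
  by_cases hex : ∃ ψ : E' →ₗ[K] (Fin 2 → K), IsChart (L.map φ) (φ ∘ v) ψ
  · obtain ⟨ψ, hψ⟩ := hex
    have hχ : IsChart L v (ψ ∘ₗ φ) := by
      refine ⟨fun x hx => ?_, ?_, ?_⟩
      · exact hψ.le_ker (Submodule.mem_map_of_mem hx)
      · rintro x ⟨hx, hx'⟩
        obtain ⟨l, hl, hlx⟩ : φ x ∈ L.map φ :=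
          hψ.inf_le ⟨by rw [hsup]; exact Submodule.mem_map_of_mem hx, hx'⟩
        have : x - l ∈ L := h ⟨U.sub_mem hx (Submodule.mem_sup_left hl), by
          rw [SetLike.mem_coe, LinearMap.mem_ker, map_sub, hlx, sub_self]⟩
        simpa using L.add_mem this hl
      · rw [Submodule.map_comp, ← span_range_comp, hψ.map_eq]
    rw [hψ.volMod_eq, hχ.volMod_eq]
    rfl
  · rw [volMod, dif_neg hex]
    rw [exists_isChart_iff, hsup] at hex
    refine (volMod_eq_zero_of_finrank_ne fun h2 => hex ?_).symm
    -- The map loses the same dimension on `U` as on `L`, so a chart exists on one side exactly when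
    -- it exists on the other.
    have e1 := finrank_map_add_finrank_inf_ker U φ
    have e2 := finrank_map_add_finrank_inf_ker L φ
    have e3 : U ⊓ LinearMap.ker φ = L ⊓ LinearMap.ker φ :=
      le_antisymm (le_inf h inf_le_right) (inf_le_inf_right _ le_sup_left)
    rw [e3] at e1
    change finrank K U = _ at h2
    omega

/-- Modulo `L` the vectors are merely rescaled: the charts are the same and `cross` depends only on
lines. This is why the Borel function forgets the choice of vectors in an affine flag. -/
lemma volMod_congr {L : Submodule K E} {v w : Fin 4 → E} (c : Fin 4 → K) (hc : ∀ i, c i ≠ 0)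
    (hf : IsBlochFunction f) (h : ∀ i, w i - c i • v i ∈ L) : volMod f L w = volMod f L v := by
  have aux : ∀ (v w : Fin 4 → E) (c : Fin 4 → K), (∀ i, w i - c i • v i ∈ L) →
      Submodule.span K (Set.range w) ≤ L ⊔ Submodule.span K (Set.range v) := by
    intro v w c h
    rw [Submodule.span_le]
    rintro _ ⟨i, rfl⟩
    rw [← sub_add_cancel (w i) (c i • v i)]
    exact Submodule.add_mem_sup (h i)
      (Submodule.smul_mem _ _ (Submodule.subset_span ⟨i, rfl⟩))
  have h' : ∀ i, v i - (c i)⁻¹ • w i ∈ L := fun i => by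
    have := L.smul_mem (-(c i)⁻¹) (h i)
    rwa [smul_sub, smul_smul, neg_mul, inv_mul_cancel₀ (hc i), neg_smul, neg_smul, one_smul,
      neg_sub_neg] at this
  have hsup : L ⊔ Submodule.span K (Set.range w) = L ⊔ Submodule.span K (Set.range v) :=
    le_antisymm (sup_le le_sup_left (aux v w c h)) (sup_le le_sup_left (aux w v _ h'))
  have trans : ∀ φ : E →ₗ[K] (Fin 2 → K), IsChart L v φ → IsChart L w φ := by
    intro φ hφ
    refine ⟨hφ.le_ker, hsup ▸ hφ.inf_le, ?_⟩
    have := hφ.map_sup_eq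
    rwa [← hsup, Submodule.map_sup, LinearMap.le_ker_iff_map.mp hφ.le_ker, bot_sup_eq] at this
  have trans' : ∀ φ : E →ₗ[K] (Fin 2 → K), IsChart L w φ → IsChart L v φ := by
    intro φ hφ
    refine ⟨hφ.le_ker, hsup.symm ▸ hφ.inf_le, ?_⟩
    have := hφ.map_sup_eq
    rwa [hsup, Submodule.map_sup, LinearMap.le_ker_iff_map.mp hφ.le_ker, bot_sup_eq] at this
  by_cases hex : ∃ φ : E →ₗ[K] (Fin 2 → K), IsChart L v φ
  · obtain ⟨φ, hφ⟩ := hex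
    have hval : ∀ i, φ (w i) = c i • φ (v i) := fun i => by
      have := hφ.le_ker (h i)
      rwa [LinearMap.mem_ker, map_sub, map_smul, sub_eq_zero] at this
    rw [hφ.volMod_eq, (trans φ hφ).volMod_eq, hval, hval, hval, hval, cross_smul₀ (hc 0),
      cross_smul₁ hf (hc 1), cross_smul₂ hf (hc 2), cross_smul₃ hf (hc 3)]
  · have hex' : ¬∃ φ : E →ₗ[K] (Fin 2 → K), IsChart L w φ := fun ⟨φ, hφ⟩ => hex ⟨φ, trans' φ hφ⟩
    rw [volMod, volMod, dif_neg hex, dif_neg hex']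

lemma volMod_eq_zero_of_mem (hf : IsBlochFunction f) {L : Submodule K E} {v : Fin 4 → E}
    (i : Fin 4) (hi : v i ∈ L) : volMod f L v = 0 := by
  by_cases hex : ∃ φ : E →ₗ[K] (Fin 2 → K), IsChart L v φ
  · obtain ⟨φ, hφ⟩ := hex
    have h0 : φ (v i) = 0 := hφ.le_ker hi
    rw [hφ.volMod_eq]
    refine cross_eq_zero hf ?_
    fin_cases i <;> simp_all [det₂]
  · rw [volMod, dif_neg hex]

lemma IsChart.comp_perm {L : Submodule K E} {v : ι → E} {φ : E →ₗ[K] (Fin r → K)}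
    (h : IsChart L v φ) (σ : Equiv.Perm ι) : IsChart L (v ∘ σ) φ := by
  have : Set.range (v ∘ σ) = Set.range v := σ.surjective.range_comp v
  exact ⟨h.le_ker, this ▸ h.inf_le, this ▸ h.map_eq⟩

lemma volMod_swap (hf : IsBlochFunction f) (L : Submodule K E) (v : Fin 4 → E) (i : Fin 3) :
    volMod f L (v ∘ Equiv.swap i.castSucc i.succ) = -volMod f L v := by
  by_cases hex : ∃ φ : E →ₗ[K] (Fin 2 → K), IsChart L v φ
  · obtain ⟨φ, hφ⟩ := hex
    rw [hφ.volMod_eq, (hφ.comp_perm _).volMod_eq]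
    have h : ∀ i j k : Fin 4, (v ∘ Equiv.swap i j) k =
      v (if k = i then j else if k = j then i else k) :=
      fun i j k => by simp [Equiv.swap_apply_def]
    simp only [h]
    fin_cases i
    · simpa using cross_swap₀₁ hf _ _ _ _
    · simpa using cross_swap₁₂ hf _ _ _ _
    · simpa using cross_swap₂₃ hf _ _ _ _
  · have hex' : ¬∃ φ : E →ₗ[K] (Fin 2 → K), IsChart L (v ∘ Equiv.swap i.castSucc i.succ) φ :=
      fun ⟨φ, hφ⟩ => hex ⟨φ, by
        have := hφ.comp_perm (Equiv.swap i.castSucc i.succ)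
        rwa [Function.comp_assoc, ← Equiv.coe_trans, Equiv.swap_swap, Equiv.coe_refl,
          Function.comp_id] at this⟩
    rw [volMod, volMod, dif_neg hex, dif_neg hex', neg_zero]

/-- The nonvanishing of the volume forces the four vectors to be in general position. -/
lemma exists_isChart_of_volMod_ne_zero (hf : IsBlochFunction f) {L : Submodule K E} {v : Fin 4 → E}
    (h : volMod f L v ≠ 0) : ∃ φ : E →ₗ[K] (Fin 2 → K), IsChart L v φ ∧
      ∀ i j, i < j → det₂ (φ (v i)) (φ (v j)) ≠ 0 := by
  by_cases hex : ∃ φ : E →ₗ[K] (Fin 2 → K), IsChart L v φ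
  · obtain ⟨φ, hφ⟩ := hex
    refine ⟨φ, hφ, fun i j hij h0 => h ?_⟩
    rw [hφ.volMod_eq]
    refine cross_eq_zero hf ?_
    fin_cases i <;> fin_cases j <;> simp_all
  · rw [volMod, dif_neg hex] at h
    exact absurd rfl h

lemma abs_volMod_le {C : ℝ} (hC : ∀ x, |f x| ≤ C) (L : Submodule K E) (v : Fin 4 → E) :
    |volMod f L v| ≤ C := by
  rw [volMod]
  split_ifs
  · exact hC _
  · rw [abs_zero]
    exact (abs_nonneg _).trans (hC 0)

end Volume

/-! ### The local cocycle identity for five vectors -/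

section FiveVectors

variable {K : Type*} [Field K] {E : Type*} [AddCommGroup E] [Module K E] {r : ℕ} {f : K → ℝ}

lemma eq_top_of_det₂_ne_zero {W : Submodule K (Fin 2 → K)} {a b : Fin 2 → K} (ha : a ∈ W)
    (hb : b ∈ W) (h : det₂ a b ≠ 0) : W = ⊤ := by
  rw [eq_top_iff]
  intro y _
  have : y = (det₂ y b / det₂ a b) • a + (det₂ a y / det₂ a b) • b := by
    have key : ∀ i, det₂ a b * y i = det₂ y b * a i + det₂ a y * b i := by
      intro i; fin_cases i <;> simp only [det₂] <;> simp <;> ring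
    ext i
    simp only [Pi.add_apply, Pi.smul_apply, smul_eq_mul]
    field_simp
    linear_combination key i
  rw [this]
  exact W.add_mem (W.smul_mem _ ha) (W.smul_mem _ hb)

lemma eq_top_of_det₃_ne_zero {W : Submodule K (Fin 3 → K)} {a b c : Fin 3 → K} (ha : a ∈ W)
    (hb : b ∈ W) (hc : c ∈ W) (h : det₃ a b c ≠ 0) : W = ⊤ := by
  rw [eq_top_iff]
  intro y _
  have : y = (det₃ y b c / det₃ a b c) • a + (det₃ a y c / det₃ a b c) • b +
      (det₃ a b y / det₃ a b c) • c := by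
    have key : ∀ i, det₃ a b c * y i = det₃ y b c * a i + det₃ a y c * b i + det₃ a b y * c i := by
      intro i; fin_cases i <;> simp only [det₃] <;> simp <;> ring
    ext i
    simp only [Pi.add_apply, Pi.smul_apply, smul_eq_mul]
    field_simp
    linear_combination key i
  rw [this]
  exact W.add_mem (W.add_mem (W.smul_mem _ ha) (W.smul_mem _ hb)) (W.smul_mem _ hc)

lemma volMod_bot_eq_cross (hf : IsBlochFunction f) (v : Fin 4 → Fin 2 → K) :
    volMod f ⊥ v = cross f (v 0) (v 1) (v 2) (v 3) := by
  have hmem : ∀ i, v i ∈ Submodule.span K (Set.range v) := fun i => Submodule.subset_span ⟨i, rfl⟩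
  by_cases h : Submodule.span K (Set.range v) = ⊤
  · have : IsChart ⊥ v (LinearMap.id : (Fin 2 → K) →ₗ[K] (Fin 2 → K)) :=
      ⟨bot_le, by simp, by simpa using h⟩
    rw [this.volMod_eq]
    rfl
  · rw [cross_eq_zero hf (.inl <| by_contra fun h0 =>
      h (eq_top_of_det₂_ne_zero (hmem 0) (hmem 1) h0)), volMod_eq_zero_of_finrank_ne]
    intro h2
    rw [bot_sup_eq, finrank_bot, zero_add] at h2
    exact h (Submodule.eq_top_of_finrank_eq (by simpa using h2))

lemma exists_det₃_ne_zero_of_ne_zero {w : Fin 3 → K} (hw : w ≠ 0) : ∃ p q, det₃ w p q ≠ 0 := by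
  by_contra! h
  have h0 := h ![0, 1, 0] ![0, 0, 1]
  have h1 := h ![0, 0, 1] ![1, 0, 0]
  have h2 := h ![1, 0, 0] ![0, 1, 0]
  simp [det₃] at h0 h1 h2
  exact hw (by ext i; fin_cases i <;> simp [h0, h1, h2])

lemma ker_projAlong_le {w p q : Fin 3 → K} (h : det₃ w p q ≠ 0) :
    LinearMap.ker (projAlong w p q) ≤ Submodule.span K {w} := fun _ ha =>
  Submodule.mem_span_singleton.mpr ⟨_, (eq_smul_of_projAlong_eq_zero h ha).symm⟩

lemma map_projAlong_eq_top {w p q : Fin 3 → K} (h : det₃ w p q ≠ 0)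
    {W : Submodule K (Fin 3 → K)} (hW : Submodule.span K {w} ⊔ W = ⊤) :
    W.map (projAlong w p q) = ⊤ := by
  have h1 : (Submodule.span K {w}).map (projAlong w p q) = ⊥ := by
    rw [Submodule.map_span, Set.image_singleton, projAlong_self, Submodule.span_zero_singleton]
  have h2 := congrArg (Submodule.map (projAlong w p q)) hW
  rw [Submodule.map_sup, h1, bot_sup_eq] at h2
  rw [h2]
  refine eq_top_of_det₂_ne_zero (Submodule.mem_map_of_mem (Submodule.mem_top (x := p)))
    (Submodule.mem_map_of_mem (Submodule.mem_top (x := q))) ?_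
  rw [det₂_projAlong]
  exact mul_ne_zero h h

/-- For nonzero `w`, projection along `w` is a chart. For `w = 0` the span has dimension 3 and all
determinants vanish, so both sides are zero. -/
lemma volMod_span_singleton (hf : IsBlochFunction f) {w : Fin 3 → K} {v : Fin 4 → Fin 3 → K}
    (h : Submodule.span K {w} ⊔ Submodule.span K (Set.range v) = ⊤) :
    volMod f (Submodule.span K {w}) v = cross₃ f w (v 0) (v 1) (v 2) (v 3) := by
  by_cases hw : w = 0
  · rw [volMod_eq_zero_of_finrank_ne, cross₃]
    · simp [hw, det₃, hf.map_zero]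
    · rw [h, finrank_top, finrank_fin_fun, hw, Submodule.span_zero_singleton, finrank_bot]
      omega
  · obtain ⟨p, q, hpq⟩ := exists_det₃_ne_zero_of_ne_zero hw
    have : IsChart (Submodule.span K {w}) v (projAlong w p q) := by
      refine ⟨?_, inf_le_right.trans (ker_projAlong_le hpq), map_projAlong_eq_top hpq h⟩
      rw [Submodule.span_singleton_le_iff_mem]
      exact projAlong_self w p q
    rw [this.volMod_eq, cross_projAlong hpq]

/-- The plane of the four vectors does not contain `w`, so projection along `w` is injective on it
and itself serves as a chart. In this situation the two halves of `volDefect` cancel. -/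
lemma volMod_bot_eq_cross₃ {w : Fin 3 → K} {v : Fin 4 → Fin 3 → K}
    (h : Submodule.span K {w} ⊔ Submodule.span K (Set.range v) = ⊤)
    (h2 : finrank K (Submodule.span K (Set.range v)) = 2) :
    volMod f ⊥ v = cross₃ f w (v 0) (v 1) (v 2) (v 3) := by
  have hw : w ∉ Submodule.span K (Set.range v) := by
    intro hw
    rw [sup_eq_right.mpr (by rwa [Submodule.span_singleton_le_iff_mem])] at h
    rw [h, finrank_top, finrank_fin_fun] at h2
    omega
  have hw0 : w ≠ 0 := fun h0 => hw (h0 ▸ Submodule.zero_mem _)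
  obtain ⟨p, q, hpq⟩ := exists_det₃_ne_zero_of_ne_zero hw0
  have : IsChart ⊥ v (projAlong w p q) := by
    refine ⟨bot_le, ?_, map_projAlong_eq_top hpq h⟩
    rw [bot_sup_eq]
    rintro x ⟨hx, hx'⟩
    obtain ⟨c, rfl⟩ := Submodule.mem_span_singleton.mp (ker_projAlong_le hpq hx')
    by_cases hc : c = 0
    · simp [hc]
    · exact absurd ((Submodule.smul_mem_iff _ hc).mp hx) hw
  rw [this.volMod_eq, cross_projAlong hpq]

lemma finrank_span_singleton_le (v : E) : finrank K (Submodule.span K {v}) ≤ 1 := by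
  by_cases hv : v = 0
  · rw [hv, Submodule.span_zero_singleton, finrank_bot]
    exact zero_le_one
  · exact (finrank_span_singleton hv).le

/-- The contribution of the `i`-th of five vectors to the differential of the volume. -/
def volDefect (f : K → ℝ) (L : Submodule K E) (v : Fin 5 → E) (i : Fin 5) : ℝ :=
  volMod f L (v ∘ i.succAbove) - volMod f (L ⊔ Submodule.span K {v i}) (v ∘ i.succAbove)

lemma span_singleton_sup_span_succAbove (v : Fin 5 → E) (i : Fin 5) :
    Submodule.span K {v i} ⊔ Submodule.span K (Set.range (v ∘ i.succAbove)) =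
      Submodule.span K (Set.range v) := by
  rw [← Submodule.span_union]
  congr 1
  ext x
  constructor
  · rintro (rfl | ⟨j, rfl⟩)
    · exact ⟨i, rfl⟩
    · exact ⟨_, rfl⟩
  · rintro ⟨j, rfl⟩
    rcases Fin.eq_self_or_eq_succAbove i j with rfl | ⟨k, rfl⟩
    · exact Or.inl rfl
    · exact Or.inr ⟨k, rfl⟩

/-- Modulo a nonzero vector only dimension 1 remains, so just the first half of each defect survives
and the sum is the five-term relation. If some vector is zero, every defect vanishes by itself. -/
lemma sum_volDefect_line (hf : IsBlochFunction f) {v : Fin 5 → Fin 2 → K}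
    (hv : Submodule.span K (Set.range v) = ⊤) :
    ∑ i : Fin 5, (-1 : ℝ) ^ (i : ℕ) * volDefect f ⊥ v i = 0 := by
  by_cases h0 : ∃ i, v i = 0
  · obtain ⟨i, hi⟩ := h0
    refine Finset.sum_eq_zero fun k _ => ?_
    rw [volDefect]
    by_cases hk : i = k
    · rw [← hk, hi, Submodule.span_zero_singleton, sup_bot_eq, sub_self, mul_zero]
    · obtain ⟨j, rfl⟩ := Fin.exists_succAbove_eq hk
      rw [volMod_eq_zero_of_mem hf j (by simp [hi]), volMod_eq_zero_of_mem hf j (by simp [hi]),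
        sub_self, mul_zero]
  · push Not at h0
    have h1 : ∀ i, volDefect f ⊥ v i = volMod f ⊥ (v ∘ i.succAbove) := by
      intro i
      rw [volDefect, volMod_eq_zero_of_finrank_ne (L := ⊥ ⊔ _), sub_zero]
      rw [bot_sup_eq, span_singleton_sup_span_succAbove, hv, finrank_top, finrank_fin_fun,
        finrank_span_singleton (h0 i)]
      omega
    simp only [h1, volMod_bot_eq_cross hf, Fin.sum_univ_five]
    have := cross_five_term hf (h0 0) (h0 1) (h0 2) (h0 3) (h0 4)
    rw [← this]
    change (-1 : ℝ) ^ 0 * cross f (v 1) (v 2) (v 3) (v 4) +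
      (-1) ^ 1 * cross f (v 0) (v 2) (v 3) (v 4) + (-1) ^ 2 * cross f (v 0) (v 1) (v 3) (v 4) +
      (-1) ^ 3 * cross f (v 0) (v 1) (v 2) (v 4) + (-1) ^ 4 * cross f (v 0) (v 1) (v 2) (v 3) = _
    ring

/-- If some four vectors span only a plane, every defect vanishes separately. Otherwise each four
span the whole space, the first halves vanish and the second halves form `pencilSum`. -/
lemma sum_volDefect_plane (hf : IsBlochFunction f) {v : Fin 5 → Fin 3 → K}
    (hv : Submodule.span K (Set.range v) = ⊤) :
    ∑ i : Fin 5, (-1 : ℝ) ^ (i : ℕ) * volDefect f ⊥ v i = 0 := by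
  have hspan := fun i => (span_singleton_sup_span_succAbove (K := K) v i).trans hv
  have t2 : ∀ i, volMod f (⊥ ⊔ Submodule.span K {v i}) (v ∘ i.succAbove) =
      cross₃ f (v i) (v (i.succAbove 0)) (v (i.succAbove 1)) (v (i.succAbove 2))
        (v (i.succAbove 3)) := fun i => by
    rw [bot_sup_eq, volMod_span_singleton hf (hspan i)]
    rfl
  have t1 : ∀ i : Fin 5, finrank K (Submodule.span K (Set.range (v ∘ i.succAbove))) ≠ 2 →
      volMod f ⊥ (v ∘ i.succAbove) = 0 := fun i hi =>
    volMod_eq_zero_of_finrank_ne (by rwa [bot_sup_eq, finrank_bot, zero_add])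
  have t1' : ∀ i : Fin 5, finrank K (Submodule.span K (Set.range (v ∘ i.succAbove))) = 2 →
      volMod f ⊥ (v ∘ i.succAbove) = volMod f (⊥ ⊔ Submodule.span K {v i}) (v ∘ i.succAbove) :=
    fun i hi => by
      rw [volMod_bot_eq_cross₃ (hspan i) hi, t2]
      rfl
  by_cases h : ∃ i : Fin 5, finrank K (Submodule.span K (Set.range (v ∘ i.succAbove))) = 2
  · obtain ⟨i, hi⟩ := h
    refine Finset.sum_eq_zero fun k _ => ?_
    rw [volDefect]
    by_cases hk : finrank K (Submodule.span K (Set.range (v ∘ k.succAbove))) = 2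
    · rw [t1' k hk, sub_self, mul_zero]
    have hik : i ≠ k := fun h => hk (h ▸ hi)
    have hmem : ∀ j, j ≠ i → v j ∈ Submodule.span K (Set.range (v ∘ i.succAbove)) := fun j hj => by
      obtain ⟨l, rfl⟩ := Fin.exists_succAbove_eq hj
      exact Submodule.subset_span ⟨l, rfl⟩
    -- All vectors except $v_i$ lie in one plane. Seen from $v_k$ in that plane, the three others in
    -- it are pairwise dependent, which degenerates the cross ratio.
    have hdet : ∀ a b c, a ≠ i → b ≠ i → c ≠ i → det₃ (v a) (v b) (v c) = 0 := by
      intro a b c ha hb hc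
      by_contra h0
      rw [eq_top_of_det₃_ne_zero (hmem a ha) (hmem b hb) (hmem c hc) h0, finrank_top,
        finrank_fin_fun] at hi
      omega
    obtain ⟨m, hm⟩ := Fin.exists_succAbove_eq hik
    have hne : ∀ j, j ≠ m → k.succAbove j ≠ i := fun j hj hji =>
      hj (Fin.succAbove_right_injective (hji.trans hm.symm))
    have hz : ∀ a b, a ≠ m → b ≠ m → det₃ (v k) (v (k.succAbove a)) (v (k.succAbove b)) = 0 :=
      fun a b ha hb => hdet _ _ _ hik.symm (hne a ha) (hne b hb)
    rw [t1 k hk, t2, cross₃]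
    -- Wherever $v_i$ stands among the four, at index `m`, one of the two factors of the numerator
    -- avoids it.
    have : det₃ (v k) (v (k.succAbove 0)) (v (k.succAbove 2)) = 0 ∨
        det₃ (v k) (v (k.succAbove 1)) (v (k.succAbove 3)) = 0 := by
      by_cases hm02 : m = 0 ∨ m = 2
      · right; apply hz <;> rintro rfl <;> simp at hm02
      · left; apply hz <;> rintro rfl <;> simp at hm02
    rcases this with h | h <;> simp [h, hf.map_zero]
  · push Not at h
    have hpen := pencilSum_eq_zero hf hv fun i => by
      have htop : Submodule.span K (Set.range (v ∘ i.succAbove)) = ⊤ := by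
        refine Submodule.eq_top_of_finrank_eq ?_
        have h1 := Submodule.finrank_add_le_finrank_add_finrank (Submodule.span K {v i})
          (Submodule.span K (Set.range (v ∘ i.succAbove)))
        rw [hspan i, finrank_top, finrank_fin_fun] at h1
        have h2 : finrank K (Submodule.span K {v i}) ≤ 1 := finrank_span_singleton_le _
        have h3 := Submodule.finrank_le (Submodule.span K (Set.range (v ∘ i.succAbove)))
        have := h i
        rw [finrank_fin_fun] at h3 ⊢
        omega
      obtain ⟨a, b, c, habc⟩ := exists_det₃_ne_zero htop
      exact ⟨_, _, _, Fin.succAbove_ne i a, Fin.succAbove_ne i b, Fin.succAbove_ne i c, habc⟩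
    have h1 : ∀ i, volDefect f ⊥ v i = -cross₃ f (v i) (v (i.succAbove 0)) (v (i.succAbove 1))
        (v (i.succAbove 2)) (v (i.succAbove 3)) := fun i => by
      rw [volDefect, t1 i (h i), t2, zero_sub]
    simp only [h1, Fin.sum_univ_five]
    rw [← neg_eq_zero, ← hpen, pencilSum]
    change -((-1 : ℝ) ^ 0 * -cross₃ f (v 0) (v 1) (v 2) (v 3) (v 4) +
      (-1) ^ 1 * -cross₃ f (v 1) (v 0) (v 2) (v 3) (v 4) +
      (-1) ^ 2 * -cross₃ f (v 2) (v 0) (v 1) (v 3) (v 4) +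
      (-1) ^ 3 * -cross₃ f (v 3) (v 0) (v 1) (v 2) (v 4) +
      (-1) ^ 4 * -cross₃ f (v 4) (v 0) (v 1) (v 2) (v 3)) = _
    ring

/-- The volume modulo subspaces satisfies the cocycle identity for five arbitrary vectors. -/
theorem sum_volDefect [FiniteDimensional K E] (hf : IsBlochFunction f) (L : Submodule K E)
    (v : Fin 5 → E) : ∑ i : Fin 5, (-1 : ℝ) ^ (i : ℕ) * volDefect f L v i = 0 := by
  set U := L ⊔ Submodule.span K (Set.range v) with hU
  have hLU : finrank K L ≤ finrank K U := Submodule.finrank_mono le_sup_left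
  obtain ⟨r, hr⟩ := Nat.exists_eq_add_of_le hLU
  obtain ⟨φ, hφ⟩ := exists_isChart hr
  have hL : L.map φ = ⊥ := LinearMap.le_ker_iff_map.mp hφ.le_ker
  have hsub : ∀ i : Fin 5, Submodule.span K (Set.range (v ∘ i.succAbove)) ≤
      Submodule.span K (Set.range v) := fun i => Submodule.span_mono (Set.range_comp_subset_range _ _)
  have hdef : ∀ i, volDefect f L v i = volDefect f ⊥ (φ ∘ v) i := by
    intro i
    have e1 := volMod_map (f := f) L (v ∘ i.succAbove) φ
      ((inf_le_inf_right _ (sup_le_sup_left (hsub i) L)).trans hφ.inf_le)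
    have hvi : Submodule.span K {v i} ≤ Submodule.span K (Set.range v) :=
      Submodule.span_mono (by rintro _ rfl; exact ⟨i, rfl⟩)
    have e2 := volMod_map (f := f) (L ⊔ Submodule.span K {v i}) (v ∘ i.succAbove) φ
      ((inf_le_inf_right _ (sup_le (sup_le_sup_left hvi L)
        ((hsub i).trans le_sup_right))).trans (hφ.inf_le.trans le_sup_left))
    rw [volDefect, volDefect, ← e1, ← e2, Submodule.map_sup, hL, Submodule.map_span,
      Set.image_singleton]
    rfl
  have hspan : Submodule.span K (Set.range (φ ∘ v)) = ⊤ := by rw [span_range_comp, hφ.map_eq]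
  simp only [hdef]
  by_cases h2 : r = 2
  · subst h2; exact sum_volDefect_line hf hspan
  by_cases h3 : r = 3
  · subst h3; exact sum_volDefect_plane hf hspan
  -- For `r < 2` no rank 2 can occur. For `r ≥ 4` any four of the vectors have rank at least 3, and
  -- the quotient by the fifth still has dimension at least 3.
  refine Finset.sum_eq_zero fun i _ => ?_
  have hs := (span_singleton_sup_span_succAbove (K := K) (φ ∘ v) i).trans hspan
  have hd1 : finrank K (Submodule.span K {(φ ∘ v) i}) ≤ 1 := finrank_span_singleton_le _
  have hd2 := Submodule.finrank_add_le_finrank_add_finrank (Submodule.span K {(φ ∘ v) i})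
    (Submodule.span K (Set.range ((φ ∘ v) ∘ i.succAbove)))
  have hd3 := Submodule.finrank_le (Submodule.span K (Set.range ((φ ∘ v) ∘ i.succAbove)))
  rw [hs, finrank_top, finrank_fin_fun] at hd2
  rw [finrank_fin_fun] at hd3
  rw [volDefect, volMod_eq_zero_of_finrank_ne, volMod_eq_zero_of_finrank_ne, sub_self, mul_zero]
  · rw [bot_sup_eq, hs, finrank_top, finrank_fin_fun]
    omega
  · rw [bot_sup_eq, finrank_bot]
    omega

end FiveVectors

/-! ### Alternation from adjacent transpositions, and telescoping -/

section AlternatingReal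

lemma alternating_of_swap {X : Type*} {k : ℕ} {F : (Fin (k + 1) → X) → ℝ}
    (h : ∀ (i : Fin k) (x : Fin (k + 1) → X), F (x ∘ Equiv.swap i.castSucc i.succ) = -F x)
    (σ : Equiv.Perm (Fin (k + 1))) (x : Fin (k + 1) → X) :
    F (x ∘ σ) = ((Equiv.Perm.sign σ : ℤ) : ℝ) * F x := by
  have hσ : σ ∈ Submonoid.closure (Set.range fun i : Fin k => Equiv.swap i.castSucc i.succ) := by
    rw [Equiv.Perm.mclosure_swap_castSucc_succ]; trivial
  induction hσ using Submonoid.closure_induction generalizing x with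
  | mem y hy =>
    obtain ⟨i, rfl⟩ := hy
    rw [h, Equiv.Perm.sign_swap Fin.castSucc_lt_succ.ne]
    simp
  | one => simp
  | mul y z _ _ hy hz =>
    rw [Equiv.Perm.coe_mul, ← Function.comp_assoc, hz, hy, Equiv.Perm.sign_mul]
    push_cast
    ring

lemma sum_castSucc_sub_succ {G : Type*} [AddCommGroup G] {n : ℕ} (T : Fin (n + 1) → G) :
    ∑ m : Fin n, (T m.castSucc - T m.succ) = T 0 - T (Fin.last n) := by
  have h := (Fin.sum_univ_castSucc T).symm.trans (Fin.sum_univ_succ T)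
  rw [Finset.sum_sub_distrib, sub_eq_sub_iff_add_eq_add, h, add_comm]

lemma iSup_eq_sup_iSup_succAbove {α : Type*} [CompleteLattice α] {k : ℕ} (i : Fin (k + 1))
    (g : Fin (k + 1) → α) : ⨆ l, g l = g i ⊔ ⨆ l, g (i.succAbove l) := by
  refine le_antisymm (iSup_le fun l => ?_) (sup_le (le_iSup g i) (iSup_le fun l => le_iSup g _))
  rcases Fin.eq_self_or_eq_succAbove i l with rfl | ⟨m, rfl⟩
  · exact le_sup_left
  · exact le_sup_of_le_right (le_iSup (fun l => g (i.succAbove l)) m)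

end AlternatingReal

/-! ### The Borel function of a Bloch function on flags -/

section FlagBorel

variable {K : Type*} [Field K] {n : ℕ} {f : K → ℝ}

lemma CompleteFlag.space_zero (F : CompleteFlag K n) : F.space 0 = ⊥ := by
  rw [← Submodule.finrank_eq_zero, F.finrank_space]
  rfl

lemma CompleteFlag.space_last (F : CompleteFlag K n) : F.space (Fin.last n) = ⊤ := by
  refine Submodule.eq_top_of_finrank_eq ?_
  rw [F.finrank_space, finrank_fin_fun, Fin.val_last]

lemma AffineFlag.vec_notMem (F : AffineFlag K n) (i : Fin n) :
    F.vec i ∉ F.space i.castSucc := by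
  intro h
  have h1 := F.space_succ i
  rw [sup_eq_right.mpr (by rwa [Submodule.span_singleton_le_iff_mem])] at h1
  have h2 := F.finrank_space i.succ
  rw [h1, F.finrank_space] at h2
  simp at h2

/-- Every complete flag carries vectors that make it an affine flag. -/
lemma CompleteFlag.exists_affineFlag (F : CompleteFlag K n) :
    ∃ G : AffineFlag K n, G.toCompleteFlag = F := by
  have h : ∀ i : Fin n, ∃ v, F.space i.succ = Submodule.span K {v} ⊔ F.space i.castSucc := by
    intro i
    have hle : F.space i.castSucc ≤ F.space i.succ := F.mono i.castSucc_le_succ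
    have hlt : F.space i.castSucc < F.space i.succ := by
      refine lt_of_le_of_ne hle fun h => ?_
      have h2 := F.finrank_space i.succ
      rw [← h, F.finrank_space] at h2
      simp at h2
    obtain ⟨v, hv, hv'⟩ := SetLike.exists_of_lt hlt
    refine ⟨v, (Submodule.eq_of_le_of_finrank_le (sup_le (by
      rwa [Submodule.span_singleton_le_iff_mem]) hle) ?_).symm⟩
    have : F.space i.castSucc < Submodule.span K {v} ⊔ F.space i.castSucc := by
      refine lt_of_le_of_ne le_sup_right fun h => hv' ?_
      rw [h]
      exact Submodule.mem_sup_left (Submodule.mem_span_singleton_self v)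
    have := Submodule.finrank_lt_finrank_of_lt this
    rw [F.finrank_space] at this ⊢
    simp at this ⊢
    omega
  choose v hv using h
  exact ⟨{ F with vec := v, space_succ := hv }, rfl⟩

/-- Both vectors generate the same one-dimensional quotient of consecutive steps. -/
lemma AffineFlag.exists_smul_vec (F G : AffineFlag K n)
    (h : F.toCompleteFlag = G.toCompleteFlag) (i : Fin n) :
    ∃ c : K, c ≠ 0 ∧ G.vec i - c • F.vec i ∈ F.space i.castSucc := by
  have hm := G.vec_mem i
  rw [← h, F.space_succ i, Submodule.mem_sup] at hm
  obtain ⟨y, hy, z, hz, hyz⟩ := hm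
  obtain ⟨c, rfl⟩ := Submodule.mem_span_singleton.mp hy
  refine ⟨c, ?_, ?_⟩
  · rintro rfl
    refine G.vec_notMem i ?_
    rw [← h, ← hyz, zero_smul, zero_add]
    exact hz
  · rwa [← hyz, add_sub_cancel_left]

/-- The Borel function attached to a function `f` of the cross ratio. -/
def affineBorel (f : K → ℝ) (F : Fin 4 → AffineFlag K n) : ℝ :=
  ∑ J : Fin 4 → Fin n, volMod f (lowerSpan F J) fun i => (F i).vec (J i)

lemma affineBorel_congr (hf : IsBlochFunction f) {F G : Fin 4 → AffineFlag K n}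
    (h : ∀ i, (F i).toCompleteFlag = (G i).toCompleteFlag) : affineBorel f F = affineBorel f G := by
  refine Finset.sum_congr rfl fun J _ => ?_
  have hL : lowerSpan G J = lowerSpan F J := by
    simp only [lowerSpan, h]
  choose c hc hcm using fun i => (F i).exists_smul_vec (G i) (h i) (J i)
  rw [hL]
  exact (volMod_congr c hc hf fun i =>
    le_iSup (fun i => (F i).space (J i).castSucc) i (hcm i)).symm

lemma volMod_comp_perm (hf : IsBlochFunction f) (L : Submodule K (Fin n → K))
    (v : Fin 4 → Fin n → K) (σ : Equiv.Perm (Fin 4)) :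
    volMod f L (v ∘ σ) = ((Equiv.Perm.sign σ : ℤ) : ℝ) * volMod f L v :=
  alternating_of_swap (F := volMod f L) (fun i v => volMod_swap hf L v i) σ v

lemma affineBorel_comp_perm (hf : IsBlochFunction f) (σ : Equiv.Perm (Fin 4))
    (F : Fin 4 → AffineFlag K n) :
    affineBorel f (F ∘ σ) = ((Equiv.Perm.sign σ : ℤ) : ℝ) * affineBorel f F := by
  rw [affineBorel, affineBorel, Finset.mul_sum]
  refine (Fintype.sum_equiv (σ.symm.arrowCongr (Equiv.refl (Fin n))) _ _ fun J => ?_).symm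
  rw [← volMod_comp_perm hf]
  have hJ : σ.symm.arrowCongr (Equiv.refl (Fin n)) J = J ∘ σ := rfl
  rw [hJ]
  congr 1
  exact (σ.iSup_comp (g := fun i => (F i).space (J i).castSucc)).symm

lemma affineBorel_smul (g : GL (Fin n) K) (F : Fin 4 → AffineFlag K n) :
    affineBorel f (fun i => g • F i) = affineBorel f F := by
  refine Finset.sum_congr rfl fun J _ => ?_
  have hL : lowerSpan (fun i => g • F i) J =
      (lowerSpan F J).map (glEquiv g : (Fin n → K) ≃ₗ[K] (Fin n → K)).toLinearMap := by
    rw [lowerSpan, lowerSpan, Submodule.map_iSup]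
    rfl
  rw [hL, ← volMod_map (f := f) (lowerSpan F J) (fun i => (F i).vec (J i))
    (glEquiv g : (Fin n → K) ≃ₗ[K] (Fin n → K)).toLinearMap (by simp)]
  rfl

/-- For each `i`, summing `volDefect` over all five positions gives the Borel function with the
`i`-th flag omitted, because the sum over the `i`-th position telescopes. Exchanging the sums leaves
`sum_volDefect` at each tuple of positions. -/
lemma affineBorel_cocycle (hf : IsBlochFunction f) (x : Fin 5 → AffineFlag K n) :
    ∑ i : Fin 5, (-1 : ℝ) ^ (i : ℕ) * affineBorel f (x ∘ i.succAbove) = 0 := by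
  let L : (Fin 5 → Fin n) → Submodule K (Fin n → K) := fun J => ⨆ l, (x l).space (J l).castSucc
  let v : (Fin 5 → Fin n) → Fin 5 → Fin n → K := fun J l => (x l).vec (J l)
  have key : ∀ i : Fin 5, ∑ J, volDefect f (L J) (v J) i = affineBorel f (x ∘ i.succAbove) := by
    intro i
    rw [← (Fin.insertNthEquiv (fun _ => Fin n) i).sum_comp, Fintype.sum_prod_type_right]
    refine Finset.sum_congr rfl fun J _ => ?_
    let T : Fin (n + 1) → ℝ := fun m =>
      volMod f ((x i).space m ⊔ lowerSpan (x ∘ i.succAbove) J) fun l => (x (i.succAbove l)).vec (J l)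
    have hT : ∀ m : Fin n, volDefect f (L (Fin.insertNthEquiv (fun _ => Fin n) i (m, J)))
        (v (Fin.insertNthEquiv (fun _ => Fin n) i (m, J))) i = T m.castSucc - T m.succ := by
      intro m
      have hL : L (Fin.insertNthEquiv (fun _ => Fin n) i (m, J)) =
          (x i).space m.castSucc ⊔ lowerSpan (x ∘ i.succAbove) J := by
        simp only [L]
        rw [iSup_eq_sup_iSup_succAbove i]
        simp [lowerSpan]
      have hv : v (Fin.insertNthEquiv (fun _ => Fin n) i (m, J)) ∘ i.succAbove =
          fun l => (x (i.succAbove l)).vec (J l) := by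
        funext l
        simp [v]
      have hv' : v (Fin.insertNthEquiv (fun _ => Fin n) i (m, J)) i = (x i).vec m := by
        simp [v]
      -- Adjoining the vector of the `i`-th flag turns step `m` into step `m + 1`, so the second
      -- half of the defect is the first half at the next position.
      rw [volDefect, hL, hv, hv', sup_right_comm, sup_comm ((x i).space m.castSucc) (Submodule.span _ _),
        ← (x i).space_succ]
    rw [Finset.sum_congr rfl fun m _ => hT m, sum_castSucc_sub_succ]
    -- At the last step the subspace is everything; at step zero it is trivial and the `i`-th flag
    -- disappears.
    have h1 : T (Fin.last n) = 0 :=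
      volMod_eq_zero_of_mem hf 0 (by simp [CompleteFlag.space_last])
    rw [h1, sub_zero]
    simp only [T, CompleteFlag.space_zero, bot_sup_eq]
    rfl
  simp only [← key, Finset.mul_sum]
  rw [Finset.sum_comm]
  exact Finset.sum_eq_zero fun J _ => sum_volDefect hf (L J) (v J)

end FlagBorel

/-! ### Counting the nonzero terms -/

section Counting

variable {K : Type*} [Field K] {n : ℕ} {f : K → ℝ}

/-- The codimension of a subspace of `Kⁿ`. -/
def codim (W : Submodule K (Fin n → K)) : ℕ := n - finrank K W

lemma finrank_le_dim (W : Submodule K (Fin n → K)) : finrank K W ≤ n := by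
  have := Submodule.finrank_le W
  rwa [finrank_fin_fun] at this

lemma codim_bot : codim (⊥ : Submodule K (Fin n → K)) = n := by
  rw [codim, finrank_bot, Nat.sub_zero]

lemma codim_eq_zero_of_eq_top {W : Submodule K (Fin n → K)} (h : W = ⊤) : codim W = 0 := by
  rw [codim, h, finrank_top, finrank_fin_fun, Nat.sub_self]

lemma codim_anti {V W : Submodule K (Fin n → K)} (h : V ≤ W) : codim W ≤ codim V :=
  Nat.sub_le_sub_left (Submodule.finrank_mono h) n

lemma codim_sup_span_of_notMem {W : Submodule K (Fin n → K)} {v : Fin n → K} (h : v ∉ W) :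
    codim (W ⊔ Submodule.span K {v}) + 1 = codim W := by
  have h1 : W < W ⊔ Submodule.span K {v} := by
    refine lt_of_le_of_ne le_sup_left fun h' => h ?_
    rw [h']
    exact Submodule.mem_sup_right (Submodule.mem_span_singleton_self v)
  have h2 := Submodule.finrank_lt_finrank_of_lt h1
  have h3 := Submodule.finrank_add_le_finrank_add_finrank W (Submodule.span K {v})
  have h4 := finrank_span_singleton_le (K := K) v
  have h5 := finrank_le_dim (W ⊔ Submodule.span K {v})
  simp only [codim]
  omega

lemma codim_sup_span_of_mem {W : Submodule K (Fin n → K)} {v : Fin n → K} (h : v ∈ W) :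
    codim (W ⊔ Submodule.span K {v}) = codim W := by
  rw [sup_eq_left.mpr (by rwa [Submodule.span_singleton_le_iff_mem])]

lemma notMem_of_det₂_ne_zero {E : Type*} [AddCommGroup E] [Module K E] {W : Submodule K E}
    {φ : E →ₗ[K] (Fin 2 → K)} (hW : W ≤ LinearMap.ker φ) {a b : E}
    (h : det₂ (φ a) (φ b) ≠ 0) : b ∉ W ⊔ Submodule.span K {a} := by
  intro hb
  obtain ⟨y, hy, z, hz, rfl⟩ := Submodule.mem_sup.mp hb
  obtain ⟨c, rfl⟩ := Submodule.mem_span_singleton.mp hz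
  have hy0 : φ y = 0 := hW hy
  rw [map_add, hy0, zero_add, map_smul, det₂_smul_right, det₂_self, mul_zero] at h
  exact h rfl

/-- The function whose second differences count the nonzero terms. -/
def tetraNum (x : ℕ) : ℤ := ((x + 1).choose 3 : ℕ)

lemma tetraNum_mono : Monotone tetraNum := fun _ _ h =>
  Int.ofNat_le.mpr (Nat.choose_le_choose 3 (Nat.succ_le_succ h))

lemma tetraNum_second_diff (y : ℕ) :
    tetraNum (y + 2) - tetraNum (y + 1) - tetraNum (y + 1) + tetraNum y = y + 1 := by
  simp only [tetraNum]
  rw [show y + 2 + 1 = (y + 2) + 1 from rfl, Nat.choose_succ_succ' (y + 2) 2,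
    Nat.choose_succ_succ' (y + 1) 2, Nat.choose_succ_succ' (y + 1) 1, Nat.choose_one_right]
  push_cast
  ring

/-- If `a` or `b` lies in `W`, the expression is zero. If they are dependent modulo `W`, it is a
first difference of the monotone `tetraNum`; if independent, a genuine second difference. -/
lemma tetraNum_second_diff_nonneg {W : Submodule K (Fin n → K)} (a b : Fin n → K) :
    0 ≤ tetraNum (codim W) - tetraNum (codim (W ⊔ Submodule.span K {b})) -
      tetraNum (codim (W ⊔ Submodule.span K {a})) +
        tetraNum (codim (W ⊔ Submodule.span K {a} ⊔ Submodule.span K {b})) := by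
  by_cases ha : a ∈ W
  · rw [sup_eq_left.mpr (show Submodule.span K {a} ≤ W by
      rwa [Submodule.span_singleton_le_iff_mem])]
    linarith
  by_cases hb : b ∈ W
  · rw [codim_sup_span_of_mem (Submodule.mem_sup_left hb : b ∈ W ⊔ Submodule.span K {a}),
      codim_sup_span_of_mem hb]
    linarith
  have h1 := codim_sup_span_of_notMem ha
  have h2 := codim_sup_span_of_notMem hb
  by_cases hab : b ∈ W ⊔ Submodule.span K {a}
  · rw [codim_sup_span_of_mem hab, sub_add_cancel, sub_nonneg]
    exact tetraNum_mono (by omega)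
  · have h3 := codim_sup_span_of_notMem hab
    rw [← h1, ← h3]
    rw [show codim (W ⊔ Submodule.span K {b}) =
      codim (W ⊔ Submodule.span K {a} ⊔ Submodule.span K {b}) + 1 by omega]
    have := tetraNum_second_diff (codim (W ⊔ Submodule.span K {a} ⊔ Submodule.span K {b}))
    linarith

/-- The four codimensions are $x,x-1,x-1,x-2$, so this is the second difference of $\binom{x+1}{3}$,
which is $x-1$. -/
lemma tetraNum_second_diff_of_independent {W : Submodule K (Fin n → K)} {a b : Fin n → K}
    (hb : b ∉ W) (hab : b ∉ W ⊔ Submodule.span K {a}) (ha : a ∉ W) :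
    ((codim W - 1 : ℕ) : ℤ) = tetraNum (codim W) - tetraNum (codim (W ⊔ Submodule.span K {b})) -
      tetraNum (codim (W ⊔ Submodule.span K {a})) +
        tetraNum (codim (W ⊔ Submodule.span K {a} ⊔ Submodule.span K {b})) := by
  have h1 := codim_sup_span_of_notMem ha
  have h2 := codim_sup_span_of_notMem hb
  have h3 := codim_sup_span_of_notMem hab
  rw [← h1, ← h3]
  rw [show codim (W ⊔ Submodule.span K {b}) =
    codim (W ⊔ Submodule.span K {a} ⊔ Submodule.span K {b}) + 1 by omega]
  have := tetraNum_second_diff (codim (W ⊔ Submodule.span K {a} ⊔ Submodule.span K {b}))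
  push_cast
  linarith

lemma sum_second_diff (G : Fin (n + 1) → Fin (n + 1) → ℤ) :
    ∑ a : Fin n, ∑ b : Fin n, (G a.castSucc b.castSucc - G a.castSucc b.succ -
      G a.succ b.castSucc + G a.succ b.succ) =
      G 0 0 - G 0 (Fin.last n) - G (Fin.last n) 0 + G (Fin.last n) (Fin.last n) := by
  have h1 : ∀ a : Fin n, ∑ b : Fin n, (G a.castSucc b.castSucc - G a.castSucc b.succ -
      G a.succ b.castSucc + G a.succ b.succ) =
      (G a.castSucc 0 - G a.castSucc (Fin.last n)) - (G a.succ 0 - G a.succ (Fin.last n)) := by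
    intro a
    rw [← sum_castSucc_sub_succ (G a.castSucc), ← sum_castSucc_sub_succ (G a.succ),
      ← Finset.sum_sub_distrib]
    exact Finset.sum_congr rfl fun b _ => by ring
  rw [Finset.sum_congr rfl fun a _ => h1 a,
    sum_castSucc_sub_succ fun a => G a 0 - G a (Fin.last n)]
  ring

/-- The quadruples of positions in the flags that contribute to the Borel function. -/
def IsGoodIndex (f : K → ℝ) (F : Fin 4 → AffineFlag K n) (J : Fin 4 → Fin n) : Prop :=
  volMod f (lowerSpan F J) (fun i => (F i).vec (J i)) ≠ 0

/-- The span of two steps of the first two flags. -/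
def pairSpan (F : Fin 4 → AffineFlag K n) (a b : Fin (n + 1)) : Submodule K (Fin n → K) :=
  (F 0).space a ⊔ (F 1).space b

lemma pairSpan_succ_left (F : Fin 4 → AffineFlag K n) (a : Fin n) (b : Fin (n + 1)) :
    pairSpan F a.succ b = pairSpan F a.castSucc b ⊔ Submodule.span K {(F 0).vec a} := by
  rw [pairSpan, pairSpan, (F 0).space_succ]
  ac_rfl

lemma pairSpan_succ_right (F : Fin 4 → AffineFlag K n) (a : Fin (n + 1)) (b : Fin n) :
    pairSpan F a b.succ = pairSpan F a b.castSucc ⊔ Submodule.span K {(F 1).vec b} := by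
  rw [pairSpan, pairSpan, (F 1).space_succ, sup_comm (Submodule.span _ _), sup_assoc]

lemma pairSpan_le_lowerSpan (F : Fin 4 → AffineFlag K n) (J : Fin 4 → Fin n) :
    pairSpan F (J 0).castSucc (J 1).castSucc ≤ lowerSpan F J :=
  sup_le (le_iSup (fun i => (F i).space (J i).castSucc) 0)
    (le_iSup (fun i => (F i).space (J i).castSucc) 1)

/-- The first three positions determine the fourth. If the fourth could be larger, the old fourth
vector would lie in the new lower span. Being a combination of the first two with a nonzero
coefficient modulo the old one, it would make those two dependent modulo the new one. -/
lemma IsGoodIndex.eq_of_eq (hf : IsBlochFunction f) {F : Fin 4 → AffineFlag K n}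
    {J J' : Fin 4 → Fin n} (hJ : IsGoodIndex f F J) (hJ' : IsGoodIndex f F J')
    (h0 : J 0 = J' 0) (h1 : J 1 = J' 1) (h2 : J 2 = J' 2) : J = J' := by
  have aux : ∀ J J' : Fin 4 → Fin n, IsGoodIndex f F J → IsGoodIndex f F J' → J 0 = J' 0 →
      J 1 = J' 1 → J 2 = J' 2 → ¬J 3 < J' 3 := by
    intro J J' hJ hJ' h0 h1 h2 h3
    obtain ⟨φ, hφ, hd⟩ := exists_isChart_of_volMod_ne_zero hf hJ
    obtain ⟨ψ, hψ, hd'⟩ := exists_isChart_of_volMod_ne_zero hf hJ'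
    set v : Fin 4 → Fin n → K := fun i => (F i).vec (J i) with hv
    have hLL : lowerSpan F J ≤ lowerSpan F J' := by
      refine iSup_mono fun i => (F i).mono ?_
      fin_cases i
      · exact (congrArg Fin.castSucc h0).le
      · exact (congrArg Fin.castSucc h1).le
      · exact (congrArg Fin.castSucc h2).le
      · exact Fin.castSucc_le_castSucc_iff.mpr h3.le
    have hv3 : v 3 ∈ lowerSpan F J' := by
      refine le_iSup (fun i => (F i).space (J' i).castSucc) 3 ((F 3).mono ?_ ((F 3).vec_mem (J 3)))
      exact Fin.succ_le_castSucc_iff.mpr h3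
    have hs : ∀ i, v i ∈ lowerSpan F J ⊔ Submodule.span K (Set.range v) := mem_sup_span _ v
    -- Cramer's rule in the chart plane, read modulo the old lower span.
    have hker : det₂ (φ (v 0)) (φ (v 1)) • v 3 - det₂ (φ (v 3)) (φ (v 1)) • v 0 -
        det₂ (φ (v 0)) (φ (v 3)) • v 1 ∈ lowerSpan F J := by
      refine hφ.inf_le ⟨?_, ?_⟩
      · exact Submodule.sub_mem _ (Submodule.sub_mem _ (Submodule.smul_mem _ _ (hs 3))
          (Submodule.smul_mem _ _ (hs 0))) (Submodule.smul_mem _ _ (hs 1))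
      · rw [SetLike.mem_coe, LinearMap.mem_ker, map_sub, map_sub, map_smul, map_smul, map_smul]
        ext i
        fin_cases i <;> simp [det₂] <;> ring
    have hz : ψ (v 3) = 0 := hψ.le_ker hv3
    have hk : ψ _ = 0 := hψ.le_ker (hLL hker)
    rw [map_sub, map_sub, map_smul, map_smul, map_smul, hz, smul_zero, zero_sub, sub_eq_zero] at hk
    have hdet := congrArg (det₂ (ψ (v 0))) hk
    rw [← neg_smul, det₂_smul_right, det₂_self, mul_zero, det₂_smul_right] at hdet
    have hψ01 : det₂ (ψ (v 0)) (ψ (v 1)) ≠ 0 := by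
      have := hd' 0 1 (by decide)
      rwa [← h0, ← h1] at this
    exact mul_ne_zero (hd 0 3 (by decide)) hψ01 hdet.symm
  have h3 : J 3 = J' 3 := le_antisymm (not_lt.mp (aux J' J hJ' hJ h0.symm h1.symm h2.symm))
    (not_lt.mp (aux J J' hJ hJ' h0 h1 h2))
  funext i
  fin_cases i
  exacts [h0, h1, h2, h3]

open Classical in
/-- The number of contributing indices with given first two entries. -/
lemma card_goodIndex_fiber_le (hf : IsBlochFunction f) (F : Fin 4 → AffineFlag K n) (a b : Fin n) :
    (Finset.univ.filter fun J : Fin 4 → Fin n => IsGoodIndex f F J ∧ J 0 = a ∧ J 1 = b).card ≤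
      codim (pairSpan F a.castSucc b.castSucc) - 1 := by
  set M := pairSpan F a.castSucc b.castSucc with hM
  -- Codimension minus one, truncated at zero, as the third flag advances. At a good index the third
  -- vector lowers the codimension and the fourth shows that it stays positive, so `T` drops by one.
  -- Distinct good indices occupy distinct third positions, hence their number is at most `T 0`.
  let T : Fin (n + 1) → ℤ := fun m => ((codim (M ⊔ (F 2).space m) - 1 : ℕ) : ℤ)
  have hanti : ∀ m : Fin n, T m.succ ≤ T m.castSucc := fun m =>
    Int.ofNat_le.mpr (Nat.sub_le_sub_right
      (codim_anti (sup_le_sup_left ((F 2).mono m.castSucc_le_succ) M)) 1)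
  have hgood : ∀ J, IsGoodIndex f F J → J 0 = a → J 1 = b →
      1 ≤ T (J 2).castSucc - T (J 2).succ := by
    intro J hJ h0 h1
    obtain ⟨φ, hφ, hd⟩ := exists_isChart_of_volMod_ne_zero hf hJ
    set W := M ⊔ (F 2).space (J 2).castSucc with hW
    have hWL : W ≤ lowerSpan F J := by
      refine sup_le ?_ (le_iSup (fun i => (F i).space (J i).castSucc) 2)
      rw [hM, ← h0, ← h1]
      exact pairSpan_le_lowerSpan F J
    have hWk := hWL.trans hφ.le_ker
    have hWs : M ⊔ (F 2).space (J 2).succ = W ⊔ Submodule.span K {(F 2).vec (J 2)} := by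
      rw [(F 2).space_succ, sup_comm (Submodule.span _ _), hW, sup_assoc]
    have e1 : codim (W ⊔ Submodule.span K {(F 2).vec (J 2)}) + 1 = codim W :=
      codim_sup_span_of_notMem fun h => notMem_of_det₂_ne_zero hWk (hd 0 2 (by decide))
        (Submodule.mem_sup_left h)
    have e2 : codim (W ⊔ Submodule.span K {(F 2).vec (J 2)} ⊔ Submodule.span K {(F 3).vec (J 3)}) + 1
        = codim (W ⊔ Submodule.span K {(F 2).vec (J 2)}) :=
      codim_sup_span_of_notMem (notMem_of_det₂_ne_zero hWk (hd 2 3 (by decide)))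
    simp only [T]
    rw [hWs, ← hW]
    omega
  have hinj : Set.InjOn (fun J : Fin 4 → Fin n => J 2)
      (Finset.univ.filter fun J : Fin 4 → Fin n => IsGoodIndex f F J ∧ J 0 = a ∧ J 1 = b) := by
    intro J hJ J' hJ' h2
    simp only [Finset.coe_filter, Finset.mem_univ, true_and, Set.mem_ofPred_eq] at hJ hJ'
    exact hJ.1.eq_of_eq hf hJ'.1 (hJ.2.1.trans hJ'.2.1.symm) (hJ.2.2.trans hJ'.2.2.symm) h2
  have hsum : ∑ m : Fin n, (T m.castSucc - T m.succ) ≤ T 0 := by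
    rw [sum_castSucc_sub_succ]
    have : 0 ≤ T (Fin.last n) := Int.natCast_nonneg _
    linarith
  have hT0 : T 0 = ((codim M - 1 : ℕ) : ℤ) := by
    simp only [T, CompleteFlag.space_zero, sup_bot_eq]
  rw [← Int.ofNat_le, ← Finset.card_image_of_injOn hinj]
  rw [← hT0]
  refine le_trans ?_ hsum
  rw [← Finset.sum_add_sum_compl (Finset.image (fun J : Fin 4 → Fin n => J 2)
    (Finset.univ.filter fun J : Fin 4 → Fin n => IsGoodIndex f F J ∧ J 0 = a ∧ J 1 = b))]
  refine le_add_of_le_of_nonneg ?_ (Finset.sum_nonneg fun m _ => sub_nonneg.mpr (hanti m))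
  have := Finset.card_nsmul_le_sum (Finset.image (fun J : Fin 4 → Fin n => J 2)
    (Finset.univ.filter fun J : Fin 4 → Fin n => IsGoodIndex f F J ∧ J 0 = a ∧ J 1 = b))
    (fun m => T m.castSucc - T m.succ) 1 (fun m hm => by
      obtain ⟨J, hJ, rfl⟩ := Finset.mem_image.mp hm
      obtain ⟨-, h, h0, h1⟩ := Finset.mem_filter.mp hJ
      exact hgood J h h0 h1)
  rwa [nsmul_eq_mul, mul_one] at this

-- A pair of first positions $(a,b)$ admits at most $x-1$ good indices, $x$ being the codimension of
-- $F_0^a+F_1^b$. If it admits any, $x-1$ is the mixed second difference of `tetraNum` of the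
-- codimension; otherwise that difference is still nonnegative. Summed over $(a,b)$ the differences
-- telescope to the corner value $\binom{n+1}{3}$.
open Classical in
lemma card_goodIndex_le (hf : IsBlochFunction f) (F : Fin 4 → AffineFlag K n) :
    (Finset.univ.filter fun J : Fin 4 → Fin n => IsGoodIndex f F J).card ≤ (n + 1).choose 3 := by
  let G : Fin (n + 1) → Fin (n + 1) → ℤ := fun a b => tetraNum (codim (pairSpan F a b))
  have hG : ∀ a b : Fin n,
      ((Finset.univ.filter fun J : Fin 4 → Fin n => IsGoodIndex f F J ∧ J 0 = a ∧ J 1 = b).card : ℤ)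
        ≤ G a.castSucc b.castSucc - G a.castSucc b.succ - G a.succ b.castSucc + G a.succ b.succ := by
    intro a b
    simp only [G]
    rw [pairSpan_succ_right F a.succ, pairSpan_succ_left F a, pairSpan_succ_right]
    by_cases h : ∃ J, IsGoodIndex f F J ∧ J 0 = a ∧ J 1 = b
    · obtain ⟨J, hJ, rfl, rfl⟩ := h
      obtain ⟨φ, hφ, hd⟩ := exists_isChart_of_volMod_ne_zero hf hJ
      have hk := (pairSpan_le_lowerSpan F J).trans hφ.le_ker
      have hab := notMem_of_det₂_ne_zero hk (hd 0 1 (by decide))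
      have ha := notMem_of_det₂_ne_zero hk (a := (F 1).vec (J 1)) (b := (F 0).vec (J 0)) (by
        rw [det₂_swap, neg_ne_zero]
        exact hd 0 1 (by decide))
      rw [← tetraNum_second_diff_of_independent (fun h => hab (Submodule.mem_sup_left h)) hab
        (fun h => ha (Submodule.mem_sup_left h))]
      exact Int.ofNat_le.mpr (card_goodIndex_fiber_le hf F _ _)
    · rw [Finset.filter_false_of_mem fun J _ hJ => h ⟨J, hJ⟩, Finset.card_empty]
      exact tetraNum_second_diff_nonneg _ _
  have hcard : ((Finset.univ.filter fun J : Fin 4 → Fin n => IsGoodIndex f F J).card : ℤ) =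
      ∑ a : Fin n, ∑ b : Fin n,
        ((Finset.univ.filter fun J : Fin 4 → Fin n =>
          IsGoodIndex f F J ∧ J 0 = a ∧ J 1 = b).card : ℤ) := by
    rw [Finset.card_eq_sum_card_fiberwise (f := fun J : Fin 4 → Fin n => (J 0, J 1))
      (t := Finset.univ) (fun _ _ => Finset.mem_coe.mpr (Finset.mem_univ _)), Fintype.sum_prod_type]
    push_cast
    refine Finset.sum_congr rfl fun a _ => Finset.sum_congr rfl fun b _ => ?_
    rw [Finset.filter_filter]
    simp only [Prod.mk.injEq]
  have hlast : ∀ a, codim (pairSpan F a (Fin.last n)) = 0 := fun a =>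
    codim_eq_zero_of_eq_top (by rw [pairSpan, CompleteFlag.space_last, sup_top_eq])
  have hlast' : ∀ b, codim (pairSpan F (Fin.last n) b) = 0 := fun b =>
    codim_eq_zero_of_eq_top (by rw [pairSpan, CompleteFlag.space_last, top_sup_eq])
  have h00 : codim (pairSpan F 0 0) = n := by
    rw [pairSpan, CompleteFlag.space_zero, CompleteFlag.space_zero, sup_bot_eq, codim_bot]
  have htot := Finset.sum_le_sum fun a (_ : a ∈ Finset.univ) =>
    Finset.sum_le_sum fun b (_ : b ∈ Finset.univ) => hG a b
  rw [← hcard, sum_second_diff] at htot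
  simp only [G, hlast, hlast', h00] at htot
  have hz : tetraNum 0 = 0 := rfl
  rw [hz] at htot
  have : tetraNum n = ((n + 1).choose 3 : ℕ) := rfl
  rw [this] at htot
  omega

theorem abs_affineBorel_le (hf : IsBlochFunction f) {C : ℝ} (hC : ∀ x, |f x| ≤ C)
    (F : Fin 4 → AffineFlag K n) :
    |affineBorel f F| ≤ (n : ℝ) * ((n : ℝ) ^ 2 - 1) / 6 * C := by
  classical
  have hC0 : 0 ≤ C := (abs_nonneg _).trans (hC 0)
  have h1 : |affineBorel f F| ≤
      (Finset.univ.filter fun J : Fin 4 → Fin n => IsGoodIndex f F J).card * C := by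
    rw [affineBorel, ← Finset.sum_filter_of_ne (p := IsGoodIndex f F) fun J _ h => h]
    refine (Finset.abs_sum_le_sum_abs _ _).trans ?_
    rw [← nsmul_eq_mul]
    exact Finset.sum_le_card_nsmul _ _ _ fun J _ => abs_volMod_le hC (lowerSpan F J) _
  refine h1.trans (mul_le_mul_of_nonneg_right ?_ hC0)
  have h2 : (((n + 1).choose 3 : ℕ) : ℝ) = (n : ℝ) * ((n : ℝ) ^ 2 - 1) / 6 := by
    clear h1 F
    induction n with
    | zero => simp [Nat.choose]
    | succ k ih =>
      rw [Nat.choose_succ_succ' (k + 1) 2, Nat.cast_add, ih, Nat.cast_choose_two]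
      push_cast
      ring
  rw [← h2]
  exact_mod_cast card_goodIndex_le hf F

end Counting

/-! ### The dilogarithm and the differential of the Bloch–Wigner function -/

section Dilogarithm

open Complex

/-- The real linear form `h ↦ Im (c h)`. -/
def imMul (c : ℂ) : ℂ →L[ℝ] ℝ := Complex.imCLM ∘L (c • (1 : ℂ →L[ℝ] ℂ))

@[simp] lemma imMul_apply (c h : ℂ) : imMul c h = (c * h).im := rfl

lemma one_sub_mul_mem_slitPlane {z : ℂ} (hz : 1 - z ∈ slitPlane) {t : ℝ} (ht : t ∈ Set.Icc (0 : ℝ) 1) :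
    1 - t * z ∈ slitPlane := by
  have h := starConvex_one_slitPlane hz (a := 1 - t) (b := t) (by linarith [ht.2]) ht.1 (by ring)
  convert h using 1
  simp only [real_smul]
  push_cast
  ring

lemma continuous_one_sub_mul (z : ℂ) : Continuous fun t : ℝ => 1 - (t : ℂ) * z := by fun_prop

lemma hasDerivAt_log_one_sub_mul {z : ℂ} {t : ℝ} (h : 1 - t * z ∈ slitPlane) :
    HasDerivAt (fun s : ℝ => Complex.log (1 - s * z)) (-z / (1 - t * z)) t := by
  have h1 : HasDerivAt (fun s : ℝ => 1 - (s : ℂ) * z) (-z) t := by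
    simpa using ((Complex.ofRealCLM.hasDerivAt (x := t)).mul_const z).const_sub 1
  exact h1.clog_real h

/-- The integrand of the dilogarithm is integrable on an interval where it has no singularity. -/
lemma intervalIntegrable_dilog_aux {z : ℂ} {b : ℝ} (hb : 0 ≤ b)
    (hz : ∀ t ∈ Set.Icc (0 : ℝ) b, 1 - t * z ∈ slitPlane) :
    IntervalIntegrable (fun t : ℝ => Complex.log (1 - t * z) / t) volume 0 b := by
  set g : ℝ → ℂ := fun t => Complex.log (1 - t * z) with hg
  set s : Set ℝ := {t | 1 - (t : ℂ) * z ∈ slitPlane}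
  have hs : IsOpen s := isOpen_slitPlane.preimage (continuous_one_sub_mul z)
  have h0 : (0 : ℝ) ∈ s := by simp [s]
  -- The logarithm vanishes at `t = 0`, so the divided slope removes the apparent singularity there.
  have hcont : ContinuousOn (dslope g 0) s :=
    (continuousOn_dslope (hs.mem_nhds h0)).mpr
      ⟨fun t ht => (hasDerivAt_log_one_sub_mul ht).continuousAt.continuousWithinAt,
        (hasDerivAt_log_one_sub_mul h0).differentiableAt⟩
  have hint : IntervalIntegrable (dslope g 0) volume 0 b := by
    refine (hcont.mono ?_).intervalIntegrable
    rw [Set.uIcc_of_le hb]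
    exact hz
  refine hint.congr fun t ht => ?_
  rw [Set.uIoc_of_le hb] at ht
  change dslope g 0 t = g t / t
  rw [dslope_of_ne _ ht.1.ne', slope_def_module]
  simp [hg, div_eq_inv_mul]

lemma intervalIntegrable_dilog {z : ℂ} (hz : 1 - z ∈ slitPlane) :
    IntervalIntegrable (fun t : ℝ => Complex.log (1 - t * z) / t) volume 0 1 :=
  intervalIntegrable_dilog_aux zero_le_one fun _ ht => one_sub_mul_mem_slitPlane hz ht

/-- Differentiation under the integral cancels the `t` in the denominator and leaves $-1/(1-tz)$,
with primitive $\log(1-tz)/z$. -/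
lemma hasDerivAt_dilog {z : ℂ} (hz0 : z ≠ 0) (hz : 1 - z ∈ slitPlane) :
    HasDerivAt dilog (-(Complex.log (1 - z) / z)) z := by
  have hopen : IsOpen {w : ℂ | 1 - w ∈ slitPlane} :=
    isOpen_slitPlane.preimage (continuous_const.sub continuous_id)
  obtain ⟨ε, hε, hball⟩ := Metric.nhds_basis_closedBall.mem_iff.mp (hopen.mem_nhds hz)
  have hne : ∀ w ∈ Metric.closedBall z ε, ∀ t ∈ Set.Icc (0 : ℝ) 1, 1 - (t : ℂ) * w ∈ slitPlane :=
    fun w hw t ht => one_sub_mul_mem_slitPlane (hball hw) ht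
  have hcont : ContinuousOn (fun p : ℂ × ℝ => -(1 : ℂ) / (1 - (p.2 : ℂ) * p.1))
      (Metric.closedBall z ε ×ˢ Set.Icc (0 : ℝ) 1) := by
    refine ContinuousOn.div continuousOn_const (by fun_prop) ?_
    rintro ⟨w, t⟩ ⟨hw, ht⟩
    exact slitPlane_ne_zero (hne w hw t ht)
  obtain ⟨C, hC⟩ := ((isCompact_closedBall z ε).prod isCompact_Icc).exists_bound_of_continuousOn hcont
  have hcz : ContinuousOn (fun t : ℝ => -(1 : ℂ) / (1 - (t : ℂ) * z)) (Set.Icc 0 1) :=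
    ContinuousOn.div continuousOn_const (by fun_prop) fun t ht =>
      slitPlane_ne_zero (one_sub_mul_mem_slitPlane hz ht)
  have key := (intervalIntegral.hasDerivAt_integral_of_dominated_loc_of_deriv_le (μ := volume)
    (a := 0) (b := 1) (F := fun w t => Complex.log (1 - (t : ℝ) * w) / t)
    (F' := fun w t => -(1 : ℂ) / (1 - (t : ℝ) * w)) (x₀ := z) (s := Metric.closedBall z ε)
    (bound := fun _ => C) (Metric.closedBall_mem_nhds z hε) ?_ (intervalIntegrable_dilog hz) ?_ ?_
    intervalIntegrable_const ?_).2
  · have hval : ∫ t in (0 : ℝ)..1, -(1 : ℂ) / (1 - (t : ℝ) * z) = Complex.log (1 - z) / z := by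
      have h := intervalIntegral.integral_eq_sub_of_hasDerivAt (a := 0) (b := 1)
        (f := fun t : ℝ => Complex.log (1 - t * z) / z)
        (f' := fun t : ℝ => -(1 : ℂ) / (1 - (t : ℝ) * z)) (fun t ht => by
          rw [Set.uIcc_of_le zero_le_one] at ht
          have hm := one_sub_mul_mem_slitPlane hz ht
          refine ((hasDerivAt_log_one_sub_mul hm).div_const z).congr_deriv ?_
          rw [div_right_comm, neg_div, div_self hz0]) (by
          refine ContinuousOn.intervalIntegrable ?_
          rwa [Set.uIcc_of_le zero_le_one])
      rw [h]
      simp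
    rw [hval] at key
    exact key.neg
  · refine Eventually.of_forall fun w => Measurable.aestronglyMeasurable ?_
    exact (Complex.measurable_log.comp (continuous_one_sub_mul w).measurable).div
      Complex.measurable_ofReal
  · refine ContinuousOn.aestronglyMeasurable (hcz.mono ?_) measurableSet_uIoc
    rw [Set.uIoc_of_le zero_le_one]
    exact Set.Ioc_subset_Icc_self
  · refine Eventually.of_forall fun t ht w hw => ?_
    rw [Set.uIoc_of_le zero_le_one] at ht
    exact hC (w, t) ⟨hw, Set.Ioc_subset_Icc_self ht⟩
  · refine Eventually.of_forall fun t ht w hw => ?_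
    rw [Set.uIoc_of_le zero_le_one] at ht
    have ht0 : (t : ℂ) ≠ 0 := ofReal_ne_zero.mpr ht.1.ne'
    have h1 : HasDerivAt (fun w : ℂ => 1 - (t : ℂ) * w) (-t) w := by
      simpa using ((hasDerivAt_id w).const_mul (t : ℂ)).const_sub 1
    refine ((h1.clog (hne w hw t (Set.Ioc_subset_Icc_self ht))).div_const (t : ℂ)).congr_deriv ?_
    rw [div_right_comm, neg_div, div_self ht0]

/-- The differential of the Bloch–Wigner function. -/
def blochForm (z : ℂ) : ℂ →L[ℝ] ℝ :=
  Real.log ‖z‖ • imMul (-(1 / (1 - z))) - Real.log ‖1 - z‖ • imMul (1 / z)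

lemma hasFDerivAt_log_norm {z : ℂ} (hz : z ≠ 0) :
    HasFDerivAt (fun w : ℂ => Real.log ‖w‖) (Complex.reCLM ∘L (z⁻¹ • (1 : ℂ →L[ℝ] ℂ))) z := by
  have main : ∀ z : ℂ, z ∈ slitPlane →
      HasFDerivAt (fun w : ℂ => Real.log ‖w‖) (Complex.reCLM ∘L (z⁻¹ • (1 : ℂ →L[ℝ] ℂ))) z := by
    intro z hz
    have h := Complex.reCLM.hasFDerivAt.comp z (hasStrictFDerivAt_log_real hz).hasFDerivAt
    exact h.congr_of_eventuallyEq (Eventually.of_forall fun w => (Complex.log_re w).symm)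
  by_cases h : z ∈ slitPlane
  · exact main z h
  · have hneg : -z ∈ slitPlane := by
      rw [mem_slitPlane_iff] at h ⊢
      push Not at h
      left
      rcases lt_or_eq_of_le h.1 with h1 | h1
      · simpa using h1
      · exact absurd (Complex.ext h1 h.2) hz
    -- Off the slit plane one passes to `-z`, since $\log|z|$ is even.
    have h1 := (main (-z) hneg).comp z (hasFDerivAt_id z).neg
    have h2 : (fun w : ℂ => Real.log ‖w‖) = (fun w : ℂ => Real.log ‖w‖) ∘ fun w => -w := by
      funext w; simp
    rw [h2]
    refine h1.congr_fderiv (ContinuousLinearMap.ext fun w => ?_)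
    simp [inv_neg]

/-- The term $\arg(1-z)\,\mathrm{Re}(h/z)$ from the derivative of $\log|z|$ cancels the one in
$\mathrm{Im}(\log(1-z)\,h/z)$. The remaining form contains no argument and makes sense across the
cut. -/
lemma hasFDerivAt_blochWigner_of_mem {z : ℂ} (hz0 : z ≠ 0) (hz : 1 - z ∈ slitPlane) :
    HasFDerivAt blochWigner (blochForm z) z := by
  have h1 := Complex.imCLM.hasFDerivAt.comp z (hasDerivAt_dilog hz0 hz).complexToReal_fderiv
  have h2 : HasFDerivAt (fun w : ℂ => Complex.arg (1 - w)) (imMul (-(1 / (1 - z)))) z := by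
    have h := ((hasDerivAt_id z).const_sub 1).clog hz
    have := Complex.imCLM.hasFDerivAt.comp z h.complexToReal_fderiv
    refine (this.congr_of_eventuallyEq (f₁ := fun w : ℂ => Complex.arg (1 - w))
      (Eventually.of_forall fun w => (Complex.log_im _).symm)).congr_fderiv
      (ContinuousLinearMap.ext fun w => ?_)
    simp [neg_div]
  have h3 := h1.add (h2.mul (hasFDerivAt_log_norm hz0))
  refine (h3.congr_of_eventuallyEq (Eventually.of_forall fun w => rfl)).congr_fderiv ?_
  refine ContinuousLinearMap.ext fun h => ?_
  have e1 : Complex.log (1 - z) / z * h = Complex.log (1 - z) * (1 / z * h) := by ring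
  have e2 : z⁻¹ * h = 1 / z * h := by rw [one_div]
  simp only [blochForm, _root_.add_apply, _root_.sub_apply,
    _root_.smul_apply, ContinuousLinearMap.comp_apply, imMul_apply, smul_eq_mul,
    one_apply_eq_self, reCLM_apply, imCLM_apply, neg_mul, neg_im, e1, e2, Complex.mul_im,
    Complex.log_re, Complex.log_im]
  ring

lemma blochWigner_conj {z : ℂ} (hz : 1 - z ∈ slitPlane) :
    blochWigner (starRingEnd ℂ z) = -blochWigner z := by
  have harg : ∀ w ∈ slitPlane, w.arg ≠ Real.pi := fun w hw => (mem_slitPlane_iff_arg.mp hw).1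
  have h1 : dilog (starRingEnd ℂ z) = starRingEnd ℂ (dilog z) := by
    rw [dilog, dilog, map_neg, intervalIntegral.integral_of_le zero_le_one,
      intervalIntegral.integral_of_le zero_le_one, ← integral_conj]
    congr 1
    refine setIntegral_congr_fun measurableSet_Ioc fun t ht => ?_
    have hm := one_sub_mul_mem_slitPlane hz (Set.Ioc_subset_Icc_self ht)
    simp only [map_div₀, conj_ofReal]
    rw [← Complex.log_conj _ (harg _ hm)]
    simp
  have h2 : Complex.arg (1 - starRingEnd ℂ z) = -Complex.arg (1 - z) := by
    have := Complex.arg_conj (1 - z)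
    rw [if_neg (harg _ hz)] at this
    rw [← this]
    simp
  rw [blochWigner, blochWigner, h1, h2, conj_im, norm_conj]
  ring

/-- For $r\le1$ both terms vanish. For $r>1$ the principal argument is $\pi$ beyond $t=1/r$, so the
dilogarithm contributes $-\pi\log r$ and the correction term $+\pi\log r$. -/
lemma blochWigner_ofReal (r : ℝ) : blochWigner r = 0 := by
  rcases le_or_gt r 1 with hr | hr
  · have h1 : dilog r = ((-∫ t in (0 : ℝ)..1, Real.log (1 - t * r) / t : ℝ) : ℂ) := by
      rw [dilog, ofReal_neg, ← intervalIntegral.integral_ofReal]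
      congr 1
      refine intervalIntegral.integral_congr fun t ht => ?_
      rw [Set.uIcc_of_le zero_le_one] at ht
      have : 0 ≤ 1 - t * r := by nlinarith [ht.1, ht.2]
      change Complex.log (1 - t * r) / t = ((Real.log (1 - t * r) / t : ℝ) : ℂ)
      rw [ofReal_div, Complex.ofReal_log this]
      push_cast
      rfl
    have h2 : Complex.arg (1 - r) = 0 := by
      rw [← ofReal_one, ← ofReal_sub]
      exact Complex.arg_ofReal_of_nonneg (by linarith)
    rw [blochWigner, h1, h2, ofReal_im, zero_mul, zero_add]
  · have hr0 : 0 < r := by linarith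
    have hri : r⁻¹ < 1 := inv_lt_one_of_one_lt₀ hr
    have hri0 : 0 < r⁻¹ := inv_pos.mpr hr0
    have hint : IntervalIntegrable (fun t : ℝ => Complex.log (1 - t * r) / t) volume 0 1 := by
      -- A splitting point strictly between the two delicate points: `t = 0`, where the quotient is
      -- regular, and `t = 1/r`, where the logarithm has an integrable singularity.
      set b := (2 * r)⁻¹ with hb
      have hb0 : 0 < b := by positivity
      have hbr : b * r = 1 / 2 := by rw [hb]; field_simp
      have hb1 : b ≤ 1 := by nlinarith
      refine (intervalIntegrable_dilog_aux hb0.le fun t ht => ?_).trans (b := b) ?_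
      · have h1 := mul_le_mul_of_nonneg_right ht.2 hr0.le
        left
        simp
        linarith
      · have hm : Measurable fun t : ℝ => Complex.arg (1 - t * r) :=
          Complex.measurable_arg.comp (continuous_one_sub_mul r).measurable
        have i1 : IntervalIntegrable (fun t : ℝ => Real.log ‖(1 : ℂ) - t * r‖) volume b 1 := by
          have h : ∀ t : ℝ, ‖(1 : ℂ) - t * r‖ = ‖1 - t * r‖ := fun t => by
            rw [← norm_real]
            push_cast
            rfl
          simp only [h]
          refine MeromorphicOn.intervalIntegrable_log_norm (f := fun t : ℝ => 1 - t * r) fun t _ => ?_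
          fun_prop
        have i2 : IntervalIntegrable (fun t : ℝ => Complex.arg (1 - t * r)) volume b 1 := by
          refine (intervalIntegrable_const (c := Real.pi)).mono_fun' hm.aestronglyMeasurable ?_
          exact Eventually.of_forall fun t => abs_arg_le_pi _
        have i3 : IntervalIntegrable (fun t : ℝ => Complex.log (1 - t * r)) volume b 1 := by
          have i1' : IntervalIntegrable (fun t : ℝ => (Real.log ‖(1 : ℂ) - t * r‖ : ℂ)) volume b 1 :=
            ⟨Integrable.ofReal i1.1, Integrable.ofReal i1.2⟩
          have i2' : IntervalIntegrable (fun t : ℝ => (Complex.arg (1 - t * r) : ℂ)) volume b 1 :=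
            ⟨Integrable.ofReal i2.1, Integrable.ofReal i2.2⟩
          exact i1'.add (i2'.mul_const I)
        simp only [div_eq_mul_inv]
        refine i3.mul_continuousOn (ContinuousOn.inv₀ (by fun_prop) fun t ht => ?_)
        rw [Set.uIcc_of_le hb1] at ht
        exact ofReal_ne_zero.mpr (hb0.trans_le ht.1).ne'
    have him : (dilog r).im = -(Real.pi * Real.log r) := by
      have h := Complex.imCLM.intervalIntegral_comp_comm hint
      rw [dilog, neg_im]
      change _ = (∫ t in (0 : ℝ)..1, Complex.log (1 - t * r) / t).im at h
      rw [← h]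
      congr 1
      have e : ∀ t : ℝ, Complex.imCLM (Complex.log (1 - t * r) / t) = Complex.arg (1 - t * r) / t := by
        intro t
        rw [imCLM_apply, div_ofReal_im, log_im]
      simp only [e]
      have hre : ∀ t : ℝ, (1 : ℂ) - t * r = ((1 - t * r : ℝ) : ℂ) := fun t => by push_cast; rfl
      have hint' : IntervalIntegrable (fun t : ℝ => Complex.arg (1 - t * r) / t) volume 0 1 := by
        have : IntervalIntegrable (fun t : ℝ => (Complex.log (1 - t * r) / t).im) volume 0 1 :=
          ⟨Integrable.im hint.1, Integrable.im hint.2⟩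
        simpa only [div_ofReal_im, log_im] using this
      have hmem : r⁻¹ ∈ Set.uIcc (0 : ℝ) 1 := by
        rw [Set.uIcc_of_le zero_le_one]
        exact ⟨hri0.le, hri.le⟩
      rw [← intervalIntegral.integral_add_adjacent_intervals
        (hint'.mono_set (Set.uIcc_subset_uIcc_left hmem))
        (hint'.mono_set (Set.uIcc_subset_uIcc_right hmem))]
      have i1 : ∫ t in (0 : ℝ)..r⁻¹, Complex.arg (1 - t * r) / t = 0 := by
        rw [intervalIntegral.integral_of_le hri0.le]
        refine setIntegral_eq_zero_of_forall_eq_zero fun t ht => ?_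
        rw [hre, Complex.arg_ofReal_of_nonneg, zero_div]
        have := mul_le_mul_of_nonneg_right ht.2 hr0.le
        rw [inv_mul_cancel₀ hr0.ne'] at this
        linarith
      have i2 : ∫ t in r⁻¹..1, Complex.arg (1 - t * r) / t = Real.pi * Real.log r := by
        have : ∫ t in r⁻¹..1, Complex.arg (1 - t * r) / t = ∫ t in r⁻¹..1, Real.pi * t⁻¹ := by
          rw [intervalIntegral.integral_of_le hri.le, intervalIntegral.integral_of_le hri.le]
          refine setIntegral_congr_fun measurableSet_Ioc fun t ht => ?_
          have h1 := mul_lt_mul_of_pos_right ht.1 hr0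
          rw [inv_mul_cancel₀ hr0.ne'] at h1
          simp only [hre]
          rw [Complex.arg_ofReal_of_neg (by linarith), div_eq_mul_inv]
        rw [this, intervalIntegral.integral_const_mul, integral_inv_of_pos hri0 one_pos, one_div,
          inv_inv]
      rw [i1, i2, zero_add]
    have h2 : Complex.arg (1 - r) = Real.pi := by
      rw [← ofReal_one, ← ofReal_sub]
      exact Complex.arg_ofReal_of_neg (by linarith)
    rw [blochWigner, him, h2, norm_real, Real.norm_of_nonneg hr0.le]
    ring

end Dilogarithm

/-! ### Functional equations and continuity of the Bloch–Wigner function -/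

section FunctionalEquations

open Complex

lemma blochWigner_of_im_eq_zero {z : ℂ} (h : z.im = 0) : blochWigner z = 0 := by
  have : z = (z.re : ℂ) := Complex.ext rfl (by simp [h])
  rw [this, blochWigner_ofReal]

lemma one_sub_mem_slitPlane_of_im_ne_zero {z : ℂ} (h : z.im ≠ 0) : 1 - z ∈ slitPlane :=
  Or.inr (by simpa using h)

lemma blochWigner_starRingEnd (z : ℂ) : blochWigner (starRingEnd ℂ z) = -blochWigner z := by
  by_cases h : z.im = 0
  · rw [blochWigner_of_im_eq_zero h, blochWigner_of_im_eq_zero (by simpa using h), neg_zero]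
  · exact blochWigner_conj (one_sub_mem_slitPlane_of_im_ne_zero h)

lemma imMul_add (a b : ℂ) : imMul (a + b) = imMul a + imMul b := by
  ext h
  simp
  ring

lemma imMul_neg (a : ℂ) : imMul (-a) = -imMul a := by
  ext h
  simp

lemma imMul_sub (a b : ℂ) : imMul (a - b) = imMul a - imMul b := by
  rw [sub_eq_add_neg, imMul_add, imMul_neg, ← sub_eq_add_neg]

lemma HasFDerivAt.blochWigner_comp {g : ℂ → ℂ} {g' x : ℂ} (hg : HasDerivAt g g' x)
    (hD : HasFDerivAt blochWigner (blochForm (g x)) (g x)) :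
    HasFDerivAt (fun w => blochWigner (g w))
      (-(Real.log ‖g x‖ • imMul (g' / (1 - g x))) - Real.log ‖1 - g x‖ • imMul (g' / g x)) x := by
  refine (hD.comp x hg.complexToReal_fderiv).congr_fderiv (ContinuousLinearMap.ext fun h => ?_)
  have e1 : 1 / (1 - g x) * (g' * h) = g' / (1 - g x) * h := by ring
  have e2 : 1 / g x * (g' * h) = g' / g x * h := by ring
  simp only [blochForm, ContinuousLinearMap.comp_apply, _root_.sub_apply, _root_.smul_apply,
    _root_.neg_apply, imMul_apply, smul_eq_mul, one_apply_eq_self, neg_mul, neg_im, e1, e2]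
  ring

lemma eq_zero_on_upperHalfPlane {G : ℂ → ℝ} (hG : ∀ z : ℂ, 0 < z.im → HasFDerivAt G (0 : ℂ →L[ℝ] ℝ) z) {w : ℂ}
    (hw : 0 < w.im) (h0 : G w = 0) {z : ℂ} (hz : 0 < z.im) : G z = 0 := by
  have hopen : IsOpen {z : ℂ | 0 < z.im} := isOpen_lt continuous_const Complex.continuous_im
  have hconv : Convex ℝ {z : ℂ | 0 < z.im} := convex_halfSpace_im_gt 0
  rw [← h0]
  exact hopen.is_const_of_fderiv_eq_zero (𝕜 := ℝ) hconv.isPreconnected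
    (fun z hz => (hG z hz).differentiableAt.differentiableWithinAt)
    (fun z hz => (hG z hz).fderiv) hz hw

/-- On the upper half-plane the differentials cancel. The base point $1/2+i$ satisfies $1-w=\bar w$,
so oddness under conjugation gives the value 0 there. Conjugation handles the lower half-plane. -/
lemma blochWigner_one_sub (z : ℂ) : blochWigner (1 - z) = -blochWigner z := by
  have upper : ∀ z : ℂ, 0 < z.im → blochWigner (1 - z) + blochWigner z = 0 := by
    intro z hz
    refine eq_zero_on_upperHalfPlane (G := fun z => blochWigner (1 - z) + blochWigner z)
      (fun z hz => ?_) (w := 1 / 2 + I) (by simp) ?_ hz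
    · have hz0 : z ≠ 0 := by rintro rfl; simp at hz
      have hz1 : 1 - z ≠ 0 := by
        intro h
        have := congrArg Complex.im h
        simp at this
        linarith
      have h1 : HasFDerivAt blochWigner (blochForm (1 - z)) (1 - z) :=
        hasFDerivAt_blochWigner_of_mem hz1 (by
          rw [sub_sub_cancel]
          exact Or.inr hz.ne')
      have h2 := HasFDerivAt.blochWigner_comp ((hasDerivAt_id z).const_sub 1) h1
      have h3 := hasFDerivAt_blochWigner_of_mem hz0 (one_sub_mem_slitPlane_of_im_ne_zero hz.ne')
      refine (h2.add h3).congr_fderiv ?_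
      simp only [id, sub_sub_cancel, blochForm, neg_div, imMul_neg]
      module
    · have : (1 : ℂ) - (1 / 2 + I) = starRingEnd ℂ (1 / 2 + I) := by
        apply Complex.ext <;> norm_num
      simp only [this, blochWigner_starRingEnd, neg_add_cancel]
  rcases lt_trichotomy z.im 0 with h | h | h
  · have := upper (starRingEnd ℂ z) (by simpa using h)
    rw [show (1 : ℂ) - starRingEnd ℂ z = starRingEnd ℂ (1 - z) by simp, blochWigner_starRingEnd,
      blochWigner_starRingEnd] at this
    linarith
  · rw [blochWigner_of_im_eq_zero h, blochWigner_of_im_eq_zero (by simpa using h), neg_zero]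
  · linarith [upper z h]

/-- The reflection $z\mapsto1-z$ carries the cut beyond 1 to the negative axis, where the defining
formula is differentiable. -/
lemma hasFDerivAt_blochWigner {z : ℂ} (hz0 : z ≠ 0) (hz1 : z ≠ 1) :
    HasFDerivAt blochWigner (blochForm z) z := by
  by_cases h : 1 - z ∈ slitPlane
  · exact hasFDerivAt_blochWigner_of_mem hz0 h
  · have hz : z ∈ slitPlane := by
      rw [mem_slitPlane_iff] at h
      push Not at h
      left
      have := h.1
      simp at this
      linarith
    have h1 : HasFDerivAt blochWigner (blochForm (1 - z)) (1 - z) :=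
      hasFDerivAt_blochWigner_of_mem (sub_ne_zero.mpr hz1.symm) (by rwa [sub_sub_cancel])
    have h2 := (HasFDerivAt.blochWigner_comp ((hasDerivAt_id z).const_sub 1) h1).neg
    refine (h2.congr_of_eventuallyEq (Eventually.of_forall fun w => ?_)).congr_fderiv ?_
    · simp [blochWigner_one_sub]
    · simp only [id, sub_sub_cancel, blochForm, neg_div, imMul_neg]
      module

lemma log_norm_div {a b : ℂ} (ha : a ≠ 0) (hb : b ≠ 0) :
    Real.log ‖a / b‖ = Real.log ‖a‖ - Real.log ‖b‖ := by
  rw [norm_div, Real.log_div (norm_ne_zero_iff.mpr ha) (norm_ne_zero_iff.mpr hb)]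

lemma log_norm_mul {a b : ℂ} (ha : a ≠ 0) (hb : b ≠ 0) :
    Real.log ‖a * b‖ = Real.log ‖a‖ + Real.log ‖b‖ := by
  rw [norm_mul, Real.log_mul (norm_ne_zero_iff.mpr ha) (norm_ne_zero_iff.mpr hb)]

/-- Constancy on the upper half-plane again, with base point $i$, where inversion is conjugation. -/
lemma blochWigner_inv (z : ℂ) : blochWigner z⁻¹ = -blochWigner z := by
  have upper : ∀ z : ℂ, 0 < z.im → blochWigner z⁻¹ + blochWigner z = 0 := by
    intro z hz
    refine eq_zero_on_upperHalfPlane (G := fun z => blochWigner z⁻¹ + blochWigner z)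
      (fun z hz => ?_) (w := I) (by simp) ?_ hz
    · have hz0 : z ≠ 0 := by rintro rfl; simp at hz
      have hz1 : z ≠ 1 := by rintro rfl; simp at hz
      have hz1' : 1 - z ≠ 0 := sub_ne_zero.mpr hz1.symm
      have hi0 : z⁻¹ ≠ 0 := inv_ne_zero hz0
      have hi1 : z⁻¹ ≠ 1 := by simpa using hz1
      have h1 := HasFDerivAt.blochWigner_comp (hasDerivAt_inv hz0) (hasFDerivAt_blochWigner hi0 hi1)
      refine (h1.add (hasFDerivAt_blochWigner hz0 hz1)).congr_fderiv ?_
      have e1 : 1 - z⁻¹ = -((1 - z) / z) := by field_simp; ring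
      have e2 : -(z ^ 2)⁻¹ / (1 - z⁻¹) = 1 / (1 - z) + 1 / z := by
        rw [e1]; field_simp; ring
      have e3 : -(z ^ 2)⁻¹ / z⁻¹ = -(1 / z) := by field_simp
      have e4 : Real.log ‖1 - z⁻¹‖ = Real.log ‖1 - z‖ - Real.log ‖z‖ := by
        rw [e1, norm_neg, log_norm_div hz1' hz0]
      rw [e2, e3, e4, norm_inv, Real.log_inv]
      simp only [blochForm, imMul_neg, imMul_add]
      module
    · simp only [Complex.inv_I]
      rw [← Complex.conj_I, blochWigner_starRingEnd, neg_add_cancel]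
  rcases lt_trichotomy z.im 0 with h | h | h
  · have := upper (starRingEnd ℂ z) (by simpa using h)
    rw [← map_inv₀, blochWigner_starRingEnd, blochWigner_starRingEnd] at this
    linarith
  · rw [blochWigner_of_im_eq_zero h, blochWigner_of_im_eq_zero (by simp [Complex.inv_im, h]), neg_zero]
  · linarith [upper z h]

lemma blochWigner_zero : blochWigner 0 = 0 := blochWigner_of_im_eq_zero rfl

lemma blochWigner_one : blochWigner 1 = 0 := blochWigner_of_im_eq_zero rfl

lemma norm_log_one_sub_le {z : ℂ} (hz : ‖z‖ ≤ 1 / 2) : ‖Complex.log (1 - z)‖ ≤ 3 / 2 * ‖z‖ := by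
  have := Complex.norm_log_one_add_half_le_self (z := -z) (by rwa [norm_neg])
  rwa [norm_neg, ← sub_eq_add_neg] at this

lemma continuousAt_blochWigner_zero : ContinuousAt blochWigner 0 := by
  have hbound : ∀ᶠ z in 𝓝 (0 : ℂ), ‖blochWigner z‖ ≤
      3 / 2 * ‖z‖ + 3 / 2 * |‖z‖ * Real.log ‖z‖| := by
    filter_upwards [Metric.closedBall_mem_nhds (0 : ℂ) (show (0 : ℝ) < 1 / 2 by norm_num)] with z hz
    rw [mem_closedBall_zero_iff] at hz
    have h1 : ‖dilog z‖ ≤ 3 / 2 * ‖z‖ := by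
      rw [dilog, norm_neg]
      refine (intervalIntegral.norm_integral_le_of_norm_le_const (C := 3 / 2 * ‖z‖)
        fun t ht => ?_).trans (by simp)
      rw [Set.uIoc_of_le zero_le_one] at ht
      have hn : ‖(t : ℂ) * z‖ = t * ‖z‖ := by rw [norm_mul, norm_real, Real.norm_of_nonneg ht.1.le]
      have := norm_log_one_sub_le (z := t * z) (by
        rw [hn]
        nlinarith [norm_nonneg z, ht.1, ht.2])
      rw [norm_div, norm_real, Real.norm_of_nonneg ht.1.le, div_le_iff₀ ht.1]
      rw [hn] at this
      linarith
    have h2 : |Complex.arg (1 - z)| ≤ 3 / 2 * ‖z‖ := by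
      rw [← Complex.log_im]
      exact (Complex.abs_im_le_norm _).trans (norm_log_one_sub_le hz)
    rw [blochWigner]
    refine (norm_add_le _ _).trans (add_le_add ((Complex.abs_im_le_norm _).trans h1) ?_)
    rw [norm_mul, abs_mul, abs_norm, ← mul_assoc]
    exact mul_le_mul_of_nonneg_right h2 (norm_nonneg _)
  have hlim : Tendsto (fun z : ℂ => 3 / 2 * ‖z‖ + 3 / 2 * |‖z‖ * Real.log ‖z‖|) (𝓝 0) (𝓝 0) := by
    have hc : Continuous fun z : ℂ => 3 / 2 * ‖z‖ + 3 / 2 * |‖z‖ * Real.log ‖z‖| :=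
      (continuous_const.mul continuous_norm).add
        (continuous_const.mul (Real.continuous_mul_log.comp continuous_norm).abs)
    simpa using hc.tendsto 0
  rw [ContinuousAt, blochWigner_zero]
  exact squeeze_zero_norm' hbound hlim

lemma continuous_blochWigner : Continuous blochWigner := by
  rw [continuous_iff_continuousAt]
  intro z
  by_cases h0 : z = 0
  · rw [h0]
    exact continuousAt_blochWigner_zero
  by_cases h1 : z = 1
  · have : blochWigner = fun w => -blochWigner (1 - w) := by
      funext w; rw [blochWigner_one_sub, neg_neg]
    have h2 : ContinuousAt blochWigner (1 - z) := by
      rw [h1, sub_self]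
      exact continuousAt_blochWigner_zero
    rw [this]
    exact (ContinuousAt.comp (f := fun w : ℂ => 1 - w) h2
      (continuous_const.sub continuous_id).continuousAt).neg
  · exact (hasFDerivAt_blochWigner h0 h1).continuousAt

/-- Inversion carries the behaviour at infinity to continuity at 0. -/
lemma tendsto_blochWigner_cocompact : Tendsto blochWigner (cocompact ℂ) (𝓝 0) := by
  have h := ((continuous_blochWigner.tendsto 0).comp (tendsto_inv₀_cobounded (α := ℂ))).neg
  rw [blochWigner_zero, neg_zero] at h
  rw [← Metric.cobounded_eq_cocompact]
  refine h.congr fun z => ?_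
  simp [blochWigner_inv]

lemma uniformContinuous_blochWigner : UniformContinuous blochWigner :=
  continuous_blochWigner.uniformContinuous_of_tendsto_cocompact tendsto_blochWigner_cocompact

/-- With `y` fixed, the left side has zero differential in `x` off the finite set $\{0,1,y\}$, whose
complement is connected. The constant is read off at $x\to1$, where the terms cancel or vanish. -/
theorem blochWigner_five_term (x y : ℂ) (hx0 : x ≠ 0) (hx1 : x ≠ 1) (hy0 : y ≠ 0) (hy1 : y ≠ 1)
    (hxy : x ≠ y) :
    blochWigner x - blochWigner y + blochWigner (y / x) -
      blochWigner ((1 - x⁻¹) / (1 - y⁻¹)) + blochWigner ((1 - x) / (1 - y)) = 0 := by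
  set G : ℂ → ℝ := fun x => blochWigner x - blochWigner y + blochWigner (y / x) -
      blochWigner ((1 - x⁻¹) / (1 - y⁻¹)) + blochWigner ((1 - x) / (1 - y)) with hG
  have hy1' : 1 - y ≠ 0 := sub_ne_zero.mpr hy1.symm
  have hyi : 1 - y⁻¹ ≠ 0 := sub_ne_zero.mpr (by simpa [eq_comm] using hy1)
  have hyi' : 1 - y⁻¹ = -(1 - y) / y := by field_simp; ring
  have hder : ∀ x : ℂ, x ≠ 0 → x ≠ 1 → x ≠ y → HasFDerivAt G (0 : ℂ →L[ℝ] ℝ) x := by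
    intro x hx0 hx1 hxy
    have hx1' : 1 - x ≠ 0 := sub_ne_zero.mpr hx1.symm
    have hxy' : x - y ≠ 0 := sub_ne_zero.mpr hxy
    have a3 : 1 - y / x = (x - y) / x := by field_simp
    have a4' : (1 - x⁻¹) / (1 - y⁻¹) = (1 - x) * y / (x * (1 - y)) := by
      rw [hyi']; field_simp; ring
    have a4 : 1 - (1 - x⁻¹) / (1 - y⁻¹) = (x - y) / (x * (1 - y)) := by
      rw [a4']; field_simp; ring
    have a5 : 1 - (1 - x) / (1 - y) = (x - y) / (1 - y) := by field_simp; ring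
    have n3 : y / x ≠ 1 := fun h => div_ne_zero hxy' hx0 (by rw [← a3, h, sub_self])
    have n4 : (1 - x⁻¹) / (1 - y⁻¹) ≠ 1 := fun h =>
      div_ne_zero hxy' (mul_ne_zero hx0 hy1') (by rw [← a4, h, sub_self])
    have n5 : (1 - x) / (1 - y) ≠ 1 := fun h =>
      div_ne_zero hxy' hy1' (by rw [← a5, h, sub_self])
    have z4 : (1 - x⁻¹) / (1 - y⁻¹) ≠ 0 := by
      rw [a4']; exact div_ne_zero (mul_ne_zero hx1' hy0) (mul_ne_zero hx0 hy1')
    have d1 := hasFDerivAt_blochWigner hx0 hx1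
    have g3 : HasDerivAt (fun x : ℂ => y / x) (-(y / x ^ 2)) x := by
      simpa [div_eq_mul_inv] using (hasDerivAt_inv hx0).const_mul y
    have d3 := HasFDerivAt.blochWigner_comp g3 (hasFDerivAt_blochWigner (div_ne_zero hy0 hx0) n3)
    have g4 : HasDerivAt (fun x : ℂ => (1 - x⁻¹) / (1 - y⁻¹)) ((x ^ 2)⁻¹ / (1 - y⁻¹)) x := by
      simpa using ((hasDerivAt_inv hx0).const_sub 1).div_const (1 - y⁻¹)
    have d4 := HasFDerivAt.blochWigner_comp g4 (hasFDerivAt_blochWigner z4 n4)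
    have g5 : HasDerivAt (fun x : ℂ => (1 - x) / (1 - y)) (-1 / (1 - y)) x := by
      simpa using ((hasDerivAt_id x).const_sub 1).div_const (1 - y)
    have d5 := HasFDerivAt.blochWigner_comp g5
      (hasFDerivAt_blochWigner (div_ne_zero hx1' hy1') n5)
    refine ((((d1.sub_const _).add d3).sub d4).add d5).congr_fderiv ?_
    have b3 : -(y / x ^ 2) / (1 - y / x) = 1 / x - 1 / (x - y) := by
      rw [a3]; field_simp; ring
    have c3 : -(y / x ^ 2) / (y / x) = -(1 / x) := by field_simp
    have b4 : (x ^ 2)⁻¹ / (1 - y⁻¹) / (1 - (1 - x⁻¹) / (1 - y⁻¹)) = 1 / x - 1 / (x - y) := by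
      rw [a4, hyi']; field_simp; ring
    have c4 : (x ^ 2)⁻¹ / (1 - y⁻¹) / ((1 - x⁻¹) / (1 - y⁻¹)) = -(1 / (1 - x)) - 1 / x := by
      rw [a4', hyi']; field_simp; ring
    have b5 : -1 / (1 - y) / (1 - (1 - x) / (1 - y)) = -(1 / (x - y)) := by
      rw [a5]; field_simp
    have c5 : -1 / (1 - y) / ((1 - x) / (1 - y)) = -(1 / (1 - x)) := by field_simp
    rw [b3, c3, b4, c4, b5, c5, a3, a4, a5, a4', log_norm_div hy0 hx0, log_norm_div hxy' hx0,
      log_norm_div (mul_ne_zero hx1' hy0) (mul_ne_zero hx0 hy1'), log_norm_mul hx1' hy0,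
      log_norm_mul hx0 hy1', log_norm_div hxy' (mul_ne_zero hx0 hy1'), log_norm_mul hx0 hy1',
      log_norm_div hx1' hy1', log_norm_div hxy' hy1']
    simp only [blochForm, imMul_neg, imMul_sub]
    module
  have hfin : ({0, 1, y} : Set ℂ).Finite := by simp
  have hconn : IsPreconnected ({0, 1, y} : Set ℂ)ᶜ :=
    (hfin.countable.isConnected_compl_of_one_lt_rank (by
      rw [Complex.rank_real_complex]; norm_num)).isPreconnected
  have hmem : ∀ x ∈ ({0, 1, y} : Set ℂ)ᶜ, x ≠ 0 ∧ x ≠ 1 ∧ x ≠ y := fun x hx => by simpa using hx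
  have hd : ∀ x ∈ ({0, 1, y} : Set ℂ)ᶜ, HasFDerivAt G (0 : ℂ →L[ℝ] ℝ) x := fun x hx =>
    hder x (hmem x hx).1 (hmem x hx).2.1 (hmem x hx).2.2
  have hconst : ∀ w ∈ ({0, 1, y} : Set ℂ)ᶜ, G x = G w := fun w hw =>
    hfin.isClosed.isOpen_compl.is_const_of_fderiv_eq_zero (𝕜 := ℝ) hconn
      (fun z hz => (hd z hz).differentiableAt.differentiableWithinAt)
      (fun z hz => (hd z hz).fderiv) (by simp [hx0, hx1, hxy]) hw
  have hcont : ContinuousAt G 1 := by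
    have c := continuous_blochWigner
    have h3 : ContinuousAt (fun x : ℂ => y / x) 1 := continuousAt_const.div continuousAt_id one_ne_zero
    have h4 : ContinuousAt (fun x : ℂ => (1 - x⁻¹) / (1 - y⁻¹)) 1 :=
      (continuousAt_const.sub (continuousAt_inv₀ one_ne_zero)).div_const _
    have h5 : ContinuousAt (fun x : ℂ => (1 - x) / (1 - y)) 1 := by fun_prop
    exact (((c.continuousAt.sub continuousAt_const).add (c.continuousAt.comp h3)).sub
      (c.continuousAt.comp h4)).add (c.continuousAt.comp h5)
  have hG1 : G 1 = 0 := by simp [hG, blochWigner_one, blochWigner_zero]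
  have hev : ∀ᶠ w in 𝓝[≠] (1 : ℂ), G w = G x := by
    have h0 : ∀ᶠ w in 𝓝[≠] (1 : ℂ), w ≠ 0 :=
      eventually_nhdsWithin_of_eventually_nhds (isOpen_ne.mem_nhds one_ne_zero)
    have h2 : ∀ᶠ w in 𝓝[≠] (1 : ℂ), w ≠ y :=
      eventually_nhdsWithin_of_eventually_nhds (isOpen_ne.mem_nhds hy1.symm)
    filter_upwards [h0, h2, self_mem_nhdsWithin] with w hw0 hwy hw1
    refine (hconst w ?_).symm
    simp only [Set.mem_compl_iff, Set.mem_insert_iff, Set.mem_singleton_iff, not_or]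
    exact ⟨hw0, hw1, hwy⟩
  have hlim : Tendsto G (𝓝[≠] 1) (𝓝 (G 1)) := hcont.tendsto.mono_left nhdsWithin_le_nhds
  have hlim' : Tendsto G (𝓝[≠] 1) (𝓝 (G x)) := tendsto_const_nhds.congr' (hev.mono fun _ h => h.symm)
  exact (tendsto_nhds_unique hlim' hlim).trans hG1

end FunctionalEquations

/-! ### Integrals of the logarithm of the sine -/

section LogSine

open Real intervalIntegral

/-- The integrand `log (2 sin u)` of the Lobachevsky function. -/
def logTwoSin (u : ℝ) : ℝ := Real.log (2 * Real.sin u)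

lemma intervalIntegrable_logTwoSin (a b : ℝ) : IntervalIntegrable logTwoSin volume a b := by
  refine MeromorphicOn.intervalIntegrable_log (f := fun u => 2 * Real.sin u) fun t _ => ?_
  exact ((analyticAt_const.mul analyticAt_sin)).meromorphicAt

lemma integral_congr_on_Ioo {a b : ℝ} {f g : ℝ → ℝ} (hab : a ≤ b)
    (h : ∀ u ∈ Set.Ioo a b, f u = g u) : ∫ u in a..b, f u = ∫ u in a..b, g u := by
  rw [integral_of_le hab, integral_of_le hab, integral_Ioc_eq_integral_Ioo,
    integral_Ioc_eq_integral_Ioo]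
  exact setIntegral_congr_fun measurableSet_Ioo h

lemma integral_logTwoSin_zero_pi : ∫ u in (0 : ℝ)..π, logTwoSin u = 0 := by
  have h : ∫ u in (0 : ℝ)..π, logTwoSin u = ∫ u in (0 : ℝ)..π, (Real.log 2 + Real.log (Real.sin u)) := by
    refine integral_congr_on_Ioo pi_pos.le fun u hu => ?_
    exact Real.log_mul two_ne_zero (sin_pos_of_mem_Ioo hu).ne'
  have hi : IntervalIntegrable (fun u => Real.log (Real.sin u)) volume 0 π :=
    intervalIntegrable_log_sin
  rw [h, integral_add intervalIntegrable_const hi, intervalIntegral.integral_const, integral_log_sin_zero_pi,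
    smul_eq_mul]
  ring

lemma integral_logTwoSin_symm :
    ∫ u in (2 * π / 3)..π, logTwoSin u = ∫ u in (0 : ℝ)..(π / 3), logTwoSin u := by
  have h := integral_comp_sub_left (a := 0) (b := π / 3) logTwoSin π
  rw [sub_zero, show π - π / 3 = 2 * π / 3 by ring] at h
  rw [← h]
  simp [logTwoSin]

lemma integral_logTwoSin_middle : ∫ u in (π / 3)..(2 * π / 3), logTwoSin u =
    -2 * ∫ u in (0 : ℝ)..(π / 3), logTwoSin u := by
  have h1 := integral_add_adjacent_intervals (intervalIntegrable_logTwoSin 0 (π / 3))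
    (intervalIntegrable_logTwoSin (π / 3) (2 * π / 3))
  have h2 := integral_add_adjacent_intervals (intervalIntegrable_logTwoSin 0 (2 * π / 3))
    (intervalIntegrable_logTwoSin (2 * π / 3) π)
  rw [integral_logTwoSin_symm, integral_logTwoSin_zero_pi] at h2
  linarith

lemma continuousOn_logTwoCos :
    ContinuousOn (fun u => Real.log (2 * Real.cos u)) (Set.uIcc 0 (π / 3)) := by
  refine ContinuousOn.log (by fun_prop) fun u hu => ?_
  rw [Set.uIcc_of_le (by positivity)] at hu
  have := cos_pos_of_mem_Ioo (x := u) ⟨by linarith [hu.1, pi_pos], by linarith [hu.2, pi_pos]⟩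
  positivity

/-- The duplication formula $2\sin 2u=(2\sin u)(2\cos u)$, together with the value of the integral
over the middle third. -/
lemma two_mul_integral_logTwoCos : 2 * ∫ u in (0 : ℝ)..(π / 3), Real.log (2 * Real.cos u) =
    -3 * ∫ u in (0 : ℝ)..(π / 3), logTwoSin u := by
  have h1 : ∫ u in (0 : ℝ)..(π / 3), logTwoSin (2 * u) =
      ∫ u in (0 : ℝ)..(π / 3), (logTwoSin u + Real.log (2 * Real.cos u)) := by
    refine integral_congr_on_Ioo (by positivity) fun u hu => ?_
    have hs : 0 < Real.sin u := sin_pos_of_mem_Ioo ⟨hu.1, by linarith [hu.2, pi_pos]⟩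
    have hc : 0 < Real.cos u :=
      cos_pos_of_mem_Ioo ⟨by linarith [hu.1, pi_pos], by linarith [hu.2, pi_pos]⟩
    simp only [logTwoSin]
    rw [sin_two_mul, ← Real.log_mul (by positivity) (by positivity)]
    congr 1
    ring
  rw [integral_add (intervalIntegrable_logTwoSin _ _) continuousOn_logTwoCos.intervalIntegrable,
    integral_comp_mul_left _ two_ne_zero, mul_zero, show 2 * (π / 3) = 2 * π / 3 by ring] at h1
  have h2 := integral_add_adjacent_intervals (intervalIntegrable_logTwoSin 0 (π / 3))
    (intervalIntegrable_logTwoSin (π / 3) (2 * π / 3))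
  rw [integral_logTwoSin_middle] at h2
  rw [smul_eq_mul, ← h2] at h1
  linarith

end LogSine

/-! ### The maximum of the Bloch–Wigner function -/

section Maximum

open Complex

lemma norm_sq_half_add (c : ℝ) : ‖(1 / 2 + c * I : ℂ)‖ ^ 2 = 1 / 4 + c ^ 2 := by
  rw [← Complex.normSq_eq_norm_sq, Complex.normSq_apply]
  simp
  ring

/-- On the line $z=1/2+(i/2)\tan u$ one has $|z|=|1-z|=1/(2\cos u)$, so the derivative in `u`
simplifies to $2\log(2\cos u)$. Integration starts at the real point $1/2$, where the function
vanishes. -/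
lemma blochWigner_vertical :
    blochWigner (1 / 2 + (Real.sqrt 3 / 2 : ℝ) * I) =
      2 * ∫ u in (0 : ℝ)..(Real.pi / 3), Real.log (2 * Real.cos u) := by
  have hder : ∀ u ∈ Set.uIcc 0 (Real.pi / 3),
      HasDerivAt (fun u : ℝ => blochWigner (1 / 2 + (Real.tan u / 2 : ℝ) * I))
        (2 * Real.log (2 * Real.cos u)) u := by
    intro u hu
    rw [Set.uIcc_of_le (by positivity)] at hu
    have hc : 0 < Real.cos u := Real.cos_pos_of_mem_Ioo
      ⟨by linarith [hu.1, Real.pi_pos], by linarith [hu.2, Real.pi_pos]⟩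
    set z : ℂ := 1 / 2 + (Real.tan u / 2 : ℝ) * I with hz
    have hre : z.re = 1 / 2 := by simp [hz]
    have hz1 : 1 - z = 1 / 2 + (-(Real.tan u / 2) : ℝ) * I := by
      rw [hz]; push_cast; ring
    have hre1 : (1 - z).re = 1 / 2 := by rw [sub_re, hre]; norm_num
    have hz0 : z ≠ 0 := fun h => by rw [h] at hre; norm_num at hre
    have hz1' : z ≠ 1 := fun h => by rw [h] at hre; norm_num at hre
    have hn : ‖z‖ ^ 2 = ((2 * Real.cos u)⁻¹) ^ 2 := by
      rw [hz, norm_sq_half_add, Real.tan_eq_sin_div_cos]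
      field_simp
      linarith [Real.sin_sq_add_cos_sq u]
    have hn1 : ‖1 - z‖ ^ 2 = ((2 * Real.cos u)⁻¹) ^ 2 := by
      rw [← hn, hz1, hz, norm_sq_half_add, norm_sq_half_add, neg_sq]
    have hnn : ‖z‖ = (2 * Real.cos u)⁻¹ :=
      (pow_left_inj₀ (norm_nonneg _) (by positivity) two_ne_zero).mp hn
    have hnn1 : ‖1 - z‖ = (2 * Real.cos u)⁻¹ :=
      (pow_left_inj₀ (norm_nonneg _) (by positivity) two_ne_zero).mp hn1
    have hpath : HasDerivAt (fun u : ℝ => (1 / 2 + (Real.tan u / 2 : ℝ) * I : ℂ))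
        (((1 / Real.cos u ^ 2 / 2 : ℝ) : ℂ) * I) u :=
      ((((Real.hasDerivAt_tan hc.ne').div_const 2).ofReal_comp).mul_const I).const_add _
    have h := (hasFDerivAt_blochWigner hz0 hz1').comp_hasDerivAt u hpath
    refine h.congr_deriv ?_
    have e : ∀ (w : ℂ) (s : ℝ), (1 / w * (s * I)).im = s * w.re / ‖w‖ ^ 2 := by
      intro w s
      rw [one_div, ← mul_assoc, mul_I_im, mul_re, inv_re, ofReal_re, ofReal_im, mul_zero, sub_zero,
        Complex.normSq_eq_norm_sq]
      ring
    simp only [blochForm, _root_.sub_apply, _root_.smul_apply, imMul_apply, smul_eq_mul, neg_mul,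
      neg_im, e, hre, hre1, hn, hn1]
    rw [hnn, hnn1, Real.log_inv]
    field_simp
    ring
  have hint := intervalIntegral.integral_eq_sub_of_hasDerivAt hder
    (continuousOn_logTwoCos.const_smul (2 : ℝ)).intervalIntegrable
  rw [intervalIntegral.integral_const_mul] at hint
  rw [hint, Real.tan_pi_div_three, Real.tan_zero, zero_div, ofReal_zero, zero_mul, add_zero,
    blochWigner_of_im_eq_zero (z := 1 / 2) (by simp), sub_zero]

/-- A critical point of the Bloch–Wigner function off the real line is `(1 ± √3 i)/2`. -/
lemma norm_eq_one_of_blochForm_eq_zero {z : ℂ} (hz : z.im ≠ 0) (h : blochForm z = 0) :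
    ‖z‖ = 1 ∧ ‖1 - z‖ = 1 := by
  have hz0 : z ≠ 0 := by rintro rfl; simp at hz
  have hz1 : 1 - z ≠ 0 := fun h => hz (by simpa using congrArg Complex.im h)
  set a := Real.log ‖z‖ with ha
  set b := Real.log ‖1 - z‖ with hb
  have hc : (a : ℂ) * (1 / (1 - z)) + b * (1 / z) = 0 := by
    -- A form $h\mapsto\mathrm{Im}(ch)$ vanishes only if $c=0$, as the values at $h=1$ and $h=i$
    -- show.
    have key : ∀ w : ℂ, (((a : ℂ) * (1 / (1 - z)) + b * (1 / z)) * w).im = 0 := by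
      intro w
      have := DFunLike.congr_fun h w
      simp only [blochForm, _root_.sub_apply, _root_.smul_apply, imMul_apply, smul_eq_mul, neg_mul,
        neg_im, zero_apply] at this
      rw [add_mul, add_im, mul_assoc, mul_assoc, im_ofReal_mul, im_ofReal_mul]
      linarith
    refine Complex.ext ?_ ?_
    · simpa using key I
    · simpa using key 1
  have hc' : (a : ℂ) * z + b * (1 - z) = 0 := by
    field_simp at hc
    linear_combination hc
  have him := congrArg Complex.im hc'
  have hre := congrArg Complex.re hc'
  simp at him hre
  have hab : a = b := by
    have : (a - b) * z.im = 0 := by linarith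
    have := (mul_eq_zero.mp this).resolve_right hz
    linarith
  rw [hab] at hre
  have hb0 : b = 0 := by linarith
  have ha0 : a = 0 := by rw [hab, hb0]
  have aux : ∀ w : ℂ, w ≠ 0 → Real.log ‖w‖ = 0 → ‖w‖ = 1 := fun w hw hl =>
    Real.eq_one_of_pos_of_log_eq_zero (norm_pos_iff.mpr hw) hl
  exact ⟨aux z hz0 ha0, aux _ hz1 hb0⟩

/-- A value above that at $\zeta=(1+i\sqrt3)/2$ would be positive. Since the function tends to 0 at
infinity and vanishes on $\mathbb R$, a positive maximum would then occur off the real line, at a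
critical point, hence at $\zeta$ or $\bar\zeta$; neither is possible. Conjugation gives the lower
bound. -/
theorem abs_blochWigner_le (z : ℂ) :
    |blochWigner z| ≤ -3 * ∫ u in (0 : ℝ)..(Real.pi / 3), logTwoSin u := by
  rw [← two_mul_integral_logTwoCos, ← blochWigner_vertical]
  set ζ : ℂ := 1 / 2 + (Real.sqrt 3 / 2 : ℝ) * I with hζ
  have hpos : 0 ≤ blochWigner ζ := by
    rw [hζ, blochWigner_vertical]
    refine mul_nonneg zero_le_two (intervalIntegral.integral_nonneg (by positivity) fun u hu => ?_)
    refine Real.log_nonneg ?_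
    have : Real.cos (Real.pi / 3) ≤ Real.cos u :=
      Real.cos_le_cos_of_nonneg_of_le_pi hu.1 (by linarith [Real.pi_pos]) hu.2
    rw [Real.cos_pi_div_three] at this
    linarith
  have main : ∀ z, blochWigner z ≤ blochWigner ζ := by
    by_contra! hcon
    obtain ⟨w, hw⟩ := hcon
    have hwpos : 0 < blochWigner w := hpos.trans_lt hw
    obtain ⟨m, hm⟩ := continuous_blochWigner.exists_forall_ge' w
      ((tendsto_blochWigner_cocompact.eventually_lt_const hwpos).mono fun _ h => h.le)
    have hmpos : 0 < blochWigner m := hwpos.trans_le (hm w)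
    have him : m.im ≠ 0 := fun h => hmpos.ne' (blochWigner_of_im_eq_zero h)
    have hm0 : m ≠ 0 := by rintro rfl; simp at him
    have hm1 : m ≠ 1 := by rintro rfl; simp at him
    have hform : blochForm m = 0 :=
      (IsLocalMax.hasFDerivAt_eq_zero (Eventually.of_forall hm) (hasFDerivAt_blochWigner hm0 hm1))
    obtain ⟨h1, h2⟩ := norm_eq_one_of_blochForm_eq_zero him hform
    have e1 : m.re * m.re + m.im * m.im = 1 := by
      rw [← Complex.normSq_apply, Complex.normSq_eq_norm_sq, h1, one_pow]
    have e2 : (1 - m.re) * (1 - m.re) + m.im * m.im = 1 := by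
      have : (1 - m).re * (1 - m).re + (1 - m).im * (1 - m).im = 1 := by
        rw [← Complex.normSq_apply, Complex.normSq_eq_norm_sq, h2, one_pow]
      simpa using this
    have hre : m.re = 1 / 2 := by linarith
    have hsq : m.im ^ 2 = (Real.sqrt 3 / 2) ^ 2 := by
      rw [div_pow, Real.sq_sqrt (by norm_num)]
      rw [hre] at e1
      linarith
    rcases sq_eq_sq_iff_eq_or_eq_neg.mp hsq with h | h
    · have : m = ζ := Complex.ext (by simp [hζ, hre]) (by simp [hζ, h])
      exact absurd (hm w) (not_le.mpr (this ▸ hw))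
    · have : m = starRingEnd ℂ ζ :=
        Complex.ext (by rw [conj_re]; simp [hζ, hre]) (by rw [conj_im]; simp [hζ, h])
      rw [this, blochWigner_starRingEnd] at hmpos
      linarith
  rw [abs_le]
  refine ⟨?_, main z⟩
  have := main (starRingEnd ℂ z)
  rw [blochWigner_starRingEnd] at this
  linarith

end Maximum

/-! ### The volume of the regular ideal tetrahedron -/

section IdealTetrahedron

/-- The equilateral triangle spanned by the cube roots of unity. -/
def idealTriangle : Set ℂ := {z | -(1 / 2) ≤ z.re ∧ Real.sqrt 3 * |z.im| ≤ 1 - z.re}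

lemma sqrt_three_mul_self : Real.sqrt 3 * Real.sqrt 3 = 3 := Real.mul_self_sqrt (by norm_num)

lemma convexHull_cube_roots : convexHull ℝ {z : ℂ | z ^ 3 = 1} = idealTriangle := by
  have h3 := sqrt_three_mul_self
  have h30 : 0 < Real.sqrt 3 := Real.sqrt_pos.mpr (by norm_num)
  apply Set.Subset.antisymm
  · refine convexHull_min ?_ ?_
    · intro z hz
      have hz' : (z - 1) * (z ^ 2 + z + 1) = 0 := by
        have : z ^ 3 = 1 := hz
        linear_combination this
      rcases mul_eq_zero.mp hz' with h | h
      · rw [sub_eq_zero.mp h]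
        constructor <;> norm_num
      · have him := congrArg Complex.im h
        have hre := congrArg Complex.re h
        simp [pow_two] at him hre
        have hx : z.re = -(1 / 2) := by
          have : z.im * (2 * z.re + 1) = 0 := by linarith
          rcases mul_eq_zero.mp this with h0 | h0
          · rw [h0] at hre
            nlinarith [sq_nonneg (z.re + 1 / 2)]
          · linarith
        refine ⟨hx.ge, abs_le_of_sq_le_sq' ?_ ?_ |>.2⟩
        · rw [hx] at hre ⊢
          rw [mul_pow, sq_abs, pow_two, h3]
          nlinarith
        · rw [hx]; norm_num
    · have e : idealTriangle = {z : ℂ | -(1 / 2) ≤ z.re} ∩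
          ({z : ℂ | z.re + Real.sqrt 3 * z.im ≤ 1} ∩ {z : ℂ | z.re - Real.sqrt 3 * z.im ≤ 1}) := by
        ext z
        constructor
        · rintro ⟨h1, h2⟩
          refine ⟨h1, ?_, ?_⟩
          · have := mul_le_mul_of_nonneg_left (le_abs_self z.im) h30.le
            change z.re + Real.sqrt 3 * z.im ≤ 1
            linarith
          · have := mul_le_mul_of_nonneg_left (neg_abs_le z.im) h30.le
            change z.re - Real.sqrt 3 * z.im ≤ 1
            linarith
        · rintro ⟨h1, h2, h4⟩
          change z.re + Real.sqrt 3 * z.im ≤ 1 at h2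
          change z.re - Real.sqrt 3 * z.im ≤ 1 at h4
          refine ⟨h1, ?_⟩
          rcases abs_cases z.im with ⟨h, -⟩ | ⟨h, -⟩ <;> rw [h] <;> linarith
      rw [e]
      have l1 : IsLinearMap ℝ fun z : ℂ => z.re + Real.sqrt 3 * z.im :=
        ⟨fun x y => by simp; ring, fun c x => by simp; ring⟩
      have l2 : IsLinearMap ℝ fun z : ℂ => z.re - Real.sqrt 3 * z.im :=
        ⟨fun x y => by simp; ring, fun c x => by simp; ring⟩
      exact (convex_halfSpace_re_ge _).inter ((convex_halfSpace_le l1 1).inter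
        (convex_halfSpace_le l2 1))
  · rintro z ⟨h1, h2⟩
    have hω : ∀ s : ℝ, s * s = 3 → (⟨-(1 / 2), s / 2⟩ : ℂ) ^ 3 = 1 := by
      intro s hs
      apply Complex.ext
      · simp [pow_succ]; nlinarith
      · simp [pow_succ]; linear_combination -(s / 8) * hs
    have hconv := convex_convexHull ℝ {z : ℂ | z ^ 3 = 1}
    have m : ∀ w : ℂ, w ^ 3 = 1 → w ∈ convexHull ℝ {z : ℂ | z ^ 3 = 1} := fun w hw =>
      subset_convexHull ℝ _ hw
    have hle := le_abs_self z.im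
    have hge := neg_abs_le z.im
    -- The weights are the barycentric coordinates of `z` with respect to the three roots of unity.
    have key := hconv.sum_mem (t := Finset.univ)
      (w := ![(2 * z.re + 1) / 3, (1 - z.re + Real.sqrt 3 * z.im) / 3,
        (1 - z.re - Real.sqrt 3 * z.im) / 3])
      (z := ![1, ⟨-(1 / 2), Real.sqrt 3 / 2⟩, ⟨-(1 / 2), -Real.sqrt 3 / 2⟩])
      (fun i _ => by
        fin_cases i
        · simp; linarith
        · simp; nlinarith
        · simp; nlinarith)
      (by simp [Fin.sum_univ_three]; ring)
      (fun i _ => by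
        fin_cases i
        · exact m _ (one_pow 3)
        · exact m _ (hω _ h3)
        · exact m _ (hω _ (by rw [neg_mul_neg, h3])))
    convert! key using 1
    apply Complex.ext
    · simp [Fin.sum_univ_three]; ring
    · simp [Fin.sum_univ_three]; nlinarith

lemma lintegral_Ici_cube {s : ℝ} (hs : 0 < s) :
    ∫⁻ t in Set.Ici s, ENNReal.ofReal (1 / t ^ 3) = ENNReal.ofReal (1 / (2 * s ^ 2)) := by
  rw [setLIntegral_congr Ioi_ae_eq_Ici.symm]
  have e : ∀ t ∈ Set.Ioi s, (1 / t ^ 3 : ℝ) = t ^ (-3 : ℝ) := fun t ht => by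
    rw [Real.rpow_neg (hs.trans ht).le, one_div]
    norm_cast
  rw [setLIntegral_congr_fun measurableSet_Ioi fun t ht => by rw [e t ht]]
  rw [← ofReal_integral_eq_lintegral_ofReal (integrableOn_Ioi_rpow_of_lt (by norm_num) hs)
    ((ae_restrict_iff' measurableSet_Ioi).mpr (Eventually.of_forall fun t ht =>
      Real.rpow_nonneg (hs.trans ht).le _)), integral_Ioi_rpow_of_lt (by norm_num) hs]
  congr 1
  rw [show (-3 : ℝ) + 1 = -2 by norm_num, Real.rpow_neg hs.le, Real.rpow_two]
  field_simp

lemma lintegral_fibre {s y₀ : ℝ} (hy : 0 < y₀) (hys : y₀ < s) :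
    ∫⁻ y in Set.Icc (-y₀) y₀, ENNReal.ofReal (1 / (2 * (s ^ 2 - y ^ 2))) =
      ENNReal.ofReal ((Real.log (s + y₀) - Real.log (s - y₀)) / (2 * s)) := by
  have hs : 0 < s := hy.trans hys
  have hpos : ∀ y ∈ Set.Icc (-y₀) y₀, 0 < s + y ∧ 0 < s - y := fun y h =>
    ⟨by linarith [h.1], by linarith [h.2]⟩
  have hsq : ∀ y ∈ Set.Icc (-y₀) y₀, 0 < s ^ 2 - y ^ 2 := fun y h => by
    have := mul_pos (hpos y h).1 (hpos y h).2
    linarith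
  have hcont : ContinuousOn (fun y => 1 / (2 * (s ^ 2 - y ^ 2))) (Set.Icc (-y₀) y₀) :=
    ContinuousOn.div continuousOn_const (by fun_prop) fun y h =>
      (mul_pos two_pos (hsq y h)).ne'
  rw [← ofReal_integral_eq_lintegral_ofReal hcont.integrableOn_Icc
    ((ae_restrict_iff' measurableSet_Icc).mpr (Eventually.of_forall fun y h =>
      (one_div_pos.mpr (mul_pos two_pos (hsq y h))).le)), integral_Icc_eq_integral_Ioc,
    ← intervalIntegral.integral_of_le (by linarith)]
  have hle : -y₀ ≤ y₀ := by linarith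
  have hder : ∀ y ∈ Set.uIcc (-y₀) y₀,
      HasDerivAt (fun y => (Real.log (s + y) - Real.log (s - y)) / (4 * s))
        (1 / (2 * (s ^ 2 - y ^ 2))) y := by
    intro y h
    rw [Set.uIcc_of_le hle] at h
    have hp := hpos y h
    have h1 := ((hasDerivAt_id y).const_add s).log hp.1.ne'
    have h2 := ((hasDerivAt_id y).const_sub s).log hp.2.ne'
    refine ((h1.sub h2).div_const (4 * s)).congr_deriv ?_
    have e1 := hp.1.ne'
    have e2 := hp.2.ne'
    have e3 : s ^ 2 - y ^ 2 = (s + y) * (s - y) := by ring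
    rw [e3]
    simp only [id]
    field_simp
    ring
  rw [← Set.uIcc_of_le hle] at hcont
  rw [intervalIntegral.integral_eq_sub_of_hasDerivAt hder hcont.intervalIntegrable]
  congr 1
  rw [sub_neg_eq_add, ← sub_eq_add_neg]
  field_simp
  ring

/-- The volume above the vertical line over `x`. -/
lemma lintegral_slice {φ : ℝ} (hφ : φ ∈ Set.Ioo 0 (2 * Real.pi / 3)) :
    ∫⁻ y : ℝ, ∫⁻ t : ℝ, regularIdealTetrahedron.indicator
        (fun p => ENNReal.ofReal (1 / p.2 ^ 3)) ((⟨Real.cos φ, y⟩ : ℂ), t) =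
      ENNReal.ofReal ((logTwoSin (Real.pi / 3 + φ / 2) - logTwoSin (Real.pi / 3 - φ / 2)) /
        (2 * Real.sin φ)) := by
  obtain ⟨u, rfl⟩ : ∃ u, φ = 2 * u := ⟨φ / 2, by ring⟩
  have hu0 : 0 < u := by linarith [hφ.1]
  have hu1 : u < Real.pi / 3 := by linarith [hφ.2]
  have h3 := sqrt_three_mul_self
  have h30 : 0 < Real.sqrt 3 := Real.sqrt_pos.mpr (by norm_num)
  have hsu : 0 < Real.sin u := Real.sin_pos_of_mem_Ioo ⟨hu0, by linarith [Real.pi_pos]⟩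
  have hadd : 2 * Real.sin (Real.pi / 3 + u) = Real.sqrt 3 * Real.cos u + Real.sin u := by
    rw [Real.sin_add, Real.sin_pi_div_three, Real.cos_pi_div_three]; ring
  have hsub : 2 * Real.sin (Real.pi / 3 - u) = Real.sqrt 3 * Real.cos u - Real.sin u := by
    rw [Real.sin_sub, Real.sin_pi_div_three, Real.cos_pi_div_three]; ring
  have hpadd : 0 < Real.sin (Real.pi / 3 + u) :=
    Real.sin_pos_of_mem_Ioo ⟨by positivity, by linarith [Real.pi_pos]⟩
  have hpsub : 0 < Real.sin (Real.pi / 3 - u) :=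
    Real.sin_pos_of_mem_Ioo ⟨by linarith, by linarith [Real.pi_pos]⟩
  set s := Real.sin (2 * u) with hs
  set x := Real.cos (2 * u) with hx
  -- Over the abscissa `x`, `s` is the half-chord of the unit circle and `y₀` the half-width of the
  -- triangle.
  set y₀ := (1 - x) / Real.sqrt 3 with hy₀
  have hxs : s ^ 2 = 1 - x ^ 2 := by
    have := Real.sin_sq_add_cos_sq (2 * u)
    linarith
  have hx1 : 1 - x = 2 * Real.sin u ^ 2 := by
    rw [hx, Real.cos_two_mul]
    linarith [Real.sin_sq_add_cos_sq u]
  -- The factor shared by `s + y₀` and `s - y₀` drops out of the difference of logarithms, leaving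
  -- `logTwoSin` at the angles $\pi/3\pm u$.
  have hsadd : s + y₀ = 2 * Real.sin u / Real.sqrt 3 * (2 * Real.sin (Real.pi / 3 + u)) := by
    rw [hadd, hy₀, hx1, hs, Real.sin_two_mul]
    field_simp
  have hssub : s - y₀ = 2 * Real.sin u / Real.sqrt 3 * (2 * Real.sin (Real.pi / 3 - u)) := by
    rw [hsub, hy₀, hx1, hs, Real.sin_two_mul]
    field_simp
  have hc : 0 < 2 * Real.sin u / Real.sqrt 3 := by positivity
  have hy0 : 0 < y₀ := by rw [hy₀, hx1]; positivity
  have hys : y₀ < s := by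
    have : 0 < s - y₀ := by rw [hssub]; positivity
    linarith
  have hxhalf : -(1 / 2) ≤ x := by
    have := Real.cos_le_cos_of_nonneg_of_le_pi (x := 2 * u) (y := 2 * (Real.pi / 3)) (by linarith)
      (by linarith [Real.pi_pos]) (by linarith)
    rw [Real.cos_two_mul, Real.cos_pi_div_three] at this
    linarith
  have hinner : ∀ y : ℝ, ∫⁻ t : ℝ, regularIdealTetrahedron.indicator
        (fun p => ENNReal.ofReal (1 / p.2 ^ 3)) ((⟨x, y⟩ : ℂ), t) =
      (Set.Icc (-y₀) y₀).indicator (fun y => ENNReal.ofReal (1 / (2 * (s ^ 2 - y ^ 2)))) y := by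
    intro y
    have htri : (⟨x, y⟩ : ℂ) ∈ idealTriangle ↔ y ∈ Set.Icc (-y₀) y₀ := by
      rw [Set.mem_Icc, ← abs_le, hy₀, le_div_iff₀ h30, mul_comm]
      exact ⟨fun h => h.2, fun h => ⟨hxhalf, h⟩⟩
    by_cases hy : y ∈ Set.Icc (-y₀) y₀
    · have hpos : 0 < s ^ 2 - y ^ 2 := by
        have h1 : 0 < s + y := by linarith [hy.1]
        have h2 : 0 < s - y := by linarith [hy.2]
        nlinarith [mul_pos h1 h2]
      rw [Set.indicator_of_mem hy, ← Real.sq_sqrt hpos.le, ← lintegral_Ici_cube (Real.sqrt_pos.mpr hpos),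
        ← lintegral_indicator measurableSet_Ici]
      refine lintegral_congr fun t => ?_
      have hmem : ((⟨x, y⟩ : ℂ), t) ∈ regularIdealTetrahedron ↔ t ∈ Set.Ici (Real.sqrt (s ^ 2 - y ^ 2)) := by
        have hn : ‖(⟨x, y⟩ : ℂ)‖ ^ 2 = x ^ 2 + y ^ 2 := by
          rw [← Complex.normSq_eq_norm_sq, Complex.normSq_mk]; ring
        constructor
        · rintro ⟨-, h1, h2⟩
          simp only [hn] at h1 h2
          exact Real.sqrt_le_iff.mpr ⟨h1.le, by linarith⟩
        · intro h
          have ht : 0 < t := (Real.sqrt_pos.mpr hpos).trans_le h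
          refine ⟨by rw [convexHull_cube_roots]; exact htri.mpr hy, ht, ?_⟩
          simp only [hn]
          have := (Real.sqrt_le_iff.mp h).2
          linarith
      by_cases ht : t ∈ Set.Ici (Real.sqrt (s ^ 2 - y ^ 2))
      · rw [Set.indicator_of_mem ht, Set.indicator_of_mem (hmem.mpr ht)]
      · rw [Set.indicator_of_notMem ht, Set.indicator_of_notMem fun h => ht (hmem.mp h)]
    · rw [Set.indicator_of_notMem hy]
      refine (lintegral_congr fun t => Set.indicator_of_notMem (fun h => hy (htri.mp ?_)) _).trans
        lintegral_zero
      rw [← convexHull_cube_roots]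
      exact h.1
  rw [lintegral_congr hinner, lintegral_indicator measurableSet_Icc, lintegral_fibre hy0 hys,
    hsadd, hssub, Real.log_mul hc.ne' (by positivity), Real.log_mul hc.ne' (by positivity),
    mul_div_cancel_left₀ u two_ne_zero, logTwoSin, logTwoSin]
  congr 2
  ring

lemma measurableSet_regularIdealTetrahedron : MeasurableSet regularIdealTetrahedron := by
  have e : regularIdealTetrahedron = {p : ℂ × ℝ | -(1 / 2) ≤ p.1.re} ∩
      ({p : ℂ × ℝ | Real.sqrt 3 * |p.1.im| ≤ 1 - p.1.re} ∩
        ({p : ℂ × ℝ | 0 < p.2} ∩ {p : ℂ × ℝ | 1 ≤ ‖p.1‖ ^ 2 + p.2 ^ 2})) := by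
    ext p
    rw [regularIdealTetrahedron, convexHull_cube_roots]
    exact ⟨fun ⟨⟨h1, h2⟩, h3, h4⟩ => ⟨h1, h2, h3, h4⟩, fun ⟨h1, h2, h3, h4⟩ => ⟨⟨h1, h2⟩, h3, h4⟩⟩
  rw [e]
  have c : Continuous fun p : ℂ × ℝ => p.1.re := Complex.continuous_re.comp continuous_fst
  have d : Continuous fun p : ℂ × ℝ => p.1.im := Complex.continuous_im.comp continuous_fst
  refine (isClosed_le continuous_const c).measurableSet.inter
    ((isClosed_le (continuous_const.mul d.abs) (continuous_const.sub c)).measurableSet.inter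
      ((isOpen_lt continuous_const continuous_snd).measurableSet.inter
        (isClosed_le continuous_const ?_).measurableSet))
  fun_prop

/-- The volume as an iterated integral. -/
lemma hyperbolicVolume_eq_iterated : hyperbolicVolume regularIdealTetrahedron =
    ∫⁻ x : ℝ, ∫⁻ y : ℝ, ∫⁻ t : ℝ, regularIdealTetrahedron.indicator
        (fun p => ENNReal.ofReal (1 / p.2 ^ 3)) ((⟨x, y⟩ : ℂ), t) := by
  have hm : Measurable (regularIdealTetrahedron.indicator
      fun p : ℂ × ℝ => ENNReal.ofReal (1 / p.2 ^ 3)) :=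
    Measurable.indicator (by fun_prop) measurableSet_regularIdealTetrahedron
  rw [hyperbolicVolume, ← lintegral_indicator measurableSet_regularIdealTetrahedron,
    Measure.volume_eq_prod, lintegral_prod _ hm.aemeasurable]
  have hH : Measurable fun z : ℂ => ∫⁻ t : ℝ, regularIdealTetrahedron.indicator
      (fun p : ℂ × ℝ => ENNReal.ofReal (1 / p.2 ^ 3)) (z, t) := hm.lintegral_prod_right'
  have hH' : Measurable fun q : ℝ × ℝ => ∫⁻ t : ℝ, regularIdealTetrahedron.indicator
      (fun p : ℂ × ℝ => ENNReal.ofReal (1 / p.2 ^ 3))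
      (Complex.measurableEquivRealProd.symm q, t) :=
    hH.comp Complex.measurableEquivRealProd.symm.measurable
  rw [← (Complex.volume_preserving_equiv_real_prod.symm).lintegral_comp hH,
    Measure.volume_eq_prod, lintegral_prod _ hH'.aemeasurable]
  rfl

lemma cos_image_Ioo : Real.cos '' Set.Ioo 0 (2 * Real.pi / 3) = Set.Ioo (-(1 / 2)) 1 := by
  have hcos : Real.cos (2 * Real.pi / 3) = -(1 / 2) := by
    rw [show 2 * Real.pi / 3 = Real.pi - Real.pi / 3 by ring, Real.cos_pi_sub,
      Real.cos_pi_div_three]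
  ext x
  constructor
  · rintro ⟨φ, hφ, rfl⟩
    constructor
    · rw [← hcos]
      exact Real.cos_lt_cos_of_nonneg_of_le_pi hφ.1.le (by linarith [Real.pi_pos]) hφ.2
    · rw [← Real.cos_zero]
      exact Real.cos_lt_cos_of_nonneg_of_le_pi le_rfl (by linarith [hφ.2, Real.pi_pos]) hφ.1
  · rintro ⟨h1, h2⟩
    refine ⟨Real.arccos x, ⟨Real.arccos_pos.mpr h2, ?_⟩, Real.cos_arccos (by linarith) h2.le⟩
    by_contra! h
    have := Real.cos_le_cos_of_nonneg_of_le_pi (by positivity) (Real.arccos_le_pi x) h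
    rw [Real.cos_arccos (by linarith) h2.le, hcos] at this
    linarith

/-- The substitution $x=\cos\varphi$ has Jacobian $\sin\varphi$, which cancels the denominator of
the slice volume. The two remaining log-sine integrals, over the middle and the first third of
$[0,\pi]$, combine to the stated multiple. -/
theorem nu₃_eq : nu₃ = -3 * ∫ u in (0 : ℝ)..(Real.pi / 3), logTwoSin u := by
  set k : ℝ → ℝ := fun φ =>
    1 / 2 * (logTwoSin (Real.pi / 3 + φ / 2) - logTwoSin (Real.pi / 3 - φ / 2)) with hk
  have hpi := Real.pi_pos
  have hle : (0 : ℝ) ≤ 2 * Real.pi / 3 := by positivity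
  have hnonneg : ∀ φ ∈ Set.Ioo 0 (2 * Real.pi / 3), 0 ≤ k φ := by
    intro φ hφ
    have h1 : 0 < Real.sin (Real.pi / 3 - φ / 2) :=
      Real.sin_pos_of_mem_Ioo ⟨by linarith [hφ.2], by linarith [hφ.1]⟩
    have h2 : 0 < Real.sin (φ / 2) :=
      Real.sin_pos_of_mem_Ioo ⟨by linarith [hφ.1], by linarith [hφ.2]⟩
    have h3 : Real.sin (Real.pi / 3 - φ / 2) ≤ Real.sin (Real.pi / 3 + φ / 2) := by
      rw [Real.sin_add, Real.sin_sub, Real.cos_pi_div_three]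
      linarith
    refine mul_nonneg (by norm_num) (sub_nonneg.mpr (Real.log_le_log (by positivity) ?_))
    linarith
  have i1 : IntervalIntegrable (fun φ => logTwoSin (Real.pi / 3 + φ / 2)) volume 0 (2 * Real.pi / 3) := by
    refine MeromorphicOn.intervalIntegrable_log
      (f := fun φ => 2 * Real.sin (Real.pi / 3 + φ / 2)) fun t _ => ?_
    refine AnalyticAt.meromorphicAt ?_
    fun_prop
  have i2 : IntervalIntegrable (fun φ => logTwoSin (Real.pi / 3 - φ / 2)) volume 0 (2 * Real.pi / 3) := by
    refine MeromorphicOn.intervalIntegrable_log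
      (f := fun φ => 2 * Real.sin (Real.pi / 3 - φ / 2)) fun t _ => ?_
    refine AnalyticAt.meromorphicAt ?_
    fun_prop
  have hint : IntervalIntegrable k volume 0 (2 * Real.pi / 3) := (i1.sub i2).const_mul _
  have hvol : hyperbolicVolume regularIdealTetrahedron =
      ENNReal.ofReal (∫ φ in (0 : ℝ)..(2 * Real.pi / 3), k φ) := by
    rw [hyperbolicVolume_eq_iterated]
    set g : ℝ → ENNReal := fun x => ∫⁻ y : ℝ, ∫⁻ t : ℝ, regularIdealTetrahedron.indicator
        (fun p => ENNReal.ofReal (1 / p.2 ^ 3)) ((⟨x, y⟩ : ℂ), t) with hg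
    have hzero : ∀ x ∉ Set.Icc (-(1 / 2) : ℝ) 1, g x = 0 := by
      intro x hx
      have : ∀ y t : ℝ, regularIdealTetrahedron.indicator
          (fun p => ENNReal.ofReal (1 / p.2 ^ 3)) ((⟨x, y⟩ : ℂ), t) = 0 := fun y t =>
        Set.indicator_of_notMem (fun h => hx (by
          have h1 := h.1
          rw [convexHull_cube_roots] at h1
          have h2 := h1.2
          have h3 : 0 ≤ Real.sqrt 3 * |y| := by positivity
          exact ⟨h1.1, by linarith [h3.trans h2]⟩)) _
      simp only [hg, this, lintegral_zero]
    have h1 : ∫⁻ x, g x = ∫⁻ x in Real.cos '' Set.Ioo 0 (2 * Real.pi / 3), g x := by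
      rw [cos_image_Ioo, setLIntegral_congr Ioo_ae_eq_Icc, ← lintegral_indicator measurableSet_Icc]
      refine lintegral_congr fun x => ?_
      by_cases hx : x ∈ Set.Icc (-(1 / 2) : ℝ) 1
      · rw [Set.indicator_of_mem hx]
      · rw [Set.indicator_of_notMem hx, hzero x hx]
    rw [h1, lintegral_image_eq_lintegral_abs_deriv_mul measurableSet_Ioo
      (fun φ _ => (Real.hasDerivAt_cos φ).hasDerivWithinAt)
      (Real.injOn_cos.mono fun φ (hφ : φ ∈ Set.Ioo 0 (2 * Real.pi / 3)) =>
        (⟨hφ.1.le, by linarith [hφ.2]⟩ : φ ∈ Set.Icc 0 Real.pi))]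
    rw [intervalIntegral.integral_of_le hle, integral_Ioc_eq_integral_Ioo,
      ofReal_integral_eq_lintegral_ofReal
        ((intervalIntegrable_iff_integrableOn_Ioo_of_le hle).mp hint)
        ((ae_restrict_iff' measurableSet_Ioo).mpr (Eventually.of_forall hnonneg))]
    refine setLIntegral_congr_fun measurableSet_Ioo fun φ hφ => ?_
    have hs : 0 < Real.sin φ := Real.sin_pos_of_mem_Ioo ⟨hφ.1, by linarith [hφ.2]⟩
    simp only [hg]
    rw [lintegral_slice hφ, abs_neg, abs_of_pos hs, ← ENNReal.ofReal_mul hs.le]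
    congr 1
    rw [hk]
    field_simp
  rw [nu₃, hvol, ENNReal.toReal_ofReal]
  · rw [intervalIntegral.integral_const_mul, intervalIntegral.integral_sub i1 i2,
      intervalIntegral.integral_comp_add_div _ two_ne_zero,
      intervalIntegral.integral_comp_sub_div _ two_ne_zero, zero_div, add_zero, sub_zero,
      show Real.pi / 3 + 2 * Real.pi / 3 / 2 = 2 * Real.pi / 3 by ring,
      show Real.pi / 3 - 2 * Real.pi / 3 / 2 = 0 by ring, integral_logTwoSin_middle, smul_eq_mul,
      smul_eq_mul]
    ring
  · rw [intervalIntegral.integral_of_le hle, integral_Ioc_eq_integral_Ioo]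
    exact setIntegral_nonneg measurableSet_Ioo hnonneg

theorem abs_blochWigner_le_nu₃ (z : ℂ) : |blochWigner z| ≤ nu₃ :=
  (abs_blochWigner_le z).trans_eq nu₃_eq.symm

end IdealTetrahedron

/-! ### The Bloch–Wigner function on the asymptotic cone -/

section ConeFunction

variable (S : ScalingData)

/-- The sequence `a` agrees `ω`-almost everywhere with a bounded sequence in the class `x`. -/
def ScalingData.Represents (a : ℕ → ℂ) (x : S.Cone) : Prop :=
  ∃ b : S.boundedSeq, S.toCone b = x ∧ ∀ᶠ k in (S.ω : Filter ℕ), (b : ℕ → ℂ) k = a k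

variable {S}

lemma ScalingData.represents_representative (x : S.Cone) : S.Represents (S.representative x) x :=
  ⟨Function.surjInv S.toCone_surjective x, Function.surjInv_eq S.toCone_surjective x,
    Eventually.of_forall fun _ => rfl⟩

namespace ScalingData.Represents

variable {a b : ℕ → ℂ} {x y : S.Cone}

lemma zero : S.Represents (fun _ => 0) 0 := ⟨0, map_zero _, Eventually.of_forall fun _ => rfl⟩

lemma one : S.Represents (fun _ => 1) 1 := ⟨1, map_one _, Eventually.of_forall fun _ => rfl⟩

lemma sub (ha : S.Represents a x) (hb : S.Represents b y) :
    S.Represents (fun k => a k - b k) (x - y) := by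
  obtain ⟨a', rfl, ha⟩ := ha
  obtain ⟨b', rfl, hb⟩ := hb
  refine ⟨a' - b', map_sub _ _ _, ?_⟩
  filter_upwards [ha, hb] with k h₁ h₂
  rw [← h₁, ← h₂]
  rfl

lemma mul (ha : S.Represents a x) (hb : S.Represents b y) :
    S.Represents (fun k => a k * b k) (x * y) := by
  obtain ⟨a', rfl, ha⟩ := ha
  obtain ⟨b', rfl, hb⟩ := hb
  refine ⟨a' * b', map_mul _ _ _, ?_⟩
  filter_upwards [ha, hb] with k h₁ h₂
  rw [← h₁, ← h₂]
  rfl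

/-- A nonzero class stays away from zero in the rescaled absolute value. -/
lemma exists_le_size (ha : S.Represents a x) (hx : x ≠ 0) :
    ∃ ε > 0, ∀ᶠ k in (S.ω : Filter ℕ), ε ≤ S.size a k := by
  obtain ⟨b, rfl, hb⟩ := ha
  by_contra! hcon
  refine hx (Ideal.Quotient.eq_zero_iff_mem.mpr ?_)
  have h : Tendsto (fun k => S.size b k) S.ω (𝓝 0) := by
    refine Metric.tendsto_nhds.mpr fun ε hε => ?_
    filter_upwards [hcon ε hε, hb] with k hk hbk
    have e : S.size b k = S.size a k := by rw [ScalingData.size, hbk, ScalingData.size]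
    rwa [e, Real.dist_0_eq_abs, abs_of_nonneg (S.size_nonneg _ k)]
  exact h

lemma eventually_ne_zero (ha : S.Represents a x) (hx : x ≠ 0) :
    ∀ᶠ k in (S.ω : Filter ℕ), a k ≠ 0 := by
  obtain ⟨ε, hε, h⟩ := ha.exists_le_size hx
  filter_upwards [h] with k hk h0
  have : S.size a k = 0 := by
    simp only [ScalingData.size, h0, norm_zero]
    exact Real.zero_rpow (S.exponent_pos k).ne'
  linarith

/-- Entries of size below the bound for a nonzero class are replaced by 0. They form an `ω`-null
set, and `Represents` is insensitive to such changes. -/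
lemma inv (ha : S.Represents a x) (hx : x ≠ 0) : S.Represents (fun k => (a k)⁻¹) x⁻¹ := by
  classical
  obtain ⟨ε, hε, h⟩ := ha.exists_le_size hx
  let y : ℕ → ℂ := fun k => if ε ≤ S.size a k then (a k)⁻¹ else 0
  have hy : y ∈ S.boundedSeq := by
    refine ⟨ε⁻¹ + 1, by positivity, fun k => ?_⟩
    by_cases hk : ε ≤ S.size a k
    · have : ‖y k‖ ^ (1 / S.scale k) = (S.size a k)⁻¹ := by
        have hyk : y k = (a k)⁻¹ := if_pos hk
        rw [hyk, norm_inv]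
        exact Real.inv_rpow (norm_nonneg _) _
      rw [this]
      have := inv_anti₀ hε hk
      linarith
    · have : ‖y k‖ ^ (1 / S.scale k) = 0 := by
        simp only [y, if_neg hk, norm_zero]
        exact Real.zero_rpow (S.exponent_pos k).ne'
      rw [this]
      positivity
  have hne := ha.eventually_ne_zero hx
  obtain ⟨a', rfl, ha⟩ := ha
  refine ⟨⟨y, hy⟩, eq_inv_of_mul_eq_one_left ?_, ?_⟩
  · rw [← map_mul, ← map_one S.toCone]
    refine Ideal.Quotient.eq.mpr ?_
    refine Tendsto.congr' ?_ tendsto_const_nhds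
    filter_upwards [h, hne, ha] with k hk hk0 hka
    have : ((⟨y, hy⟩ * a' - 1 : S.boundedSeq) : ℕ → ℂ) k = 0 := by
      change y k * (a' : ℕ → ℂ) k - 1 = 0
      simp only [y, if_pos hk, hka]
      rw [inv_mul_cancel₀ hk0, sub_self]
    rw [this, norm_zero, Real.zero_rpow (S.exponent_pos k).ne']
  · filter_upwards [h] with k hk
    exact if_pos hk

lemma div (ha : S.Represents a x) (hb : S.Represents b y) (hy : y ≠ 0) :
    S.Represents (fun k => a k / b k) (x / y) := by
  simpa only [div_eq_mul_inv] using ha.mul (hb.inv hy)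

/-- Sequences of the same class are asymptotic along `ω`. -/
lemma tendsto_sub (ha : S.Represents a x) (hb : S.Represents b x) :
    Tendsto (fun k => a k - b k) S.ω (𝓝 0) := by
  obtain ⟨a', rfl, ha⟩ := ha
  obtain ⟨b', hab, hb⟩ := hb
  have h : Tendsto (fun k => S.size ((a' - b' : S.boundedSeq) : ℕ → ℂ) k) S.ω (𝓝 0) :=
    Ideal.Quotient.eq.mp hab.symm
  refine squeeze_zero_norm' ?_ h
  filter_upwards [h.eventually (gt_mem_nhds one_pos), ha, hb] with k hk hka hkb
  have e : ((a' - b' : S.boundedSeq) : ℕ → ℂ) k = a k - b k := by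
    rw [← hka, ← hkb]
    rfl
  simp only [ScalingData.size, e] at hk ⊢
  -- For numbers below 1 the exponent $1/\lambda_k\le1$ only increases the value, so smallness of
  -- the rescaled difference bounds the difference itself.
  have h1 : ‖a k - b k‖ < 1 := by
    by_contra! h1
    exact absurd hk (not_lt.mpr (Real.one_le_rpow h1 (S.exponent_pos k).le))
  simpa using Real.rpow_le_rpow_of_exponent_ge' (norm_nonneg (a k - b k)) h1.le
    (S.exponent_pos k).le (S.exponent_le_one k)

/-- `D₂^ω(x)` is the `ω`-limit of `D₂` along every sequence representing `x`. -/
lemma tendsto_blochWigner (ha : S.Represents a x) :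
    Tendsto (fun k => blochWigner (a k)) S.ω (𝓝 (omegaBlochWigner S x)) := by
  have hr := S.represents_representative x
  have h1 : Tendsto (fun k => blochWigner (S.representative x k)) S.ω
      (𝓝 (omegaBlochWigner S x)) := by
    -- Boundedness gives an `ω`-limit along the chosen representative, by compactness; uniform
    -- continuity then transfers it to any other sequence of the class.
    have hm : ∀ k, blochWigner (S.representative x k) ∈ Set.Icc (-nu₃) nu₃ := fun k =>
      abs_le.mp (abs_blochWigner_le_nu₃ _)
    obtain ⟨l, -, hl⟩ := (isCompact_Icc (a := -nu₃) (b := nu₃)).ultrafilter_le_nhds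
      (S.ω.map fun k => blochWigner (S.representative x k))
      (le_principal_iff.mpr (Ultrafilter.mem_map.mpr (univ_mem' hm)))
    exact tendsto_nhds_limUnder ⟨l, hl⟩
  have h2 : Tendsto (fun k => blochWigner (a k) - blochWigner (S.representative x k)) S.ω
      (𝓝 0) := by
    have hd : Tendsto (fun k => (a k, S.representative x k)) S.ω (uniformity ℂ) := by
      rw [uniformity_eq_comap_nhds_zero, tendsto_comap_iff]
      simpa [Function.comp_def] using hr.tendsto_sub ha
    have := Tendsto.comp uniformContinuous_blochWigner hd
    rw [uniformity_eq_comap_nhds_zero, tendsto_comap_iff] at this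
    simpa [Function.comp_def] using this.neg
  simpa using h2.add h1

end ScalingData.Represents

open ScalingData in
-- Along representatives each identity holds for `ω`-almost every index, because inequalities
-- between classes hold `ω`-almost everywhere termwise. Uniqueness of limits transfers it.
theorem isBlochFunction_omegaBlochWigner : IsBlochFunction (omegaBlochWigner S) where
  map_inv x := by
    have h := (S.represents_representative x).tendsto_blochWigner.neg
    by_cases hx : x = 0
    · subst hx
      have h0 := Represents.zero (S := S).tendsto_blochWigner
      simp only [blochWigner_zero] at h0
      rw [inv_zero, tendsto_nhds_unique h0 tendsto_const_nhds, neg_zero]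
    · have h' := ((S.represents_representative x).inv hx).tendsto_blochWigner
      simp only [blochWigner_inv] at h'
      exact tendsto_nhds_unique h' h
  map_one_sub x := by
    have h := (S.represents_representative x).tendsto_blochWigner.neg
    have h' := (Represents.one.sub (S.represents_representative x)).tendsto_blochWigner
    simp only [blochWigner_one_sub] at h'
    exact tendsto_nhds_unique h' h
  five_term x y hx0 hx1 hy0 hy1 hxy := by
    have hx := S.represents_representative x
    have hy := S.represents_representative y
    have h1 := Represents.one (S := S)
    have hy1' : 1 - y ≠ 0 := sub_ne_zero.mpr hy1.symm
    have hyi : 1 - y⁻¹ ≠ 0 := sub_ne_zero.mpr fun h => hy1 (inv_eq_one.mp h.symm)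
    have h := (((hx.tendsto_blochWigner.sub hy.tendsto_blochWigner).add
      (hy.div hx hx0).tendsto_blochWigner).sub
      ((h1.sub (hx.inv hx0)).div (h1.sub (hy.inv hy0)) hyi).tendsto_blochWigner).add
      ((h1.sub hx).div (h1.sub hy) hy1').tendsto_blochWigner
    refine tendsto_nhds_unique h (Tendsto.congr' ?_ tendsto_const_nhds)
    filter_upwards [hx.eventually_ne_zero hx0, (hx.sub h1).eventually_ne_zero (sub_ne_zero.mpr hx1),
      hy.eventually_ne_zero hy0, (hy.sub h1).eventually_ne_zero (sub_ne_zero.mpr hy1),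
      (hx.sub hy).eventually_ne_zero (sub_ne_zero.mpr hxy)] with k k1 k2 k3 k4 k5
    exact (blochWigner_five_term _ _ k1 (sub_ne_zero.mp k2) k3 (sub_ne_zero.mp k4)
      (sub_ne_zero.mp k5)).symm

lemma abs_omegaBlochWigner_le (x : S.Cone) : |omegaBlochWigner S x| ≤ nu₃ :=
  le_of_tendsto (S.represents_representative x).tendsto_blochWigner.abs
    (Eventually.of_forall fun _ => abs_blochWigner_le_nu₃ _)

end ConeFunction

/-! ### Comparison with the volumes of the statement -/

section OmegaVolume

variable {S : ScalingData}

/-- The case distinction on distinct points is absorbed by `cross`, which already vanishes when two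
lines coincide. -/
lemma omegaVol_mk (v : Fin 4 → Fin 2 → S.Cone) (hv : ∀ i, v i ≠ 0) :
    omegaVol S (fun i => Projectivization.mk S.Cone (v i) (hv i)) =
      cross (omegaBlochWigner S) (v 0) (v 1) (v 2) (v 3) := by
  classical
  rw [omegaVol]
  split_ifs with h
  · rw [crossRatio_mk, cross]
  · simp only [Function.Injective, not_forall] at h
    obtain ⟨i, j, hij, hne⟩ := h
    obtain ⟨c, hc⟩ := (Projectivization.mk_eq_mk_iff' _ _ _ _ _).mp hij
    have hd : det₂ (v i) (v j) = 0 := by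
      rw [← hc, det₂_smul_left, det₂_self, mul_zero]
    have hd' : det₂ (v j) (v i) = 0 := by rw [det₂_swap, hd, neg_zero]
    refine (cross_eq_zero isBlochFunction_omegaBlochWigner ?_).symm
    fin_cases i <;> fin_cases j <;> simp_all

lemma omegaVolVectors_eq_cross {V : Type} [AddCommGroup V] [Module S.Cone V]
    [Module.Finite S.Cone V] (h : finrank S.Cone V = 2) (v : Fin 4 → V) :
    omegaVolVectors S v = cross (omegaBlochWigner S)
      ((finBasisOfFinrankEq S.Cone V h).equivFun (v 0))
      ((finBasisOfFinrankEq S.Cone V h).equivFun (v 1))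
      ((finBasisOfFinrankEq S.Cone V h).equivFun (v 2))
      ((finBasisOfFinrankEq S.Cone V h).equivFun (v 3)) := by
  classical
  rw [omegaVolVectors]
  split_ifs with h'
  · exact omegaVol_mk (fun i => (finBasisOfFinrankEq S.Cone V h).equivFun (v i)) _
  · obtain ⟨i, hi⟩ : ∃ i, v i = 0 := by
      by_contra! hcon
      exact h' ⟨h, hcon⟩
    have h0 : (finBasisOfFinrankEq S.Cone V h).equivFun (v i) = 0 := by rw [hi, map_zero]
    refine (cross_eq_zero isBlochFunction_omegaBlochWigner ?_).symm
    fin_cases i <;> simp_all [det₂]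

lemma upperSpan_eq {K : Type*} [Field K] {n : ℕ} (F : Fin 4 → AffineFlag K n)
    (J : Fin 4 → Fin n) :
    upperSpan F J = lowerSpan F J ⊔ Submodule.span K (Set.range fun i => (F i).vec (J i)) := by
  rw [upperSpan, lowerSpan, Submodule.span_range_eq_iSup, ← iSup_sup_eq]
  exact iSup_congr fun i => by rw [(F i).space_succ, sup_comm]

lemma omegaVolVectors_quotientVec {n : ℕ} (F : Fin 4 → AffineFlag S.Cone n)
    (J : Fin 4 → Fin n) :
    omegaVolVectors S (quotientVec F J) =
      volMod (omegaBlochWigner S) (lowerSpan F J) fun i => (F i).vec (J i) := by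
  set U := upperSpan F J with hU
  set L := lowerSpan F J with hL
  have hUL := upperSpan_eq F J
  rw [← hU, ← hL] at hUL
  have hLU : L ≤ U := hUL ▸ le_sup_left
  have hq : finrank S.Cone (SpanQuotient F J) + finrank S.Cone L = finrank S.Cone U := by
    have := Submodule.finrank_quotient_add_finrank (L.submoduleOf U)
    rwa [(Submodule.submoduleOfEquivOfLe hLU).finrank_eq] at this
  by_cases h : finrank S.Cone (SpanQuotient F J) = 2
  · set e := (finBasisOfFinrankEq S.Cone (SpanQuotient F J) h).equivFun with he
    -- The chosen coordinates of the quotient space, extended to the whole space, form a chart, so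
    -- they compute `volMod`.
    obtain ⟨φ, hφ⟩ := LinearMap.exists_extend (e.toLinearMap ∘ₗ (L.submoduleOf U).mkQ)
    have hφ' : ∀ u (hu : u ∈ U), φ u = e (Submodule.Quotient.mk ⟨u, hu⟩) := fun u hu =>
      LinearMap.congr_fun hφ ⟨u, hu⟩
    have hker : ∀ u ∈ U, φ u = 0 ↔ u ∈ L := fun u hu => by
      rw [hφ' u hu, LinearEquiv.map_eq_zero_iff, Submodule.Quotient.mk_eq_zero]
      exact Iff.rfl
    have hL0 : L ≤ LinearMap.ker φ := fun u hu => (hker u (hLU hu)).mpr hu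
    have hchart : IsChart L (fun i => (F i).vec (J i)) φ := by
      refine ⟨hL0, fun u hu => ?_, ?_⟩
      · rw [← hUL] at hu
        exact (hker u hu.1).mp hu.2
      · have h1 : U.map φ = ⊤ := by
          refine eq_top_iff.mpr fun w _ => ?_
          obtain ⟨⟨u, hu⟩, hq⟩ := Submodule.Quotient.mk_surjective _ (e.symm w)
          exact ⟨u, hu, by rw [hφ' u hu, hq, e.apply_symm_apply]⟩
        rwa [hUL, Submodule.map_sup, LinearMap.le_ker_iff_map.mp hL0, bot_sup_eq] at h1
    rw [hchart.volMod_eq, omegaVolVectors_eq_cross h]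
    have hv : ∀ i, φ ((F i).vec (J i)) = e (quotientVec F J i) := fun i =>
      hφ' _ (le_iSup (fun i => (F i).space (J i).succ) i ((F i).vec_mem (J i)))
    simp only [hv, he]
  · rw [omegaVolVectors, dif_neg fun h' => h h'.1]
    refine (volMod_eq_zero_of_finrank_ne ?_).symm
    rw [← hUL, ← hq, add_comm]
    exact fun h' => h (Nat.add_left_cancel h')

lemma omegaBorel_eq_affineBorel {n : ℕ} (F : Fin 4 → AffineFlag S.Cone n) :
    omegaBorel S n F = affineBorel (omegaBlochWigner S) F :=
  Finset.sum_congr rfl fun J _ => omegaVolVectors_quotientVec F J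

end OmegaVolume

end OmegaBorel
end


theorem mainTheorem8 (S : OmegaBorel.ScalingData) (n : ℕ) :
    OmegaBorel.IsBoundedAlternatingInvariantCocycle
      (GL (Fin n) S.Cone) (OmegaBorel.omegaBorel S n) ∧
    ∃ b : (Fin 4 → OmegaBorel.CompleteFlag S.Cone n) → ℝ,
      (∀ F : Fin 4 → OmegaBorel.AffineFlag S.Cone n,
        OmegaBorel.omegaBorel S n F = b (fun i => (F i).toCompleteFlag)) ∧
      OmegaBorel.IsBoundedAlternatingInvariantCocycle (GL (Fin n) S.Cone) b ∧
      ∀ F : Fin 4 → OmegaBorel.CompleteFlag S.Cone n,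
        |b F| ≤ (n : ℝ) * ((n : ℝ) ^ 2 - 1) / 6 * OmegaBorel.nu₃ := by
  have hf := OmegaBorel.isBlochFunction_omegaBlochWigner (S := S)
  have hB : OmegaBorel.omegaBorel S n =
      OmegaBorel.affineBorel (n := n) (OmegaBorel.omegaBlochWigner S) :=
    funext fun F => OmegaBorel.omegaBorel_eq_affineBorel F
  have hbound := OmegaBorel.abs_affineBorel_le (n := n) hf OmegaBorel.abs_omegaBlochWigner_le
  -- The descended function evaluates the affine one on arbitrary lifts. The lifts need not be
  -- equivariant, since the value depends only on the underlying flags.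
  choose lift hlift using
    OmegaBorel.CompleteFlag.exists_affineFlag (K := S.Cone) (n := n)
  rw [hB]
  refine ⟨⟨⟨_, hbound⟩, OmegaBorel.affineBorel_comp_perm hf, OmegaBorel.affineBorel_smul,
    OmegaBorel.affineBorel_cocycle hf⟩,
    fun F => OmegaBorel.affineBorel (OmegaBorel.omegaBlochWigner S) (lift ∘ F),
    fun F => OmegaBorel.affineBorel_congr hf fun i => (hlift _).symm,
    ⟨⟨_, fun F => hbound _⟩, fun σ F => OmegaBorel.affineBorel_comp_perm hf σ (lift ∘ F),
      fun g F => ?_, fun F => OmegaBorel.affineBorel_cocycle hf (lift ∘ F)⟩, fun F => hbound _⟩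
  rw [← OmegaBorel.affineBorel_smul g (lift ∘ F)]
  refine OmegaBorel.affineBorel_congr hf fun i => ?_
  change (lift (g • F i)).toCompleteFlag = g • (lift (F i)).toCompleteFlag
  rw [hlift, hlift]
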